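/- **Setting.** Let $d\ge 1$, $s\in(0,1/2)$, and let $\Omega\subset\mathbb R^d$ be a bounded Lipschitz domain, $\Omega^c=\mathbb R^d\setminus\Omega$, $Q_\Omega=(\mathbb R^d\times\mathbb R^d)\setminus(\Omega^c\times\Omega^c)$. Let $g\in L^\infty(\mathbb R^d)$ have compact support, contained in a bounded set $\Lambda$ whose interior contains $\overline\Omega$ (it suffices that $g=0$ a.e. outside $\Lambda$). For $\sigma\in(0,1)$ let $\|v\|_{W^{\sigma}_1(\Omega)}=\|v\|_{L^1(\Omega)}+\iint_{\Omega\times\Omega}\frac{|v(x)-v(y)|}{|x-y|^{d+\sigma}}\,dx\,dy$, and $W^0_1(\Omega)=L^1(\Omega)$. Let $$\mathbb V^g=\Big\{v:\mathbb R^d\to\mathbb R\ :\ v|_\Omega\in W^{2s}_1(\Omega),\ v=g \text{ a.e. in }\Omega^c,\ \iint_{Q_\Omega}\frac{|v(x)-v(y)|}{|x-y|^{d+2s}}\,dx\,dy<\infty\Big\},$$ and define the energy $$I_s[v]=\iint_{Q_\Omega}F_s\Big(\frac{v(x)-v(y)}{|x-y|}\Big)\frac{dx\,dy}{|x-y|^{d+2s-1}},\qquad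 F_s(\rho)=\int_0^\rho\frac{\rho-r}{(1+r^2)^{(d+1+2s)/2}}\,dr,$$ and, with $\widetilde G_s(\rho)=\int_0^1(1+\rho^2r^2)^{-(d+1+2s)/2}\,dr$, the form $$a_u(w,v)=\iint_{Q_\Omega}\widetilde G_s\Big(\frac{u(x)-u(y)}{|x-y|}\Big)\frac{(w(x)-w(y))(v(x)-v(y))}{|x-y|^{d+1+2s}}\,dx\,dy .$$ **Continuous problem.** Let $u\in\mathbb V^g$ be the nonlocal minimal graph, i.e. the solution of $a_u(u,v)=0$ for all $v\in\mathbb V^0$, or (equivalently) the minimizer of $I_s$ over $\mathbb V^g$. **Discretization.** Let $\{\mathcal T_h\}$ be a family of conforming simplicial meshes of $\Lambda$ (finitely many closed $d$-simplices, any two of which meet in a common face or not at all, with union $\Lambda$), such that $\overline\Omega$ is a union of elements of each $\mathcal T_h$, and shape-regular: there is $\sigma$ with $\operatorname{diam}T\le\sigma\rho_T$ for all elements $T$ of all meshes, $\rho_T$ being the diameter of the largest ball contained in $T$. Write $h=\max_{T\in\mathcal T_h}\operatorname{diam}T$. Let $\mathbb V_h$ be the space of continuous functions on $\Lambda$ that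 are affine on each element, extended by $0$ to $\mathbb R^d$; let $\varphi_i$ be its Lagrange basis function at the vertex $x_i$ and $S_i=\operatorname{supp}\varphi_i$. Define the exterior Clément interpolant $$\Pi_h^c g=\sum_{x_i\in\Omega^c}(\Pi_h^{x_i}g)(x_i)\,\varphi_i,$$ where $\Pi_h^{x_i}g$ is the $L^2$-projection of $g|_{S_i\cap\Omega^c}$ onto the affine functions on $S_i\cap\Omega^c$, and set $\mathbb V_h^g=\{v\in\mathbb V_h: v=\Pi_h^c g\text{ on }\Lambda\setminus\Omega\}$. Let $u_h\in\mathbb V_h^g$ be the solution of $a_{u_h}(u_h,v_h)=0$ for all $v_h\in\mathbb V_h^0$, or (equivalently) the minimizer of $I_s$ over $\mathbb V_h^g$. **Theorem (convergence).** For every $r\in[0,s)$, $$\lim_{h\to0}\|u-u_h\|_{W^{2r}_1(\Omega)}=0 .$$ No regularity of $u$ beyond $u\in\mathbb V^g$ is assumed. -/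

import Mathlib

open MeasureTheory Filter Topology Set
open scoped ENNReal

noncomputable section

namespace NonlocalGraph

/-! ### Domains -/

/-- The Euclidean space `ℝ^d`. -/
abbrev Eucl (d : ℕ) : Type := EuclideanSpace ℝ (Fin d)

/-- Bounded Lipschitz domain: a bounded, open, connected (nonempty) set which, near each of its
boundary points and for a suitable unit vector `e`, is the set of points lying above the graph of
a Lipschitz function of the variable in the hyperplane orthogonal to `e`. -/
structure IsBoundedLipschitzDomain {d : ℕ} (Ω : Set (Eucl d)) : Prop where
  isOpen : IsOpen Ω
  isConnected : IsConnected Ω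
  isBounded : Bornology.IsBounded Ω
  lipschitz : ∀ p ∈ frontier Ω, ∃ e : Eucl d, ‖e‖ = 1 ∧
    ∃ (L : NNReal) (φ : (ℝ ∙ e)ᗮ → ℝ), LipschitzWith L φ ∧
      ∃ U : Set (Eucl d), IsOpen U ∧ p ∈ U ∧
        ∀ x ∈ U, (x ∈ Ω ↔ φ ((ℝ ∙ e)ᗮ.orthogonalProjectionOnto x) < inner ℝ e x)

/-- `Q_Ω = (ℝ^d × ℝ^d) \ (Ω^c × Ω^c)`. -/
def Q {d : ℕ} (Ω : Set (Eucl d)) : Set (Eucl d × Eucl d) := (Ωᶜ ×ˢ Ωᶜ)ᶜ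

/-! ### Fractional Sobolev spaces, the nonlocal area energy, and the continuous problem -/

/-- The double integral of `|v(x) - v(y)| / |x - y|^(d + σ)` over `A ⊆ ℝ^d × ℝ^d`. -/
def gagliardo {d : ℕ} (σ : ℝ) (A : Set (Eucl d × Eucl d)) (v : Eucl d → ℝ) : ℝ≥0∞ :=
  ∫⁻ z in A, ENNReal.ofReal (|v z.1 - v z.2| / ‖z.1 - z.2‖ ^ ((d : ℝ) + σ))

/-- The norm of `W^σ_1(Ω)` for `0 ≤ σ < 1` (with value `∞` outside the space): the `L^1(Ω)` norm
plus the Gagliardo seminorm, with the usual convention `W^0_1(Ω) = L^1(Ω)`. -/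
def sobolevNorm {d : ℕ} (σ : ℝ) (Ω : Set (Eucl d)) (v : Eucl d → ℝ) : ℝ≥0∞ :=
  eLpNorm v 1 (volume.restrict Ω) + if σ = 0 then 0 else gagliardo σ (Ω ×ˢ Ω) v

/-- The restriction of `v` to `Ω` belongs to `W^σ_1(Ω)`, `0 ≤ σ < 1`. -/
def MemSobolev {d : ℕ} (σ : ℝ) (Ω : Set (Eucl d)) (v : Eucl d → ℝ) : Prop :=
  AEStronglyMeasurable v (volume.restrict Ω) ∧ sobolevNorm σ Ω v < ∞

/-- The space `𝕍^g`: functions with restriction to `Ω` in `W^{2s}_1(Ω)`, equal to `g` (almost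
everywhere) in `Ω^c`, and with finite seminorm over `Q_Ω`. -/
def energySpace {d : ℕ} (s : ℝ) (Ω : Set (Eucl d)) (g : Eucl d → ℝ) : Set (Eucl d → ℝ) :=
  {v | MemSobolev (2 * s) Ω v ∧ (∀ᵐ x, x ∉ Ω → v x = g x) ∧ gagliardo (2 * s) (Q Ω) v < ∞}

/-- `F_s(ρ) = ∫_0^ρ (ρ - r) / (1 + r²)^((d + 1 + 2s)/2) dr`. -/
def F (d : ℕ) (s ρ : ℝ) : ℝ :=
  ∫ r in (0 : ℝ)..ρ, (ρ - r) / (1 + r ^ 2) ^ (((d : ℝ) + 1 + 2 * s) / 2)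

/-- `G̃_s(ρ) = ∫_0^1 (1 + ρ² r²)^(-(d + 1 + 2s)/2) dr`. -/
def Gtilde (d : ℕ) (s ρ : ℝ) : ℝ :=
  ∫ r in (0 : ℝ)..1, (1 + ρ ^ 2 * r ^ 2) ^ (-(((d : ℝ) + 1 + 2 * s) / 2))

/-- The energy `I_s[v]`, the integral over `Q_Ω` of the nonnegative function
`F_s((v(x) - v(y)) / |x - y|) / |x - y|^(d + 2s - 1)`. -/
def energy {d : ℕ} (s : ℝ) (Ω : Set (Eucl d)) (v : Eucl d → ℝ) : ℝ≥0∞ :=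
  ∫⁻ z in Q Ω, ENNReal.ofReal
    (F d s ((v z.1 - v z.2) / ‖z.1 - z.2‖) / ‖z.1 - z.2‖ ^ ((d : ℝ) + 2 * s - 1))

/-- The form `a_u(w, v)`. -/
def form {d : ℕ} (s : ℝ) (Ω : Set (Eucl d)) (u w v : Eucl d → ℝ) : ℝ :=
  ∫ z in Q Ω, Gtilde d s ((u z.1 - u z.2) / ‖z.1 - z.2‖) *
    ((w z.1 - w z.2) * (v z.1 - v z.2) / ‖z.1 - z.2‖ ^ ((d : ℝ) + 1 + 2 * s))

/-- `u` minimizes `I_s` over the class `V`. -/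
def IsMinimizerOver {d : ℕ} (s : ℝ) (Ω : Set (Eucl d)) (V : Set (Eucl d → ℝ))
    (u : Eucl d → ℝ) : Prop :=
  u ∈ V ∧ ∀ v ∈ V, energy s Ω u ≤ energy s Ω v

/-- `u` belongs to the trial class `V` and `a_u(u, v) = 0` for all `v` in the test class `V₀`. -/
def IsWeakSolutionOver {d : ℕ} (s : ℝ) (Ω : Set (Eucl d)) (V V₀ : Set (Eucl d → ℝ))
    (u : Eucl d → ℝ) : Prop :=
  u ∈ V ∧ ∀ v ∈ V₀, form s Ω u u v = 0

/-! ### Meshes -/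

/-- A simplicial complex in `ℝ^d`, as a family of vertex sets of (nondegenerate) simplices. -/
abbrev Cplx (d : ℕ) : Type := Geometry.SimplicialComplex ℝ (Eucl d)

/-- The vertex sets of the elements, i.e. of the `d`-dimensional simplices. -/
def cells {d : ℕ} (K : Cplx d) : Set (Finset (Eucl d)) := {t | t ∈ K.faces ∧ t.card = d + 1}

/-- The (closed) element with vertex set `t`. -/
def elt {d : ℕ} (t : Finset (Eucl d)) : Set (Eucl d) := convexHull ℝ (t : Set (Eucl d))

/-- `K` is a conforming simplicial mesh of `Λ` that exactly meshes `Ω`: it is a finite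
simplicial complex, each of its simplices is a face of an element, the elements cover exactly `Λ`,
and some of them cover exactly the closure of `Ω`. -/
structure IsMesh {d : ℕ} (Λ Ω : Set (Eucl d)) (K : Cplx d) : Prop where
  finite : K.faces.Finite
  pure : ∀ f ∈ K.faces, ∃ t ∈ cells K, f ⊆ t
  covers : ⋃ t ∈ cells K, elt t = Λ
  exact : ⋃ t ∈ {t ∈ cells K | elt t ⊆ closure Ω}, elt t = closure Ω

/-- `ρ_T`: the diameter of the largest ball contained in `T`. -/
def inDiam {d : ℕ} (T : Set (Eucl d)) : ℝ :=
  sSup {ρ : ℝ | 0 ≤ ρ ∧ ∃ c, Metric.closedBall c (ρ / 2) ⊆ T}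

/-- The mesh size: the largest diameter of an element. -/
def meshSize {d : ℕ} (K : Cplx d) : ℝ := sSup ((fun t => Metric.diam (elt t)) '' cells K)

/-! ### Finite element spaces -/

/-- `w` is the family of barycentric coordinates of `x` in `K`, extended by `0` to the vertices
that do not belong to the simplex `t`. -/
def IsBary {d : ℕ} (K : Cplx d) (x : Eucl d) (w : Eucl d → ℝ) : Prop :=
  ∃ t ∈ K.faces, (∀ p ∈ t, 0 ≤ w p) ∧ (∀ p ∉ t, w p = 0) ∧ ∑ p ∈ t, w p = 1 ∧
    ∑ p ∈ t, w p • p = x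

/-- Barycentric coordinates in a simplicial complex are unique. -/
theorem IsBary.unique {d : ℕ} {K : Cplx d} {x : Eucl d} {w w' : Eucl d → ℝ}
    (h : IsBary K x w) (h' : IsBary K x w') : w = w' := by
  classical
  have key : ∀ (t : Finset (Eucl d)), t ∈ K.faces → ∀ a b : Eucl d → ℝ,
      (∀ p ∉ t, a p = 0) → (∀ p ∉ t, b p = 0) → ∑ p ∈ t, a p = 1 → ∑ p ∈ t, b p = 1 →
      ∑ p ∈ t, a p • p = ∑ p ∈ t, b p • p → a = b := by
    intro t ht a b ha hb ha1 hb1 hab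
    have hi := K.indep ht
    rw [affineIndependent_iff] at hi
    have := hi Finset.univ (fun p => a p - b p) (by
      rw [Finset.univ_eq_attach, Finset.sum_attach t (fun p => a p - b p)]
      simp [Finset.sum_sub_distrib, ha1, hb1]) (by
      rw [Finset.univ_eq_attach, Finset.sum_attach t (fun p => (a p - b p) • p)]
      simp [sub_smul, Finset.sum_sub_distrib, hab])
    funext p
    by_cases hp : p ∈ t
    · have := this ⟨p, hp⟩ (by simp)
      simpa [sub_eq_zero] using this
    · rw [ha p hp, hb p hp]
  obtain ⟨t, ht, h0, hn, h1, hx⟩ := h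
  obtain ⟨t', ht', h0', hn', h1', hx'⟩ := h'
  have hm : x ∈ convexHull ℝ (t : Set (Eucl d)) := Finset.mem_convexHull'.2 ⟨w, h0, h1, hx⟩
  have hm' : x ∈ convexHull ℝ (t' : Set (Eucl d)) := Finset.mem_convexHull'.2 ⟨w', h0', h1', hx'⟩
  have := K.inter_subset_convexHull ht ht' ⟨hm, hm'⟩
  rw [← Finset.coe_inter] at this
  obtain ⟨v, hv0, hv1, hvx⟩ := Finset.mem_convexHull'.1 this
  let v' : Eucl d → ℝ := fun p => if p ∈ t ∩ t' then v p else 0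
  have e1 : ∀ r : Finset (Eucl d), t ∩ t' ⊆ r → ∑ p ∈ r, v' p = 1 ∧ ∑ p ∈ r, v' p • p = x := by
    intro r hr
    constructor
    · rw [← hv1, ← Finset.sum_subset hr]
      · exact Finset.sum_congr rfl fun p hp => if_pos hp
      · intro p _ hp; exact if_neg hp
    · rw [← hvx, ← Finset.sum_subset hr]
      · exact Finset.sum_congr rfl fun p hp => by simp only [v', if_pos hp]
      · intro p _ hp; simp only [v', if_neg hp, zero_smul]
  have a1 := key t ht w v' hn (fun p hp => if_neg (by simp [hp])) h1
    (e1 t Finset.inter_subset_left).1 (hx.trans (e1 t Finset.inter_subset_left).2.symm)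
  have a2 := key t' ht' w' v' hn' (fun p hp => if_neg (by simp [hp])) h1'
    (e1 t' Finset.inter_subset_right).1 (hx'.trans (e1 t' Finset.inter_subset_right).2.symm)
  rw [a1, a2]

open Classical in
/-- The Lagrange basis function at the vertex `p`: in the mesh, its value at `x` is the
barycentric coordinate of `x` at `p`; it is extended by `0` outside the mesh. -/
def hat {d : ℕ} (K : Cplx d) (p x : Eucl d) : ℝ :=
  if h : ∃ w, IsBary K x w then h.choose p else 0

theorem hat_eq {d : ℕ} {K : Cplx d} {x : Eucl d} {w : Eucl d → ℝ} (h : IsBary K x w)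
    (p : Eucl d) : hat K p x = w p := by
  have hex : ∃ w, IsBary K x w := ⟨w, h⟩
  rw [hat, dif_pos hex, hex.choose_spec.unique h]

/-- The star of the node `p`: the union of the elements containing `p` (the support of the
basis function at `p`). -/
def star {d : ℕ} (K : Cplx d) (p : Eucl d) : Set (Eucl d) :=
  ⋃ t ∈ {t ∈ cells K | p ∈ elt t}, elt t

/-- `q` is the `L²`-projection of `g` (restricted to `A`) onto the affine functions on `A`. -/
def IsL2Proj {d : ℕ} (A : Set (Eucl d)) (g : Eucl d → ℝ) (q : Eucl d →ᵃ[ℝ] ℝ) : Prop :=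
  ∀ p : Eucl d →ᵃ[ℝ] ℝ, ∫ x in A, (g x - q x) * p x = 0

/-- The `L²`-projection of `g` (restricted to `A`) onto the affine functions on `A`. -/
def l2Proj {d : ℕ} (A : Set (Eucl d)) (g : Eucl d → ℝ) : Eucl d →ᵃ[ℝ] ℝ :=
  Classical.epsilon (IsL2Proj A g)

/-- The exterior Clément interpolant `Π_h^c g`, a sum over the nodes in `Ω^c`. -/
def exteriorClement {d : ℕ} (K : Cplx d) (Ω : Set (Eucl d)) (g : Eucl d → ℝ) (x : Eucl d) : ℝ :=
  ∑ᶠ p ∈ K.vertices \ Ω, l2Proj (star K p ∩ Ωᶜ) g p * hat K p x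

/-- The space `𝕍_h`: continuous functions on `Λ` that are affine on each element; they are
regarded as functions on `ℝ^d` through the extension by `0`. -/
def feSpace {d : ℕ} (Λ : Set (Eucl d)) (K : Cplx d) : Set (Eucl d → ℝ) :=
  {v | ContinuousOn v Λ ∧ (∀ t ∈ cells K, ∃ q : Eucl d →ᵃ[ℝ] ℝ, EqOn v q (elt t)) ∧
    ∀ x ∉ Λ, v x = 0}

/-- The space `𝕍_h^g`: the functions of `𝕍_h` that coincide with `Π_h^c g` on `Λ \ Ω`. -/
def feSpaceBC {d : ℕ} (Λ Ω : Set (Eucl d)) (K : Cplx d) (g : Eucl d → ℝ) : Set (Eucl d → ℝ) :=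
  {v | v ∈ feSpace Λ K ∧ EqOn v (exteriorClement K Ω g) (Λ \ Ω)}

end NonlocalGraph

end

noncomputable section

namespace NonlocalGraph

section

/-! ### The scalar energy density -/

/-! The density `F` is even, strictly convex, has slope at most 2 and grows linearly. Hence `I_s` is
controlled by the `2s`-seminorm over `Q_Ω`, even continuous with respect to it (`energy_le_add`),
and it controls the seminorm up to lower-order terms (`gagliardo_prod_le_energy`). Convexity turns
the weak equations, continuous and discrete, into minimality (`energy_le_of_form_eq_zero`), so only
minimizers have to be compared.

Consistency (`exists_consistent`): some `w` in the discrete class is arbitrarily close to `u` in the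
seminorm over `Q_Ω`. Inside `Ω`, `u` is approximated by a bounded Lipschitz `ψ`
(`exists_lipschitz_approx`), and `w` takes the nodal values of `ψ` at nodes in `Ω` and those of the
Clément interpolant at the others. The error has an interpolation part of order `h^(1-2s)`, a
bounded mismatch on the cells with a node outside `Ω`, and the exterior Clément error. The last two
vanish because `2s < 1`: `dist(x, Ωᶜ)^(-2s)` is integrable over a Lipschitz domain, so a thin
boundary layer costs little, and a bounded error that is small in `L¹(Ωᶜ)` stays small against the
integrable kernel weight (`exists_gagliardo_strip_le`, `exists_gagliardo_interp_sub_le`,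
`exists_lintegral_outer_le`).

Stability uses strict convexity quantitatively instead of weak compactness. Put `e = u_h - w`, which
vanishes off `Ω`. Then `u + e` nearly minimizes the energy while `u + e/2` is admissible, so the
integrated midpoint convexity defect of the energy between `u` and `u + e` is small
(`energyGap_le`). Testing it on pairs `(x, y)` with `y` in a distant ball, where both `u` and `e`
vanish, shows that `e` is small in measure (`exists_measure_le_of_energyGap_le`). Coercivity bounds
the `2s`-seminorm of `e`, and a bounded seminorm with smallness in measure yields smallness in `L¹`
(`exists_lintegral_le_of_measure_le`). Splitting pairs into near and far ones finally interpolates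
between the bounded `2s`-seminorm and the vanishing `L¹` norm, for every `r < s`
(`gagliardo_interpolation`). -/

/-- The weight `(1 + r²)^(-(d + 1 + 2s)/2)`, which is the second derivative of `F d s`. -/
def F'' (d : ℕ) (s r : ℝ) : ℝ := (1 + r ^ 2) ^ (-(((d : ℝ) + 1 + 2 * s) / 2))

/-- The derivative of `F d s`. -/
def F' (d : ℕ) (s ρ : ℝ) : ℝ := ∫ r in (0 : ℝ)..ρ, F'' d s r

variable {d : ℕ} {s : ℝ}

theorem F''_pos (r : ℝ) : 0 < F'' d s r := Real.rpow_pos_of_pos (by positivity) _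

theorem continuous_F'' : Continuous (F'' d s) := by
  unfold F''
  exact (continuous_const.add (continuous_id.pow 2)).rpow_const fun x =>
    Or.inl (show (1 + x ^ 2 : ℝ) ≠ 0 by positivity)

theorem F''_neg (r : ℝ) : F'' d s (-r) = F'' d s r := by simp [F'']

theorem hasDerivAt_F' (ρ : ℝ) : HasDerivAt (F' d s) (F'' d s ρ) ρ :=
  intervalIntegral.integral_hasDerivAt_right (continuous_F''.intervalIntegrable _ _)
    (continuous_F''.stronglyMeasurableAtFilter _ _) continuous_F''.continuousAt

theorem continuous_F' : Continuous (F' d s) :=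
  continuous_iff_continuousAt.2 fun ρ => (hasDerivAt_F' ρ).continuousAt

theorem strictMono_F' : StrictMono (F' d s) :=
  strictMono_of_hasDerivAt_pos hasDerivAt_F' fun ρ => F''_pos ρ

theorem F'_zero : F' d s 0 = 0 := by simp [F']

/-- Frees the integrand from the parameter `ρ`, so that differentiation needs only the fundamental
theorem of calculus. -/
theorem F_eq (ρ : ℝ) : F d s ρ = ρ * F' d s ρ - ∫ r in (0 : ℝ)..ρ, r * F'' d s r := by
  have h1 : ρ * F' d s ρ = ∫ r in (0 : ℝ)..ρ, ρ * F'' d s r := by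
    rw [F', intervalIntegral.integral_const_mul]
  rw [h1, ← intervalIntegral.integral_sub]
  · unfold F
    refine intervalIntegral.integral_congr fun r _ => ?_
    simp only [F'']
    rw [Real.rpow_neg (by positivity)]
    ring
  · exact (continuous_const.mul continuous_F'').intervalIntegrable _ _
  · exact (continuous_id.mul continuous_F'').intervalIntegrable _ _

theorem hasDerivAt_F (ρ : ℝ) : HasDerivAt (F d s) (F' d s ρ) ρ := by
  have hc : Continuous fun r => r * F'' d s r := continuous_id.mul continuous_F''
  have h2 : HasDerivAt (fun ρ => ∫ r in (0 : ℝ)..ρ, r * F'' d s r) (ρ * F'' d s ρ) ρ :=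
    intervalIntegral.integral_hasDerivAt_right (hc.intervalIntegrable _ _)
      (hc.stronglyMeasurableAtFilter _ _) hc.continuousAt
  have := ((hasDerivAt_id ρ).mul (hasDerivAt_F' (d := d) (s := s) ρ)).sub h2
  have e : F d s = fun ρ => ρ * F' d s ρ - ∫ r in (0 : ℝ)..ρ, r * F'' d s r := funext F_eq
  rw [e]
  convert! this using 1
  simp

theorem continuous_F : Continuous (F d s) :=
  continuous_iff_continuousAt.2 fun ρ => (hasDerivAt_F ρ).continuousAt

theorem F_zero : F d s 0 = 0 := by simp [F]

/-- Substitution `r ↦ ρ r`. It identifies `form s Ω u u v` as the first variation of the energy at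
`u` in direction `v`. -/
theorem F'_eq (ρ : ℝ) : F' d s ρ = Gtilde d s ρ * ρ := by
  have := intervalIntegral.mul_integral_comp_mul_left (f := F'' d s) (a := 0) (b := 1) ρ
  simp only [mul_zero, mul_one] at this
  rw [F', ← this, mul_comm]
  congr 1
  refine intervalIntegral.integral_congr fun r _ => ?_
  simp only [F'', mul_pow]

theorem strictConvexOn_F : StrictConvexOn ℝ univ (F d s) := by
  apply StrictMonoOn.strictConvexOn_of_deriv convex_univ continuous_F.continuousOn
  have : deriv (F d s) = F' d s := funext fun ρ => (hasDerivAt_F ρ).deriv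
  rw [this]
  exact strictMono_F'.strictMonoOn _

theorem F_tangent (a b : ℝ) : F d s a + F' d s a * (b - a) ≤ F d s b := by
  have hc : ConvexOn ℝ univ (F d s) := strictConvexOn_F.convexOn
  rcases lt_trichotomy a b with h | h | h
  · have := hc.le_slope_of_hasDerivAt (mem_univ a) (mem_univ b) h (hasDerivAt_F a)
    rw [slope_def_field, le_div_iff₀ (by linarith)] at this
    linarith
  · simp [h]
  · have := hc.slope_le_of_hasDerivAt (mem_univ b) (mem_univ a) h (hasDerivAt_F a)
    rw [slope_def_field, div_le_iff₀ (by linarith)] at this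
    linarith

theorem F_nonneg (ρ : ℝ) : 0 ≤ F d s ρ := by
  have := F_tangent (d := d) (s := s) 0 ρ
  simpa [F_zero, F'_zero] using this

theorem F_pos {ρ : ℝ} (h : ρ ≠ 0) : 0 < F d s ρ := by
  have h2 := (strictConvexOn_F (d := d) (s := s)).2 (mem_univ 0) (mem_univ ρ) h.symm
    (show (0:ℝ) < 1/2 by norm_num) (show (0:ℝ) < 1/2 by norm_num) (by norm_num)
  have h3 := F_nonneg (d := d) (s := s) ((1/2 : ℝ) • (0:ℝ) + (1/2:ℝ) • ρ)
  rw [F_zero] at h2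
  simp only [smul_eq_mul] at h2 h3
  linarith

theorem F_neg (ρ : ℝ) : F d s (-ρ) = F d s ρ := by
  unfold F
  have := intervalIntegral.integral_comp_neg (a := 0) (b := ρ)
    (fun r => (-ρ - r) / (1 + r ^ 2) ^ (((d : ℝ) + 1 + 2 * s) / 2))
  rw [neg_zero] at this
  rw [intervalIntegral.integral_symm, ← this, ← intervalIntegral.integral_neg]
  refine intervalIntegral.integral_congr fun r _ => ?_
  simp only [neg_sq]
  ring

/-- By evenness take `ρ ≥ 0`. Below 1 the left side is nonpositive; above 1 use the tangent at 1,
whose slope is at least `F d s 1` because that tangent lies below `F` at 0. This is the coercivity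
of the energy. -/
theorem F_growth (ρ : ℝ) : F d s 1 * (|ρ| - 1) ≤ F d s ρ := by
  wlog h : 0 ≤ ρ generalizing ρ
  · have := this (-ρ) (by linarith)
    rwa [F_neg, abs_neg] at this
  rw [abs_of_nonneg h]
  have h1 := F_tangent (d := d) (s := s) 1 ρ
  have h2 := F_tangent (d := d) (s := s) 1 0
  rw [F_zero] at h2
  have h3 := F_nonneg (d := d) (s := s) ρ
  have h4 := F_pos (d := d) (s := s) one_ne_zero
  rcases le_total ρ 1 with h5 | h5
  · nlinarith
  · nlinarith

/-- The exponent `(d + 1 + 2s)/2` is at least 1, so the weight is dominated by `1/(1 + r²)`, and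
`arctan` stays below `π/2 ≤ 2`. -/
theorem abs_F'_le (hd : 1 ≤ d) (hs : 0 ≤ s) (ρ : ℝ) : |F' d s ρ| ≤ 2 := by
  have key : ∀ x : ℝ, 0 ≤ x → |F' d s x| ≤ 2 := by
    intro x hx
    have hnn : 0 ≤ F' d s x :=
      intervalIntegral.integral_nonneg hx fun u _ => (F''_pos u).le
    rw [abs_of_nonneg hnn]
    have h1 : F' d s x ≤ ∫ r in (0:ℝ)..x, (1 + r ^ 2)⁻¹ := by
      apply intervalIntegral.integral_mono_on hx (continuous_F''.intervalIntegrable _ _)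
      · apply Continuous.intervalIntegrable
        exact (continuous_const.add (continuous_id.pow 2)).inv₀ fun x =>
          (show (1 + x ^ 2 : ℝ) ≠ 0 by positivity)
      · intro r _
        rw [F'', ← Real.rpow_neg_one]
        apply Real.rpow_le_rpow_of_exponent_le (by nlinarith [sq_nonneg r])
        have : (1:ℝ) ≤ d := by exact_mod_cast hd
        linarith
    rw [integral_inv_one_add_sq] at h1
    have := Real.arctan_lt_pi_div_two x
    have := Real.pi_le_four
    simp at h1
    linarith
  rcases le_total 0 ρ with h | h
  · exact key ρ h
  · have h2 : F' d s ρ = - F' d s (-ρ) := by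
      have := intervalIntegral.integral_comp_neg (a := 0) (b := -ρ) (F'' d s)
      simp only [F''_neg, neg_zero, neg_neg] at this
      rw [F', F', this, intervalIntegral.integral_symm]
    rw [h2, abs_neg]
    exact key _ (by linarith)

theorem F_sub_le (hd : 1 ≤ d) (hs : 0 ≤ s) (a b : ℝ) : F d s a - F d s b ≤ 2 * |a - b| := by
  have h := F_tangent (d := d) (s := s) a b
  have h2 := abs_F'_le hd hs a
  have h3 : F' d s a * (a - b) ≤ |F' d s a| * |a - b| := by
    rw [← abs_mul]; exact le_abs_self _
  have h4 : |F' d s a| * |a - b| ≤ 2 * |a - b| := by gcongr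
  nlinarith

/-- The convexity defect of `F d s` at the midpoint. -/
def convexityGap (d : ℕ) (s a b : ℝ) : ℝ :=
  (F d s a + F d s b) / 2 - F d s ((a + b) / 2)

theorem continuous_convexityGap : Continuous fun x : ℝ × ℝ => convexityGap d s x.1 x.2 := by
  have := continuous_F (d := d) (s := s)
  unfold convexityGap
  fun_prop

theorem convexityGap_nonneg (a b : ℝ) : 0 ≤ convexityGap d s a b := by
  have h1 := F_tangent (d := d) (s := s) ((a + b) / 2) a
  have h2 := F_tangent (d := d) (s := s) ((a + b) / 2) b
  unfold convexityGap
  nlinarith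

theorem convexityGap_pos {a b : ℝ} (h : a ≠ b) : 0 < convexityGap d s a b := by
  have h2 := (strictConvexOn_F (d := d) (s := s)).2 (mem_univ a) (mem_univ b) h
    (show (0:ℝ) < 1/2 by norm_num) (show (0:ℝ) < 1/2 by norm_num) (by norm_num)
  simp only [smul_eq_mul] at h2
  rw [show 1 / 2 * a + 1 / 2 * b = (a + b) / 2 by ring] at h2
  unfold convexityGap
  linarith

/-- The derivative is `t/2` times an increment of `F'` in the direction of `t`, hence nonnegative.
Large increments thereby reduce to increments of a fixed size. -/
theorem convexityGap_monotoneOn (a t : ℝ) :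
    MonotoneOn (fun l => convexityGap d s a (a + l * t)) (Ici 0) := by
  have hder : ∀ l, HasDerivAt (fun l => convexityGap d s a (a + l * t))
      (t / 2 * (F' d s (a + l * t) - F' d s (a + l * t / 2))) l := by
    intro l
    have e : (fun l => convexityGap d s a (a + l * t)) = fun l =>
        (F d s a + F d s (a + l * t)) / 2 - F d s (a + l * t / 2) := by
      funext l
      rw [convexityGap]
      ring_nf
    rw [e]
    have l1 : HasDerivAt (fun l : ℝ => a + l * t) t l := by
      simpa using ((hasDerivAt_id l).mul_const t).const_add a
    have l2 : HasDerivAt (fun l : ℝ => a + l * t / 2) (t / 2) l := by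
      simpa using (((hasDerivAt_id l).mul_const t).div_const 2).const_add a
    have := ((((hasDerivAt_F (d := d) (s := s) _).comp l l1).const_add (F d s a)).div_const 2).sub
      ((hasDerivAt_F (d := d) (s := s) _).comp l l2)
    convert! this using 1
    ring
  apply monotoneOn_of_deriv_nonneg (convex_Ici 0)
  · exact fun l _ => (hder l).continuousAt.continuousWithinAt
  · exact fun l _ => (hder l).differentiableAt.differentiableWithinAt
  · intro l hl
    rw [interior_Ici, mem_Ioi] at hl
    rw [(hder l).deriv]
    rcases le_total 0 t with ht | ht
    · have : F' d s (a + l * t / 2) ≤ F' d s (a + l * t) :=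
        strictMono_F'.monotone (by nlinarith)
      exact mul_nonneg (by linarith) (by linarith)
    · have : F' d s (a + l * t) ≤ F' d s (a + l * t / 2) :=
        strictMono_F'.monotone (by nlinarith)
      exact mul_nonneg_of_nonpos_of_nonpos (by linarith) (by linarith)

/-- The convexity gap is bounded below away from the diagonal, uniformly for `a` bounded. -/
theorem exists_le_convexityGap (d : ℕ) (s N : ℝ) {ε : ℝ} (hε : 0 < ε) :
    ∃ c : ℝ, 0 < c ∧ ∀ a b, |a| ≤ N → ε ≤ |b - a| → c ≤ convexityGap d s a b := by
  -- Monotonicity along rays leaves only the increments `±ε`, so a positive continuous function is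
  -- minimized over a compact set. That set is empty only if no `a` is admissible.
  have hK : IsCompact (Icc (-N) N ×ˢ ({-ε, ε} : Set ℝ)) :=
    isCompact_Icc.prod (Set.toFinite _).isCompact
  have hcont : Continuous fun x : ℝ × ℝ => convexityGap d s x.1 (x.1 + x.2) :=
    continuous_convexityGap.comp (continuous_fst.prodMk (continuous_fst.add continuous_snd))
  rcases (Icc (-N) N ×ˢ ({-ε, ε} : Set ℝ)).eq_empty_or_nonempty with he | hne
  · refine ⟨1, one_pos, fun a b ha _ => ?_⟩
    have : (a, ε) ∈ (Icc (-N) N ×ˢ ({-ε, ε} : Set ℝ)) := ⟨abs_le.1 ha, by simp⟩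
    rw [he] at this
    exact this.elim
  obtain ⟨x, hx, hmin⟩ := hK.exists_isMinOn hne hcont.continuousOn
  have hx2 : x.2 ≠ 0 := by
    rcases hx.2 with h | h
    · rw [h]; linarith
    · rw [h]; exact hε.ne'
  refine ⟨_, convexityGap_pos (d := d) (s := s) (a := x.1) (b := x.1 + x.2) (by simpa using hx2), ?_⟩
  intro a b ha hab
  have hpos : 0 < |b - a| := hε.trans_le hab
  have hne : b - a ≠ 0 := abs_pos.1 hpos
  have hmem : (a, (ε / |b - a|) * (b - a)) ∈ (Icc (-N) N ×ˢ ({-ε, ε} : Set ℝ)) := by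
    refine ⟨abs_le.1 ha, ?_⟩
    rcases abs_choice (b - a) with h | h
    · right
      rw [h]
      exact div_mul_cancel₀ ε hne
    · left
      rw [h, div_neg, neg_mul, div_mul_cancel₀ ε hne]
  have h1 := hmin hmem
  have h2 := convexityGap_monotoneOn (d := d) (s := s) a (b - a)
    (show ε / |b - a| ∈ Ici (0:ℝ) from by simp only [mem_Ici]; positivity)
    (show (1:ℝ) ∈ Ici (0:ℝ) from mem_Ici.2 zero_le_one) ((div_le_one hpos).2 hab)
  simp only [one_mul, add_sub_cancel] at h2
  exact le_trans h1 h2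

end

section

/-! ### The singular kernel -/

/-- The kernel `‖z‖^(-α)` with values in `[0, ∞]` (and value `0` at the origin if `α ≠ 0`). -/
def ker {d : ℕ} (α : ℝ) (z : Eucl d) : ℝ≥0∞ := ENNReal.ofReal (‖z‖ ^ (-α))

variable {d : ℕ}

@[fun_prop]
theorem measurable_ker (α : ℝ) : Measurable (ker α : Eucl d → ℝ≥0∞) := by
  unfold ker; fun_prop

theorem measurable_ker_sub (α : ℝ) (x : Eucl d) : Measurable fun y => ker α (x - y) :=
  (measurable_ker α).comp (measurable_const.sub measurable_id)

theorem ker_neg (α : ℝ) (z : Eucl d) : ker α (-z) = ker α z := by simp [ker]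

theorem ker_sub_comm (α : ℝ) (x y : Eucl d) : ker α (x - y) = ker α (y - x) := by
  rw [← ker_neg, neg_sub]

theorem ker_smul (α : ℝ) {R : ℝ} (hR : 0 < R) (z : Eucl d) :
    ker α (R • z) = ENNReal.ofReal (R ^ (-α)) * ker α z := by
  rw [ker, ker, ← ENNReal.ofReal_mul (by positivity), norm_smul, Real.norm_of_nonneg hR.le,
    Real.mul_rpow hR.le (norm_nonneg _)]

theorem ofReal_div_eq_mul_ker (a α : ℝ) (z : Eucl d) (ha : 0 ≤ a) :
    ENNReal.ofReal (a / ‖z‖ ^ α) = ENNReal.ofReal a * ker α z := by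
  rw [ker, ← ENNReal.ofReal_mul ha, Real.rpow_neg (norm_nonneg _), div_eq_mul_inv]

theorem ker_anti {α : ℝ} (hα : 0 ≤ α) {z : Eucl d} {R : ℝ} (hz : z ≠ 0) (hR : ‖z‖ ≤ R) :
    ENNReal.ofReal (R ^ (-α)) ≤ ker α z :=
  ENNReal.ofReal_le_ofReal
    (Real.rpow_le_rpow_of_nonpos (norm_pos_iff.2 hz) hR (by linarith))

/-- The truncated integral of the kernel of order `d + σ`. -/
def kerConst (d : ℕ) (σ : ℝ) : ℝ≥0∞ :=
  ∫⁻ z : Eucl d, ENNReal.ofReal (min 1 ‖z‖) * ker (d + σ) z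

/-- In polar coordinates the integrand is `y^(-σ)` near 0 and `y^(-1-σ)` at infinity. -/
theorem kerConst_ne_top (hd : 1 ≤ d) {σ : ℝ} (h0 : 0 < σ) (h1 : σ < 1) :
    kerConst d σ ≠ ∞ := by
  have : Nonempty (Fin d) := ⟨⟨0, hd⟩⟩
  have hint : Integrable (fun z : Eucl d => min 1 ‖z‖ * ‖z‖ ^ (-((d : ℝ) + σ))) volume := by
    apply (integrable_fun_norm_addHaar volume (E := Eucl d)
      (f := fun y : ℝ => min 1 y * y ^ (-((d : ℝ) + σ)))).2
    simp only [finrank_euclideanSpace, Fintype.card_fin, smul_eq_mul]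
    rw [← Ioc_union_Ioi_eq_Ioi (zero_le_one' ℝ)]
    have hpow : ∀ y : ℝ, 0 < y → y ^ (d - 1) = y ^ ((d : ℝ) - 1) := by
      intro y hy
      rw [← Real.rpow_natCast, Nat.cast_sub hd, Nat.cast_one]
    apply IntegrableOn.union
    · have := (intervalIntegral.intervalIntegrable_rpow' (a := 0) (b := 1)
        (r := -σ) (by linarith)).1
      refine this.congr_fun (fun y hy => ?_) measurableSet_Ioc
      have hy0 : 0 < y := hy.1
      simp only [min_eq_right hy.2, hpow y hy0]
      rw [mul_left_comm, ← Real.rpow_add hy0]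
      nth_rewrite 2 [← Real.rpow_one y]
      rw [← Real.rpow_add hy0]
      congr 1; ring
    · have := integrableOn_Ioi_rpow_of_lt (a := -1 - σ) (by linarith) one_pos
      refine this.congr_fun (fun y hy => ?_) measurableSet_Ioi
      have hy1 : 1 < y := hy
      have hy0 : 0 < y := by linarith
      simp only [min_eq_left hy1.le, one_mul, hpow y hy0]
      rw [← Real.rpow_add hy0]
      congr 1; ring
  have := hint.lintegral_lt_top
  refine (lt_of_eq_of_lt ?_ this).ne
  refine lintegral_congr fun z => ?_
  rw [ker, ← ENNReal.ofReal_mul (by positivity)]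

/-- Scaling: the homogeneity `-(d + σ)` of the kernel against the Jacobian `R^d`. This single
integral bounds both the kernel mass beyond radius `R` and its first moment within radius `R`. -/
theorem lintegral_min_mul_ker (σ : ℝ) {R : ℝ} (hR : 0 < R) :
    ∫⁻ z : Eucl d, ENNReal.ofReal (min 1 (‖z‖ / R)) * ker (d + σ) z
      = ENNReal.ofReal (R ^ (-σ)) * kerConst d σ := by
  have hm := Measure.map_addHaar_smul (volume : Measure (Eucl d)) hR.ne'
  have hmeas : Measurable fun z : Eucl d =>
    ENNReal.ofReal (min 1 (‖z‖ / R)) * ker (d + σ) z := by fun_prop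
  have h1 : ∫⁻ z : Eucl d, ENNReal.ofReal (min 1 (‖R • z‖ / R)) * ker (d + σ) (R • z) =
      ENNReal.ofReal (R ^ (-((d : ℝ) + σ))) * kerConst d σ := by
    rw [kerConst, ← lintegral_const_mul _ (by fun_prop)]
    refine lintegral_congr fun z => ?_
    rw [ker_smul _ hR, norm_smul, Real.norm_of_nonneg hR.le, mul_div_cancel_left₀ _ hR.ne']
    ring
  rw [← lintegral_map (f := fun z : Eucl d =>
    ENNReal.ofReal (min 1 (‖z‖ / R)) * ker (d + σ) z) hmeas (measurable_const_smul R), hm,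
    lintegral_smul_measure, finrank_euclideanSpace, Fintype.card_fin, smul_eq_mul] at h1
  have h2 := congrArg (fun t => ENNReal.ofReal (R ^ d) * t) h1
  simp only [← mul_assoc] at h2
  rw [← ENNReal.ofReal_mul (by positivity), ← ENNReal.ofReal_mul (by positivity),
    abs_of_pos (by positivity), mul_inv_cancel₀ (by positivity), ENNReal.ofReal_one, one_mul] at h2
  rw [h2, ← Real.rpow_natCast, ← Real.rpow_add hR]
  congr 3; ring

/-- The mass that the kernel of order `d + σ`, centred at `x`, gives to `A`. -/
def wt (σ : ℝ) (A : Set (Eucl d)) (x : Eucl d) : ℝ≥0∞ := ∫⁻ y in A, ker (d + σ) (x - y)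

theorem measurable_wt (σ : ℝ) (A : Set (Eucl d)) : Measurable (wt σ A) := by
  unfold wt
  have h : Measurable fun p : Eucl d × Eucl d => ker (d + σ) (p.1 - p.2) := by fun_prop
  exact h.lintegral_prod_right' (ν := volume.restrict A)

theorem lintegral_translate (f : Eucl d → ℝ≥0∞) (x : Eucl d) :
    ∫⁻ y, f (x - y) = ∫⁻ z, f z := lintegral_sub_left_eq_self f x

theorem wt_le (σ : ℝ) {A : Set (Eucl d)} (hA : MeasurableSet A) {x : Eucl d} {R : ℝ} (hR : 0 < R)
    (h : ∀ y ∈ A, R ≤ ‖x - y‖) : wt σ A x ≤ ENNReal.ofReal (R ^ (-σ)) * kerConst d σ := by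
  rw [← lintegral_min_mul_ker σ hR, ← lintegral_translate _ x]
  refine le_trans ?_ (setLIntegral_le_lintegral A _)
  refine setLIntegral_mono' hA fun y hy => ?_
  rw [min_eq_left ((one_le_div hR).2 (h y hy))]
  simp

theorem lintegral_norm_mul_ker_le (σ : ℝ) {A : Set (Eucl d)} (hA : MeasurableSet A) {x : Eucl d}
    {R : ℝ} (hR : 0 < R) (h : ∀ y ∈ A, ‖x - y‖ ≤ R) :
    ∫⁻ y in A, ENNReal.ofReal ‖x - y‖ * ker (d + σ) (x - y)
      ≤ ENNReal.ofReal (R ^ (1 - σ)) * kerConst d σ := by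
  have : ENNReal.ofReal (R ^ (1 - σ)) * kerConst d σ
      = ENNReal.ofReal R * (ENNReal.ofReal (R ^ (-σ)) * kerConst d σ) := by
    rw [← mul_assoc, ← ENNReal.ofReal_mul hR.le, sub_eq_add_neg, Real.rpow_add hR, Real.rpow_one]
  rw [this, ← lintegral_min_mul_ker σ hR, ← lintegral_translate _ x,
    ← lintegral_const_mul _ (by fun_prop)]
  refine le_trans ?_ (setLIntegral_le_lintegral A _)
  refine setLIntegral_mono' hA fun y hy => ?_
  rw [min_eq_right ((div_le_one hR).2 (h y hy)), ← mul_assoc, ← ENNReal.ofReal_mul hR.le,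
    mul_div_cancel₀ _ hR.ne']

/-- The case `α = 1` fails only at the origin, where the left side is 0 and the right side is `0 ^ 0
= 1`. -/
theorem mul_ker_eq {z : Eucl d} (α : ℝ) (hα : α ≠ 1) :
    ENNReal.ofReal ‖z‖ * ker α z = ker (α - 1) z := by
  rw [ker, ker, ← ENNReal.ofReal_mul (norm_nonneg _)]
  congr 1
  rcases eq_or_ne z 0 with rfl | hz
  · rw [norm_zero, zero_mul, Real.zero_rpow]
    intro h; apply hα; linarith
  · have := norm_pos_iff.2 hz
    nth_rewrite 1 [← Real.rpow_one ‖z‖]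
    rw [← Real.rpow_add this]
    congr 1; ring

/-! ### The Gagliardo seminorm -/

/-- The integrand of the Gagliardo seminorm. -/
def gint (σ : ℝ) (v : Eucl d → ℝ) (z : Eucl d × Eucl d) : ℝ≥0∞ :=
  ENNReal.ofReal |v z.1 - v z.2| * ker (d + σ) (z.1 - z.2)

theorem measurable_gint (σ : ℝ) {v : Eucl d → ℝ} (hv : Measurable v) :
    Measurable (gint σ v) := by
  unfold gint; fun_prop

theorem gagliardo_eq (σ : ℝ) (A : Set (Eucl d × Eucl d)) (v : Eucl d → ℝ) :
    gagliardo σ A v = ∫⁻ z in A, gint σ v z :=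
  lintegral_congr fun _ => ofReal_div_eq_mul_ker _ _ _ (abs_nonneg _)

theorem gagliardo_mono {σ : ℝ} {A B : Set (Eucl d × Eucl d)} (h : A ⊆ B) (v : Eucl d → ℝ) :
    gagliardo σ A v ≤ gagliardo σ B v := lintegral_mono_set h

theorem gint_add_le (σ : ℝ) (v w : Eucl d → ℝ) (z : Eucl d × Eucl d) :
    gint σ (fun x => v x + w x) z ≤ gint σ v z + gint σ w z := by
  unfold gint
  rw [← add_mul, ← ENNReal.ofReal_add (abs_nonneg _) (abs_nonneg _)]
  gcongr
  rw [add_sub_add_comm]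
  exact abs_add_le _ _

theorem gagliardo_add_le (σ : ℝ) (A : Set (Eucl d × Eucl d)) {v w : Eucl d → ℝ}
    (hv : Measurable v) :
    gagliardo σ A (fun x => v x + w x) ≤ gagliardo σ A v + gagliardo σ A w := by
  simp only [gagliardo_eq]
  rw [← lintegral_add_left (measurable_gint σ hv)]
  exact lintegral_mono fun z => gint_add_le σ v w z

theorem gagliardo_neg (σ : ℝ) (A : Set (Eucl d × Eucl d)) (v : Eucl d → ℝ) :
    gagliardo σ A (fun x => -v x) = gagliardo σ A v := by
  simp only [gagliardo]
  refine lintegral_congr fun z => ?_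
  rw [← abs_neg]
  congr 4
  ring

theorem gagliardo_sub_le (σ : ℝ) (A : Set (Eucl d × Eucl d)) {v w : Eucl d → ℝ}
    (hv : Measurable v) :
    gagliardo σ A (fun x => v x - w x) ≤ gagliardo σ A v + gagliardo σ A w := by
  have := gagliardo_add_le σ A (w := fun x => -w x) hv
  rwa [gagliardo_neg] at this

theorem gagliardo_sub_comm (σ : ℝ) (A : Set (Eucl d × Eucl d)) (v w : Eucl d → ℝ) :
    gagliardo σ A (fun x => v x - w x) = gagliardo σ A (fun x => w x - v x) := by
  rw [← gagliardo_neg]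
  simp

theorem gagliardo_half (σ : ℝ) (A : Set (Eucl d × Eucl d)) (v : Eucl d → ℝ) :
    gagliardo σ A (fun x => v x / 2) ≤ gagliardo σ A v := by
  simp only [gagliardo_eq]
  refine lintegral_mono fun z => ?_
  unfold gint
  refine mul_le_mul_left (ENNReal.ofReal_le_ofReal ?_) _
  rw [← sub_div, abs_div, abs_two]
  linarith [abs_nonneg (v z.1 - v z.2)]

theorem ae_prod_of_ae {p : Eucl d → Prop} (h : ∀ᵐ x, p x) :
    ∀ᵐ z : Eucl d × Eucl d, p z.1 ∧ p z.2 := by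
  have h1 := (Measure.quasiMeasurePreserving_fst (μ := (volume : Measure (Eucl d)))
    (ν := (volume : Measure (Eucl d)))).ae h
  have h2 := (Measure.quasiMeasurePreserving_snd (μ := (volume : Measure (Eucl d)))
    (ν := (volume : Measure (Eucl d)))).ae h
  filter_upwards [h1, h2] with z a b using ⟨a, b⟩

theorem gagliardo_congr (σ : ℝ) (A : Set (Eucl d × Eucl d)) {v w : Eucl d → ℝ}
    (h : ∀ᵐ x, v x = w x) : gagliardo σ A v = gagliardo σ A w := by
  refine lintegral_congr_ae (ae_restrict_of_ae ?_)
  filter_upwards [ae_prod_of_ae h] with z hz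
  rw [hz.1, hz.2]

theorem lintegral_prod_restrict {A B : Set (Eucl d)} {f : Eucl d × Eucl d → ℝ≥0∞}
    (hf : Measurable f) :
    ∫⁻ z in A ×ˢ B, f z = ∫⁻ x in A, ∫⁻ y in B, f (x, y) := by
  rw [Measure.volume_eq_prod, ← Measure.prod_restrict, lintegral_prod _ hf.aemeasurable]

theorem lintegral_prod_restrict_symm {A B : Set (Eucl d)} {f : Eucl d × Eucl d → ℝ≥0∞}
    (hf : Measurable f) :
    ∫⁻ z in A ×ˢ B, f z = ∫⁻ y in B, ∫⁻ x in A, f (x, y) := by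
  rw [Measure.volume_eq_prod, ← Measure.prod_restrict, lintegral_prod_symm _ hf.aemeasurable]

theorem gagliardo_swap (σ : ℝ) (A B : Set (Eucl d)) {v : Eucl d → ℝ} (hv : Measurable v) :
    gagliardo σ (A ×ˢ B) v = gagliardo σ (B ×ˢ A) v := by
  rw [gagliardo_eq, gagliardo_eq, lintegral_prod_restrict (measurable_gint σ hv),
    lintegral_prod_restrict_symm (measurable_gint σ hv)]
  refine lintegral_congr fun x => lintegral_congr fun y => ?_
  simp only [gint, abs_sub_comm (v y), ker_sub_comm _ x y]

theorem lintegral_mul_wt (σ : ℝ) (A B : Set (Eucl d)) {f : Eucl d → ℝ≥0∞} (hf : Measurable f) :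
    ∫⁻ z in A ×ˢ B, f z.1 * ker (d + σ) (z.1 - z.2) = ∫⁻ x in A, f x * wt σ B x := by
  rw [lintegral_prod_restrict (f := fun z : Eucl d × Eucl d => f z.1 * ker (d + σ) (z.1 - z.2))
    (by fun_prop)]
  refine lintegral_congr fun x => ?_
  exact lintegral_const_mul (f x) (measurable_ker_sub ((d : ℝ) + σ) x)

theorem lintegral_mul_wt' (σ : ℝ) (A B : Set (Eucl d)) {f : Eucl d → ℝ≥0∞} (hf : Measurable f) :
    ∫⁻ z in A ×ˢ B, f z.2 * ker (d + σ) (z.1 - z.2) = ∫⁻ y in B, f y * wt σ A y := by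
  rw [lintegral_prod_restrict_symm
    (f := fun z : Eucl d × Eucl d => f z.2 * ker (d + σ) (z.1 - z.2)) (by fun_prop)]
  refine lintegral_congr fun x => ?_
  simp only [ker_sub_comm _ _ x]
  exact lintegral_const_mul (f x) (measurable_ker_sub ((d : ℝ) + σ) x)

theorem lintegral_wt_comm (σ : ℝ) (A B : Set (Eucl d)) :
    ∫⁻ x in A, wt σ B x = ∫⁻ y in B, wt σ A y := by
  have h1 := lintegral_mul_wt σ A B (f := fun _ => 1) measurable_const
  have h2 := lintegral_mul_wt' σ A B (f := fun _ => 1) measurable_const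
  simp only [one_mul] at h1 h2
  rw [← h1, h2]

theorem gagliardo_prod_le (σ : ℝ) (A B : Set (Eucl d)) {v : Eucl d → ℝ} (hv : Measurable v) :
    gagliardo σ (A ×ˢ B) v ≤ (∫⁻ x in A, ENNReal.ofReal |v x| * wt σ B x)
      + ∫⁻ y in B, ENNReal.ofReal |v y| * wt σ A y := by
  rw [← lintegral_mul_wt σ A B (f := fun x => ENNReal.ofReal |v x|) (by fun_prop),
    ← lintegral_mul_wt' σ A B (f := fun x => ENNReal.ofReal |v x|) (by fun_prop),
    ← lintegral_add_left (by fun_prop), gagliardo_eq]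
  refine lintegral_mono fun z => ?_
  rw [← add_mul, ← ENNReal.ofReal_add (abs_nonneg _) (abs_nonneg _), gint]
  gcongr
  exact abs_sub _ _

/-- Triangle inequality and Tonelli, in the direction that bounds `v` on `A` from its values on `B`.
With `v` zero on `B` it is a Hardy or Poincaré inequality, according to the position of `B`. -/
theorem lintegral_mul_wt_le (σ : ℝ) (A B : Set (Eucl d)) {v : Eucl d → ℝ} (hv : Measurable v) :
    ∫⁻ x in A, ENNReal.ofReal |v x| * wt σ B x
      ≤ gagliardo σ (A ×ˢ B) v + ∫⁻ y in B, ENNReal.ofReal |v y| * wt σ A y := by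
  rw [← lintegral_mul_wt σ A B (f := fun x => ENNReal.ofReal |v x|) (by fun_prop),
    ← lintegral_mul_wt' σ A B (f := fun x => ENNReal.ofReal |v x|) (by fun_prop),
    gagliardo_eq, ← lintegral_add_left (measurable_gint σ hv)]
  refine lintegral_mono fun z => ?_
  rw [gint, ← add_mul, ← ENNReal.ofReal_add (abs_nonneg _) (abs_nonneg _)]
  gcongr
  have := abs_add_le (v z.1 - v z.2) (v z.2)
  simpa using this

theorem Q_eq (Ω : Set (Eucl d)) : Q Ω = Ω ×ˢ Ω ∪ (Ω ×ˢ Ωᶜ ∪ Ωᶜ ×ˢ Ω) := by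
  ext z
  simp only [Q, mem_compl_iff, mem_prod, mem_union]
  tauto

theorem measurableSet_Q {Ω : Set (Eucl d)} (hΩ : MeasurableSet Ω) : MeasurableSet (Q Ω) :=
  (hΩ.compl.prod hΩ.compl).compl

theorem gagliardo_Q_le (σ : ℝ) (Ω : Set (Eucl d)) {v : Eucl d → ℝ} (hv : Measurable v) :
    gagliardo σ (Q Ω) v ≤ gagliardo σ (Ω ×ˢ Ω) v + 2 * gagliardo σ (Ω ×ˢ Ωᶜ) v := by
  rw [Q_eq, two_mul]
  nth_rewrite 3 [gagliardo_swap σ _ _ hv]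
  exact (lintegral_union_le _ _ _).trans (add_le_add_right (lintegral_union_le _ _ _) _)

theorem prod_subset_Q (Ω B : Set (Eucl d)) : Ω ×ˢ B ⊆ Q Ω := by
  intro z hz h
  exact h.1 hz.1

end

section

/-! ### Boundary layers of Lipschitz domains -/

variable {d : ℕ}

/-- The boundary height: near a boundary point, a Lipschitz domain is the positivity set of a
Lipschitz function growing at unit speed in a fixed direction. -/
theorem IsBoundedLipschitzDomain.exists_height {Ω : Set (Eucl d)}
    (hΩ : IsBoundedLipschitzDomain Ω) {p : Eucl d} (hp : p ∈ frontier Ω) :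
    ∃ (e : Eucl d) (K ρ : ℝ) (ψ : Eucl d → ℝ), ‖e‖ = 1 ∧ 0 ≤ K ∧ 0 < ρ ∧ Continuous ψ ∧
      (∀ x c, ψ (x + c • e) = ψ x + c) ∧ (∀ x y, ψ x - ψ y ≤ K * dist x y) ∧
      ∀ x ∈ Metric.ball p (2 * ρ), (x ∈ Ω ↔ 0 < ψ x) := by
  obtain ⟨e, he, L, φ, hφ, U, hU, hpU, hiff⟩ := hΩ.lipschitz p hp
  obtain ⟨ρ, hρ, hball⟩ := Metric.isOpen_iff.1 hU p hpU
  -- The height is `⟨e, x⟩` minus the graph function at the projection of `x`. The projection kills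
  -- `e`, hence the unit speed along `e`; the slope is 1 from the inner product plus `L` from the
  -- graph.
  refine ⟨e, 1 + L, ρ / 2, fun x => inner ℝ e x - φ ((ℝ ∙ e)ᗮ.orthogonalProjectionOnto x), he,
    by positivity, by positivity, ?_, ?_, ?_, ?_⟩
  · exact (continuous_const.inner continuous_id).sub
      (hφ.continuous.comp (ContinuousLinearMap.continuous _))
  · intro x c
    have : (ℝ ∙ e)ᗮ.orthogonalProjectionOnto e = 0 :=
      Submodule.orthogonalProjectionOnto_orthogonalComplement_singleton_eq_zero e
    simp only [map_add, map_smul, this, smul_zero, add_zero, inner_add_right, inner_smul_right,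
      real_inner_self_eq_norm_sq, he]
    ring
  · intro x y
    have h1 : inner ℝ e x - inner ℝ e y ≤ dist x y := by
      rw [← inner_sub_right, dist_eq_norm]
      have := real_inner_le_norm e (x - y)
      rwa [he, one_mul] at this
    have h2 := hφ.dist_le_mul ((ℝ ∙ e)ᗮ.orthogonalProjectionOnto y)
      ((ℝ ∙ e)ᗮ.orthogonalProjectionOnto x)
    have h3 : dist ((ℝ ∙ e)ᗮ.orthogonalProjectionOnto y)
        ((ℝ ∙ e)ᗮ.orthogonalProjectionOnto x) ≤ dist x y := by
      rw [dist_eq_norm, ← map_sub, dist_comm, dist_eq_norm]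
      exact Submodule.norm_orthogonalProjectionOnto_apply_le _ _
    have h4 : (L : ℝ) * dist ((ℝ ∙ e)ᗮ.orthogonalProjectionOnto y)
        ((ℝ ∙ e)ᗮ.orthogonalProjectionOnto x) ≤ L * dist x y := by gcongr
    have h5 := (abs_le.1 (h2.trans h4)).2
    linarith
  · intro x hx
    rw [hiff x (hball (by rwa [mul_div_cancel₀ _ two_ne_zero] at hx))]
    exact sub_pos.symm

/-- A slab between two levels of a function that grows at unit speed in a fixed direction has
measure at most proportional to its height. -/
theorem volume_slab_le {e : Eucl d} (he : ‖e‖ = 1) {ψ : Eucl d → ℝ}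
    (hψ : ∀ x c, ψ (x + c • e) = ψ x + c) {S : Set (Eucl d)} (hS : MeasurableSet S)
    {p : Eucl d} {ρ : ℝ} (hSρ : S ⊆ Metric.ball p ρ) {a τ : ℝ} (hτ : 0 < τ) (hτ1 : τ ≤ 1)
    (hSψ : ∀ x ∈ S, a < ψ x ∧ ψ x ≤ a + τ) :
    volume S ≤ ENNReal.ofReal (2 * τ) * volume (Metric.ball p (ρ + 1)) := by
  -- Stack `N` translates of `S` along `e` in steps of `τ`. Their height ranges are disjoint, and
  -- they stay in the ball enlarged by 1 since `N τ ≤ 1`; as `2 τ N ≥ 1`, comparing volumes gives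
  -- the bound.
  set N := ⌊1 / τ⌋₊ with hN
  have hN1 : 1 ≤ N := Nat.le_floor (by rw [Nat.cast_one, le_div_iff₀ hτ]; linarith)
  have hNτ : N * τ ≤ 1 := by
    have := Nat.floor_le (show 0 ≤ 1 / τ by positivity)
    rwa [le_div_iff₀ hτ] at this
  have hN2 : 1 ≤ (2 * τ) * N := by
    have := Nat.lt_floor_add_one (1 / τ)
    rw [div_lt_iff₀ hτ] at this
    have : (1:ℝ) ≤ N := by exact_mod_cast hN1
    nlinarith
  let Sj : ℕ → Set (Eucl d) := fun j => (fun x => x + (-(j * τ)) • e) ⁻¹' S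
  have hmeas : ∀ j, MeasurableSet (Sj j) := fun j => hS.preimage (by fun_prop)
  have hvol : ∀ j, volume (Sj j) = volume S := fun j => measure_preimage_add_right _ _ _
  have hdisj : Pairwise fun i j => Disjoint (Sj i) (Sj j) := by
    have key : ∀ i j : ℕ, i < j → Disjoint (Sj i) (Sj j) := by
      intro i j hij
      rw [Set.disjoint_left]
      intro x hi hj
      have h1 := (hSψ _ hi).2
      have h2 := (hSψ _ hj).1
      rw [hψ] at h1 h2
      have : (i : ℝ) + 1 ≤ j := by exact_mod_cast hij
      nlinarith
    intro i j hij
    rcases lt_or_gt_of_ne hij with h | h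
    · exact key i j h
    · exact (key j i h).symm
  have hsub : (⋃ j ∈ Finset.range N, Sj j) ⊆ Metric.ball p (ρ + 1) := by
    intro x hx
    simp only [mem_iUnion, Finset.mem_range] at hx
    obtain ⟨j, hj, hx⟩ := hx
    have h1 := hSρ hx
    rw [Metric.mem_ball] at h1 ⊢
    have h2 : dist x (x + (-(j * τ)) • e) ≤ 1 := by
      rw [dist_self_add_right, norm_smul, he, mul_one, Real.norm_eq_abs, abs_neg,
        abs_of_nonneg (by positivity)]
      refine le_trans ?_ hNτ
      gcongr
    linarith [dist_triangle x (x + (-(j * τ)) • e) p]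
  have hle := measure_mono (μ := volume) hsub
  rw [measure_biUnion_finset (fun i _ j _ h => hdisj h) (fun j _ => hmeas j)] at hle
  simp only [hvol, Finset.sum_const, Finset.card_range, nsmul_eq_mul] at hle
  calc volume S ≤ ENNReal.ofReal ((2 * τ) * N) * volume S := by
        refine le_mul_of_one_le_left zero_le ?_
        rw [← ENNReal.ofReal_one]
        exact ENNReal.ofReal_le_ofReal hN2
    _ = ENNReal.ofReal (2 * τ) * (N * volume S) := by
        rw [ENNReal.ofReal_mul (by positivity), ENNReal.ofReal_natCast, mul_assoc]
    _ ≤ _ := by gcongr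

/-- Otherwise the interiors of `Ω` and of `Ωᶜ` would disconnect the segment from `x` to `y`. -/
theorem exists_mem_frontier_segment {Ω : Set (Eucl d)} {x y : Eucl d} (hx : x ∈ Ω) (hy : y ∉ Ω) :
    ∃ z ∈ frontier Ω, dist x z ≤ dist x y := by
  by_contra! hcon
  have hpre : IsPreconnected (segment ℝ x y) := (convex_segment x y).isPreconnected
  have hcover : segment ℝ x y ⊆ interior Ω ∪ interior Ωᶜ := by
    intro z hz
    by_contra hn
    have hzf : z ∈ frontier Ω := by
      rw [mem_union, not_or] at hn
      rw [frontier, interior_compl, mem_compl_iff, not_not] at *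
      exact ⟨hn.2, hn.1⟩
    have h1 := hcon z hzf
    have h2 := dist_add_dist_of_mem_segment hz
    linarith [dist_nonneg (x := z) (y := y)]
  have hxi : x ∈ interior Ω := by
    rcases hcover (left_mem_segment ℝ x y) with h | h
    · exact h
    · exact absurd hx (interior_subset h)
  have hyi : y ∈ interior Ωᶜ := by
    rcases hcover (right_mem_segment ℝ x y) with h | h
    · exact absurd (interior_subset h) hy
    · exact h
  obtain ⟨z, -, hz1, hz2⟩ := hpre _ _ isOpen_interior isOpen_interior hcover
    ⟨x, left_mem_segment ℝ x y, hxi⟩ ⟨y, right_mem_segment ℝ x y, hyi⟩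
  exact interior_subset hz2 (interior_subset hz1)

theorem IsBoundedLipschitzDomain.measurableSet {Ω : Set (Eucl d)}
    (hΩ : IsBoundedLipschitzDomain Ω) : MeasurableSet Ω := hΩ.isOpen.measurableSet

theorem IsBoundedLipschitzDomain.volume_ne_top {Ω : Set (Eucl d)}
    (hΩ : IsBoundedLipschitzDomain Ω) : volume Ω ≠ ∞ := hΩ.isBounded.measure_lt_top.ne

theorem nonempty_compl_of_isBounded (hd : 1 ≤ d) {Ω : Set (Eucl d)}
    (hΩ : Bornology.IsBounded Ω) : Ωᶜ.Nonempty := by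
  have : Nonempty (Fin d) := ⟨⟨0, hd⟩⟩
  rw [nonempty_compl]
  rintro rfl
  exact NormedSpace.unbounded_univ ℝ (Eucl d) hΩ

theorem IsBoundedLipschitzDomain.isCompact_frontier {Ω : Set (Eucl d)}
    (hΩ : IsBoundedLipschitzDomain Ω) : IsCompact (frontier Ω) :=
  Metric.isCompact_of_isClosed_isBounded isClosed_frontier
    (hΩ.isBounded.closure.subset frontier_subset_closure)

/-- The inner boundary layer of width `t` has measure `O(t)`. -/
theorem IsBoundedLipschitzDomain.exists_volume_layer_le (hd : 1 ≤ d) {Ω : Set (Eucl d)}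
    (hΩ : IsBoundedLipschitzDomain Ω) :
    ∃ C : ℝ, 0 ≤ C ∧ ∀ t : ℝ, 0 < t →
      volume {x ∈ Ω | Metric.infDist x Ωᶜ < t} ≤ ENNReal.ofReal (C * t) := by
  have hne := nonempty_compl_of_isBounded hd hΩ.isBounded
  have hloc : ∃ r > 0, ∃ C : ℝ, 0 ≤ C ∧ ∀ t : ℝ, 0 < t → t < r →
      volume {x ∈ Ω | Metric.infDist x Ωᶜ < t ∧ ∃ z ∈ frontier Ω, dist x z < r}
        ≤ ENNReal.ofReal (C * t) := by
    -- Relativized to points near a part `S` of the frontier, the estimate passes to subsets and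
    -- unions, so compactness reduces it to a neighbourhood of a single boundary point.
    refine hΩ.isCompact_frontier.induction_on (p := fun S => ∃ r > 0, ∃ C : ℝ, 0 ≤ C ∧
      ∀ t : ℝ, 0 < t → t < r →
      volume {x ∈ Ω | Metric.infDist x Ωᶜ < t ∧ ∃ z ∈ S, dist x z < r}
        ≤ ENNReal.ofReal (C * t)) ?_ ?_ ?_ ?_
    · exact ⟨1, one_pos, 0, le_rfl, fun t _ _ => by simp⟩
    · rintro S T hST ⟨r, hr, C, hC, h⟩
      refine ⟨r, hr, C, hC, fun t ht htr => (measure_mono ?_).trans (h t ht htr)⟩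
      rintro x ⟨hx, hxt, z, hz, hxz⟩
      exact ⟨hx, hxt, z, hST hz, hxz⟩
    · rintro S T ⟨r, hr, C, hC, h⟩ ⟨r', hr', C', hC', h'⟩
      refine ⟨min r r', lt_min hr hr', C + C', add_nonneg hC hC', fun t ht htr => ?_⟩
      rw [add_mul, ENNReal.ofReal_add (by positivity) (by positivity)]
      refine le_trans ?_ (add_le_add (h t ht (htr.trans_le (min_le_left _ _)))
        (h' t ht (htr.trans_le (min_le_right _ _))))
      refine le_trans (measure_mono ?_) (measure_union_le _ _)
      rintro x ⟨hx, hxt, z, hz | hz, hxz⟩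
      · exact Or.inl ⟨hx, hxt, z, hz, hxz.trans_le (min_le_left _ _)⟩
      · exact Or.inr ⟨hx, hxt, z, hz, hxz.trans_le (min_le_right _ _)⟩
    · intro p hp
      obtain ⟨e, K, ρ, ψ, he, hK, hρ, hψc, hψ, hψK, hiff⟩ := hΩ.exists_height hp
      set V := (volume (Metric.ball p (ρ + 1))).toReal with hV
      have hVtop : volume (Metric.ball p (ρ + 1)) ≠ ∞ := measure_ball_lt_top.ne
      refine ⟨Metric.ball p (ρ / 2), mem_nhdsWithin_of_mem_nhds (Metric.ball_mem_nhds _ (by linarith)),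
        min (ρ / 2) (1 / (K + 1)), by positivity, 2 * (K + 1) * V, by positivity,
        fun t ht htr => ?_⟩
      have ht1 := htr.trans_le (min_le_left _ _)
      have ht2 := htr.trans_le (min_le_right _ _)
      rw [lt_div_iff₀ (by positivity)] at ht2
      -- A point of the layer lies within `t` of some `y ∉ Ω`, where the height is at most 0, so its
      -- own height lies in `(0, K t]`. The factor `K + 1` keeps the slab nondegenerate when `K =
      -- 0`.
      have hslab := volume_slab_le he hψ
        (S := Metric.ball p ρ ∩ ψ ⁻¹' Ioc 0 (0 + (K + 1) * t))
        (Metric.isOpen_ball.measurableSet.inter (measurableSet_Ioc.preimage hψc.measurable))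
        inter_subset_left (a := 0) (τ := (K + 1) * t) (by positivity) (by linarith)
        (fun x hx => hx.2)
      refine (measure_mono ?_).trans (hslab.trans (le_of_eq ?_))
      · rintro x ⟨hx, hxt, z, hz, hxz⟩
        rw [Metric.mem_ball] at hz
        have hxz' := hxz.trans_le (min_le_left _ _)
        have hxp : dist x p < ρ := by linarith [dist_triangle x z p]
        refine ⟨hxp, ((hiff x (by rw [Metric.mem_ball]; linarith)).1 hx), ?_⟩
        obtain ⟨y, hy, hxy⟩ := (Metric.infDist_lt_iff hne).1 hxt
        have hyp : dist y p < 2 * ρ := by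
          rw [dist_comm] at hxy
          linarith [dist_triangle y x p]
        have h1 := (hiff y hyp).not.1 hy
        have h2 := hψK x y
        have h3 : K * dist x y ≤ K * t := by gcongr
        nlinarith
      · rw [← ENNReal.ofReal_toReal hVtop, ← ENNReal.ofReal_mul (by positivity), ← hV]
        congr 1; ring
  obtain ⟨r, hr, C, hC, h⟩ := hloc
  set V := (volume Ω).toReal with hV
  -- The term `V / r` serves the widths `t ≥ r`, for which the whole volume of `Ω` is an acceptable
  -- bound.
  refine ⟨C + V / r, by positivity, fun t ht => ?_⟩
  rcases lt_or_ge t r with htr | htr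
  · refine (measure_mono ?_).trans ((h t ht htr).trans (ENNReal.ofReal_le_ofReal ?_))
    · rintro x ⟨hx, hxt⟩
      obtain ⟨y, hy, hxy⟩ := (Metric.infDist_lt_iff hne).1 hxt
      obtain ⟨z, hz, hxz⟩ := exists_mem_frontier_segment hx hy
      exact ⟨hx, hxt, z, hz, by linarith⟩
    · have : 0 ≤ V / r * t := by positivity
      linarith
  · refine (measure_mono (sep_subset _ _)).trans ?_
    rw [← ENNReal.ofReal_toReal hΩ.volume_ne_top, ← hV]
    refine ENNReal.ofReal_le_ofReal ?_
    have h1 : V ≤ V / r * t := by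
      rw [div_mul_eq_mul_div, le_div_iff₀ hr]
      gcongr
    have h2 : 0 ≤ C * t := by positivity
    linarith

theorem height_eq_zero_of_mem_frontier {Ω : Set (Eucl d)} (hΩ : IsOpen Ω) {p : Eucl d}
    {ρ : ℝ} {ψ : Eucl d → ℝ} (hψ : Continuous ψ)
    (h : ∀ x ∈ Metric.ball p ρ, (x ∈ Ω ↔ 0 < ψ x)) {x : Eucl d} (hx : x ∈ Metric.ball p ρ)
    (hxf : x ∈ frontier Ω) : ψ x = 0 := by
  rw [hΩ.frontier_eq] at hxf
  refine le_antisymm (not_lt.1 ((h x hx).not.1 hxf.2)) ?_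
  by_contra! hneg
  have hnhds : Metric.ball p ρ ∩ {y | ψ y < 0} ∈ 𝓝 x :=
    inter_mem (Metric.isOpen_ball.mem_nhds hx) ((isOpen_lt hψ continuous_const).mem_nhds hneg)
  obtain ⟨y, hy, hyΩ⟩ := mem_closure_iff_nhds.1 hxf.1 _ hnhds
  have := (h y hy.1).1 hyΩ
  have h2 : ψ y < 0 := hy.2
  linarith

/-- Locally the frontier lies in the zero level of the height, which fits into slabs of arbitrarily
small thickness. -/
theorem IsBoundedLipschitzDomain.volume_frontier {Ω : Set (Eucl d)}
    (hΩ : IsBoundedLipschitzDomain Ω) : volume (frontier Ω) = 0 := by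
  refine measure_null_of_locally_null _ fun p hp => ?_
  obtain ⟨e, K, ρ, ψ, he, hK, hρ, hψc, hψ, hψK, hiff⟩ := hΩ.exists_height hp
  refine ⟨Metric.ball p (2 * ρ) ∩ {y | ψ y = 0} , ?_, ?_⟩
  · rw [mem_nhdsWithin]
    refine ⟨_, Metric.isOpen_ball, Metric.mem_ball_self (by positivity : 0 < 2 * ρ), ?_⟩
    exact fun y hy => ⟨hy.1, height_eq_zero_of_mem_frontier hΩ.isOpen hψc hiff hy.1 hy.2⟩
  · have hmeas : MeasurableSet (Metric.ball p (2 * ρ) ∩ {y | ψ y = 0}) :=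
      Metric.isOpen_ball.measurableSet.inter (isClosed_eq hψc continuous_const).measurableSet
    have hle : ∀ n : ℕ, volume (Metric.ball p (2 * ρ) ∩ {y | ψ y = 0}) ≤
        ENNReal.ofReal (2 * (1 / ((n : ℝ) + 1))) * volume (Metric.ball p (2 * ρ + 1)) := by
      intro n
      refine volume_slab_le he hψ hmeas inter_subset_left (a := -(1 / ((n : ℝ) + 1)))
        (by positivity) ?_ ?_
      · rw [div_le_one (by positivity)]
        linarith [n.cast_nonneg (α := ℝ)]
      · intro x hx
        have : ψ x = 0 := hx.2
        rw [this]
        refine ⟨?_, by linarith⟩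
        have : 0 < 1 / ((n : ℝ) + 1) := by positivity
        linarith
    have hlim : Tendsto (fun n : ℕ => ENNReal.ofReal (2 * (1 / ((n : ℝ) + 1))) *
        volume (Metric.ball p (2 * ρ + 1))) atTop (𝓝 0) := by
      have h1 := (tendsto_one_div_add_atTop_nhds_zero_nat (𝕜 := ℝ)).const_mul 2
      have h2 := ENNReal.tendsto_ofReal h1
      have h3 := ENNReal.Tendsto.mul_const (b := volume (Metric.ball p (2 * ρ + 1))) h2
        (Or.inr measure_ball_lt_top.ne)
      simpa using h3
    exact le_antisymm (ge_of_tendsto' hlim hle) zero_le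

/-- Moving slightly against `e` from a boundary point makes the height negative on a whole
neighbourhood, which therefore misses `Ω`. This rules out slits and guarantees exterior cells at
boundary nodes. -/
theorem IsBoundedLipschitzDomain.frontier_subset {Ω : Set (Eucl d)}
    (hΩ : IsBoundedLipschitzDomain Ω) : frontier Ω ⊆ closure (closure Ω)ᶜ := by
  intro p hp
  obtain ⟨e, K, ρ, ψ, he, hK, hρ, hψc, hψ, hψK, hiff⟩ := hΩ.exists_height hp
  rw [Metric.mem_closure_iff]
  intro ε hε
  have hp0 := height_eq_zero_of_mem_frontier hΩ.isOpen hψc hiff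
    (Metric.mem_ball_self (by positivity)) hp
  set c := min (ε / 2) ρ with hc
  have hc0 : 0 < c := lt_min (by positivity) hρ
  have hdist : dist p (p + (-c) • e) = c := by
    rw [dist_self_add_right, norm_smul, he, mul_one, Real.norm_eq_abs, abs_neg, abs_of_pos hc0]
  refine ⟨p + (-c) • e, ?_, ?_⟩
  · rw [← interior_compl, mem_interior]
    refine ⟨Metric.ball p (2 * ρ) ∩ {y | ψ y < 0}, ?_,
      Metric.isOpen_ball.inter (isOpen_lt hψc continuous_const), ?_, ?_⟩
    · intro y hy hyΩ
      have h1 := (hiff y hy.1).1 hyΩ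
      have h2 : ψ y < 0 := hy.2
      linarith
    · rw [Metric.mem_ball, dist_comm, hdist]
      have : c ≤ ρ := min_le_right _ _
      linarith
    · simp only [mem_ofPred_eq, hψ, hp0]
      linarith
  · rw [hdist]
    have : c ≤ ε / 2 := min_le_left _ _
    linarith

/-- The weight `dist(x, Ωᶜ)^(-σ)`. -/
def dinv (σ : ℝ) (Ω : Set (Eucl d)) (x : Eucl d) : ℝ≥0∞ :=
  ENNReal.ofReal (Metric.infDist x Ωᶜ ^ (-σ))

@[fun_prop]
theorem measurable_dinv (σ : ℝ) (Ω : Set (Eucl d)) : Measurable (dinv σ Ω) := by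
  have : Measurable fun x => Metric.infDist x Ωᶜ := (Metric.continuous_infDist_pt _).measurable
  unfold dinv
  fun_prop

theorem infDist_compl_pos (hd : 1 ≤ d) {Ω : Set (Eucl d)} (hΩ : IsBoundedLipschitzDomain Ω)
    {x : Eucl d} (hx : x ∈ Ω) : 0 < Metric.infDist x Ωᶜ :=
  (hΩ.isOpen.isClosed_compl.notMem_iff_infDist_pos
    (nonempty_compl_of_isBounded hd hΩ.isBounded)).1 (by simpa using hx)

theorem wt_compl_le (hd : 1 ≤ d) {Ω : Set (Eucl d)} (hΩ : IsBoundedLipschitzDomain Ω) (σ : ℝ)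
    {x : Eucl d} (hx : x ∈ Ω) : wt σ Ωᶜ x ≤ dinv σ Ω x * kerConst d σ := by
  refine wt_le σ hΩ.measurableSet.compl (infDist_compl_pos hd hΩ hx) fun y hy => ?_
  rw [← dist_eq_norm]
  exact Metric.infDist_le_dist_of_mem hy

theorem le_dinv (hd : 1 ≤ d) {Ω : Set (Eucl d)} (hΩ : IsBoundedLipschitzDomain Ω) {σ : ℝ}
    (hσ : 0 ≤ σ) {x : Eucl d} (hx : x ∈ Ω) {R : ℝ} (h : Metric.infDist x Ωᶜ ≤ R) :
    ENNReal.ofReal (R ^ (-σ)) ≤ dinv σ Ω x :=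
  ENNReal.ofReal_le_ofReal
    (Real.rpow_le_rpow_of_nonpos (infDist_compl_pos hd hΩ hx) h (by linarith))

/-- Layer-cake formula: the set where `dist⁻¹ > t` is the boundary layer of width `1/t`, of measure
at most `min (|Ω|, C/t)`. Against `t^(σ-1)` this converges at 0 because `σ > 0` and at infinity
because `σ < 1`. -/
theorem lintegral_dinv_ne_top (hd : 1 ≤ d) {Ω : Set (Eucl d)} (hΩ : IsBoundedLipschitzDomain Ω)
    {σ : ℝ} (h0 : 0 < σ) (h1 : σ < 1) : ∫⁻ x in Ω, dinv σ Ω x ≠ ∞ := by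
  obtain ⟨C, hC, hlayer⟩ := hΩ.exists_volume_layer_le hd
  have e1 : ∀ x, dinv σ Ω x = ENNReal.ofReal ((Metric.infDist x Ωᶜ)⁻¹ ^ σ) := by
    intro x
    rw [dinv, Real.rpow_neg Metric.infDist_nonneg, Real.inv_rpow Metric.infDist_nonneg]
  have hmeas : Measurable fun x => (Metric.infDist x Ωᶜ)⁻¹ :=
    (Metric.continuous_infDist_pt _).measurable.inv
  simp only [e1]
  rw [lintegral_rpow_eq_lintegral_meas_lt_mul (volume.restrict Ω)
    (ae_of_all _ fun x => inv_nonneg.2 Metric.infDist_nonneg) hmeas.aemeasurable h0]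
  refine ENNReal.mul_ne_top ENNReal.ofReal_ne_top ?_
  have hle1 : ∀ t, (volume.restrict Ω) {a | t < (Metric.infDist a Ωᶜ)⁻¹} ≤ volume Ω := fun t =>
    (measure_mono (subset_univ _)).trans (by rw [Measure.restrict_apply_univ])
  have hle2 : ∀ t, 0 < t → (volume.restrict Ω) {a | t < (Metric.infDist a Ωᶜ)⁻¹} ≤
      ENNReal.ofReal (C * t⁻¹) := by
    intro t ht
    rw [Measure.restrict_apply' hΩ.measurableSet]
    refine (measure_mono ?_).trans (hlayer t⁻¹ (by positivity))
    rintro x ⟨hx, hxΩ⟩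
    refine ⟨hxΩ, ?_⟩
    rw [mem_ofPred_eq, lt_inv_comm₀ ht (infDist_compl_pos hd hΩ hxΩ)] at hx
    exact hx
  rw [← Ioc_union_Ioi_eq_Ioi (zero_le_one' ℝ)]
  refine ne_top_of_le_ne_top ?_ (lintegral_union_le _ _ _)
  refine ENNReal.add_ne_top.2 ⟨?_, ?_⟩
  · refine ne_top_of_le_ne_top ?_ (lintegral_mono (g := fun t : ℝ =>
      volume Ω * ENNReal.ofReal (t ^ (σ - 1))) fun t => mul_le_mul_left (hle1 t) _)
    rw [lintegral_const_mul _ (by fun_prop)]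
    refine ENNReal.mul_ne_top hΩ.volume_ne_top ?_
    exact ((intervalIntegral.intervalIntegrable_rpow' (a := 0) (b := 1)
        (r := σ - 1) (by linarith)).1).lintegral_lt_top.ne
  · refine ne_top_of_le_ne_top ?_ (setLIntegral_mono' (g := fun t : ℝ =>
      ENNReal.ofReal C * ENNReal.ofReal (t ^ (σ - 2))) measurableSet_Ioi fun t ht => ?_)
    · rw [lintegral_const_mul _ (by fun_prop)]
      refine ENNReal.mul_ne_top ENNReal.ofReal_ne_top ?_
      exact (integrableOn_Ioi_rpow_of_lt (a := σ - 2) (by linarith) one_pos).lintegral_lt_top.ne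
    · have ht0 : 0 < t := one_pos.trans ht
      refine (mul_le_mul_left (hle2 t ht0) _).trans (le_of_eq ?_)
      rw [← ENNReal.ofReal_mul (by positivity), ← ENNReal.ofReal_mul hC, mul_assoc]
      congr 2
      rw [← Real.rpow_neg_one, ← Real.rpow_add ht0]
      congr 1; ring

/-- The integral is the fractional perimeter of `Ω`. Its finiteness allows bounded functions to be
weighted by the kernel mass across the boundary. -/
theorem lintegral_wt_compl_ne_top (hd : 1 ≤ d) {Ω : Set (Eucl d)}
    (hΩ : IsBoundedLipschitzDomain Ω) {σ : ℝ} (h0 : 0 < σ) (h1 : σ < 1) :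
    ∫⁻ x in Ω, wt σ Ωᶜ x ≠ ∞ := by
  refine ne_top_of_le_ne_top ?_ (setLIntegral_mono' (g := fun x => dinv σ Ω x * kerConst d σ)
    hΩ.measurableSet fun x hx => wt_compl_le hd hΩ σ hx)
  rw [lintegral_mul_const _ (by fun_prop)]
  exact ENNReal.mul_ne_top (lintegral_dinv_ne_top hd hΩ h0 h1) (kerConst_ne_top hd h0 h1)

end

section

/-! ### Seminorms of functions that are Lipschitz on each of finitely many fat convex sets -/

variable {d : ℕ}

/-- `T` is a convex body with inradius at least `r` and diameter at most `κ * r`. -/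
structure IsFat (κ r : ℝ) (T : Set (Eucl d)) : Prop where
  isCompact : IsCompact T
  convex : Convex ℝ T
  pos : 0 < r
  ball : ∃ c, Metric.closedBall c r ⊆ T
  dist_le : ∀ x ∈ T, ∀ y ∈ T, dist x y ≤ κ * r

theorem IsFat.volume_ne_top {κ r : ℝ} {T : Set (Eucl d)} (hT : IsFat κ r T) : volume T ≠ ∞ :=
  hT.isCompact.measure_lt_top.ne

theorem IsFat.measurableSet {κ r : ℝ} {T : Set (Eucl d)} (hT : IsFat κ r T) : MeasurableSet T :=
  hT.isCompact.isClosed.measurableSet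

/-- Shrink `T` about the centre of its inner ball by the factor `1 - l`, `l = ‖z‖ / r`. The shrunken
copy shifted by `-z` stays in `T` by convexity, since `c - l⁻¹ z` lies in the inner ball. Only `T`
minus the copy can be bad, a fraction `1 - (1 - l)^d ≤ d l` of the volume by Bernoulli. -/
theorem IsFat.volume_shift_le (hd : 1 ≤ d) {κ r : ℝ} {T : Set (Eucl d)} (hT : IsFat κ r T)
    (z : Eucl d) :
    volume {x ∈ T | x - z ∉ T} ≤ d * ENNReal.ofReal (min 1 (‖z‖ / r)) * volume T := by
  have hd' : (1 : ℝ) ≤ d := by exact_mod_cast hd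
  obtain ⟨c, hc⟩ := hT.ball
  have hr := hT.pos
  rcases le_or_gt r ‖z‖ with hz | hz
  · rw [min_eq_left ((one_le_div hr).2 hz), ENNReal.ofReal_one, mul_one]
    refine (measure_mono (sep_subset _ _)).trans (le_mul_of_one_le_left zero_le ?_)
    exact_mod_cast hd
  have hl1 : ‖z‖ / r < 1 := (div_lt_one hr).2 hz
  rw [min_eq_right hl1.le]
  set l := ‖z‖ / r with hl
  have hl0 : 0 ≤ l := by positivity
  set H := AffineMap.homothety c (1 - l) '' T with hH
  have hcT : c ∈ T := hc (Metric.mem_closedBall_self hr.le)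
  have hHT : H ⊆ T := by
    rintro _ ⟨x, hx, rfl⟩
    rw [AffineMap.homothety_eq_lineMap]
    exact hT.convex.lineMap_mem hcT hx ⟨by linarith, by linarith⟩
  have hHm : MeasurableSet H := by
    refine (hT.isCompact.image ?_).isClosed.measurableSet
    exact AffineMap.homothety_continuous _ _
  have hsub : {x ∈ T | x - z ∉ T} ⊆ T \ H := by
    rintro x ⟨hx, hxz⟩
    refine ⟨hx, fun hxH => hxz ?_⟩
    obtain ⟨y, hy, rfl⟩ := hxH
    rcases eq_or_ne z 0 with rfl | hz0
    · rw [sub_zero]; exact hx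
    have hlpos : 0 < l := div_pos (norm_pos_iff.2 hz0) hr
    have hw : c - l⁻¹ • z ∈ T := by
      apply hc
      rw [Metric.mem_closedBall, dist_eq_norm, sub_sub_cancel_left, norm_neg, norm_smul, norm_inv,
        Real.norm_of_nonneg hl0, hl, inv_div, div_mul_cancel₀ _ (norm_pos_iff.2 hz0).ne']
    have : AffineMap.homothety c (1 - l) y - z = (1 - l) • y + l • (c - l⁻¹ • z) := by
      rw [AffineMap.homothety_apply, smul_sub, smul_inv_smul₀ hlpos.ne', vsub_eq_sub, vadd_eq_add,
        sub_smul, sub_smul, one_smul, one_smul, smul_sub]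
      abel
    rw [this]
    exact hT.convex hy hw (by linarith) hl0 (by ring)
  refine (measure_mono hsub).trans ?_
  have hvH : volume H = ENNReal.ofReal ((1 - l) ^ d) * volume T := by
    rw [hH, Measure.addHaar_image_homothety, finrank_euclideanSpace, Fintype.card_fin,
      abs_of_nonneg (pow_nonneg (by linarith) _)]
  rw [measure_sdiff hHT hHm.nullMeasurableSet
    (ne_top_of_le_ne_top hT.volume_ne_top (measure_mono hHT)), hvH, tsub_le_iff_right, ← add_mul,
    ← ENNReal.ofReal_natCast, ← ENNReal.ofReal_mul (by positivity),
    ← ENNReal.ofReal_add (by positivity) (pow_nonneg (by linarith) _)]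
  refine le_mul_of_one_le_left zero_le ?_
  rw [← ENNReal.ofReal_one]
  refine ENNReal.ofReal_le_ofReal ?_
  have := one_add_mul_le_pow (a := -l) (by linarith) d
  rw [← sub_eq_add_neg] at this
  linarith

theorem lintegral_wt_eq (σ : ℝ) (A : Set (Eucl d)) {B : Set (Eucl d)} (hB : MeasurableSet B) :
    ∫⁻ x in A, wt σ B x = ∫⁻ z, ker (d + σ) z * volume {x ∈ A | x - z ∈ B} := by
  have h1 : ∀ x, wt σ B x = ∫⁻ z, B.indicator 1 (x - z) * ker (d + σ) z := by
    intro x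
    rw [wt, ← lintegral_indicator hB,
      ← lintegral_translate (fun z => B.indicator 1 (x - z) * ker (d + σ) z) x]
    refine lintegral_congr fun y => ?_
    simp only [sub_sub_cancel]
    by_cases h : y ∈ B <;> simp [h]
  have hBm : Measurable (B.indicator (1 : Eucl d → ℝ≥0∞)) := measurable_one.indicator hB
  simp only [h1]
  rw [lintegral_lintegral_swap]
  · refine lintegral_congr fun z => ?_
    have hBz : Measurable fun x => B.indicator (1 : Eucl d → ℝ≥0∞) (x - z) :=
      hBm.comp (measurable_id.sub measurable_const)
    rw [lintegral_mul_const _ hBz, mul_comm]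
    congr 1
    have : (fun x => B.indicator (1 : Eucl d → ℝ≥0∞) (x - z)) =
        ((fun x => x - z) ⁻¹' B).indicator 1 := rfl
    have hm : MeasurableSet ((fun x => x - z) ⁻¹' B) := hB.preimage (by fun_prop)
    rw [this, lintegral_indicator_one hm, Measure.restrict_apply hm, inter_comm]
    rfl
  · apply Measurable.aemeasurable
    have h2 : Measurable fun p : Eucl d × Eucl d => B.indicator (1 : Eucl d → ℝ≥0∞) (p.1 - p.2) :=
      hBm.comp (measurable_fst.sub measurable_snd)
    exact h2.mul ((measurable_ker _).comp measurable_snd)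

/-- The fractional perimeter of a fat body: integrate the shift estimate against the kernel and
rescale. -/
theorem IsFat.lintegral_wt_compl_le (hd : 1 ≤ d) {κ r : ℝ} {T : Set (Eucl d)} (hT : IsFat κ r T)
    (σ : ℝ) : ∫⁻ x in T, wt σ Tᶜ x
      ≤ d * kerConst d σ * (ENNReal.ofReal (r ^ (-σ)) * volume T) := by
  rw [lintegral_wt_eq σ T hT.measurableSet.compl]
  calc _ ≤ ∫⁻ z : Eucl d, ENNReal.ofReal (min 1 (‖z‖ / r)) * ker (d + σ) z * (d * volume T) := by
        refine lintegral_mono fun z => ?_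
        refine (mul_le_mul_right (hT.volume_shift_le hd z) _).trans (le_of_eq ?_)
        ring
    _ = _ := by
        rw [lintegral_mul_const _ (by fun_prop), lintegral_min_mul_ker σ hT.pos]
        ring

theorem IsFat.lintegral_norm_mul_ker_le {κ r : ℝ} {T : Set (Eucl d)} (hT : IsFat κ r T)
    (hκ : 0 < κ) (σ : ℝ) :
    ∫⁻ z in T ×ˢ T, ENNReal.ofReal ‖z.1 - z.2‖ * ker (d + σ) (z.1 - z.2)
      ≤ ENNReal.ofReal ((κ * r) ^ (1 - σ)) * kerConst d σ * volume T := by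
  rw [lintegral_prod_restrict (f := fun z : Eucl d × Eucl d =>
    ENNReal.ofReal ‖z.1 - z.2‖ * ker (d + σ) (z.1 - z.2)) (by fun_prop), ← setLIntegral_const]
  refine setLIntegral_mono' hT.measurableSet fun x hx => ?_
  refine NonlocalGraph.lintegral_norm_mul_ker_le σ hT.measurableSet (mul_pos hκ hT.pos)
    fun y hy => ?_
  rw [← dist_eq_norm]
  exact hT.dist_le x hx y hy

/-- Inverse estimate: on a vector of length `r`, the linear part of `q` is half the difference of
the values of `q` at two opposite points of the inner ball, hence at most `m`. -/
theorem IsFat.abs_sub_le {κ r : ℝ} {T : Set (Eucl d)} (hT : IsFat κ r T) {q : Eucl d →ᵃ[ℝ] ℝ}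
    {m : ℝ} (hq : ∀ x ∈ T, |q x| ≤ m) (x y : Eucl d) : |q x - q y| ≤ m / r * ‖x - y‖ := by
  obtain ⟨c, hc⟩ := hT.ball
  have hr := hT.pos
  have e1 : q x - q y = q.linear (x - y) := by
    rw [← vsub_eq_sub, ← vsub_eq_sub, AffineMap.linearMap_vsub]
  rcases eq_or_ne x y with rfl | hxy
  · simp
  have hn : 0 < ‖x - y‖ := norm_pos_iff.2 (sub_ne_zero.2 hxy)
  set w := (r / ‖x - y‖) • (x - y) with hw
  have hwn : ‖w‖ = r := by
    rw [hw, norm_smul, Real.norm_of_nonneg (by positivity), div_mul_cancel₀ _ hn.ne']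
  have h1 := hq (c + w) (hc (by simp [hwn]))
  have h2 := hq (c - w) (hc (by simp [hwn]))
  have e2 : q (c + w) - q (c - w) = q.linear w + q.linear w := by
    rw [← vsub_eq_sub, ← AffineMap.linearMap_vsub, vsub_eq_sub, ← map_add]
    congr 1; abel
  have e3 : q.linear w = r / ‖x - y‖ * q.linear (x - y) := by rw [hw, map_smul, smul_eq_mul]
  have h3 : |q.linear w| ≤ m := by
    rw [abs_le] at *
    constructor <;> linarith
  rw [e3, abs_mul, abs_of_pos (by positivity), div_mul_eq_mul_div, div_le_iff₀ hn] at h3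
  rw [e1, div_mul_eq_mul_div, le_div_iff₀ hr]
  linarith

/-- The seminorm bound for functions with sup norm `m i` and Lipschitz constant `m i / r i` on
fat cells `T i` and vanishing elsewhere. -/
theorem gagliardo_le_sum (hd : 1 ≤ d) {ι : Type*} (I : Finset ι) {κ : ℝ} (hκ : 0 < κ)
    {T : ι → Set (Eucl d)} {r m : ι → ℝ} (hT : ∀ i ∈ I, IsFat κ (r i) (T i)) {σ : ℝ}
    {v : Eucl d → ℝ} (hv0 : ∀ x, (∀ i ∈ I, x ∉ T i) → v x = 0)
    (hvm : ∀ i ∈ I, ∀ x ∈ T i, |v x| ≤ m i)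
    (hvL : ∀ i ∈ I, ∀ x ∈ T i, ∀ y ∈ T i, |v x - v y| ≤ m i / r i * ‖x - y‖) :
    gagliardo σ univ v ≤ (ENNReal.ofReal (κ ^ (1 - σ)) + 2 * d) * kerConst d σ *
      ∑ i ∈ I, ENNReal.ofReal (m i * r i ^ (-σ)) * volume (T i) := by
  let f1 : ι → Eucl d × Eucl d → ℝ≥0∞ := fun i => (T i ×ˢ T i).indicator fun z =>
    ENNReal.ofReal (m i / r i) * (ENNReal.ofReal ‖z.1 - z.2‖ * ker (d + σ) (z.1 - z.2))
  let f2 : ι → Eucl d × Eucl d → ℝ≥0∞ := fun i => (T i ×ˢ (T i)ᶜ).indicator fun z =>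
    ENNReal.ofReal (m i) * ker (d + σ) (z.1 - z.2)
  let f3 : ι → Eucl d × Eucl d → ℝ≥0∞ := fun i => ((T i)ᶜ ×ˢ T i).indicator fun z =>
    ENNReal.ofReal (m i) * ker (d + σ) (z.1 - z.2)
  have hm2 : ∀ i ∈ I, MeasurableSet (T i ×ˢ (T i)ᶜ) := fun i hi =>
    (hT i hi).measurableSet.prod (hT i hi).measurableSet.compl
  have hm3 : ∀ i ∈ I, MeasurableSet ((T i)ᶜ ×ˢ T i) := fun i hi =>
    (hT i hi).measurableSet.compl.prod (hT i hi).measurableSet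
  have hm1 : ∀ i ∈ I, MeasurableSet (T i ×ˢ T i) := fun i hi =>
    (hT i hi).measurableSet.prod (hT i hi).measurableSet
  have hmf1 : ∀ i ∈ I, Measurable (f1 i) := fun i hi =>
    Measurable.indicator (by fun_prop) (hm1 i hi)
  have hmf2 : ∀ i ∈ I, Measurable (f2 i) := fun i hi =>
    Measurable.indicator (by fun_prop) (hm2 i hi)
  have hmf3 : ∀ i ∈ I, Measurable (f3 i) := fun i hi =>
    Measurable.indicator (by fun_prop) (hm3 i hi)
  -- Pairs in a common cell use the Lipschitz bound. For any other pair, each point is charged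
  -- separately to the interaction of its own cell with the complement of that cell, so interactions
  -- between two cells never have to be counted.
  have hpt : ∀ z, gint σ v z ≤ ∑ i ∈ I, (f1 i z + f2 i z + f3 i z) := by
    rintro ⟨x, y⟩
    by_cases hxy : ∃ i ∈ I, x ∈ T i ∧ y ∈ T i
    · obtain ⟨i, hi, hx, hy⟩ := hxy
      refine le_trans ?_ (Finset.single_le_sum (f := fun i => f1 i (x, y) + f2 i (x, y) + f3 i (x, y))
        (fun _ _ => zero_le) hi)
      refine le_trans ?_ (le_add_right (le_add_right le_rfl))
      have : (x, y) ∈ T i ×ˢ T i := ⟨hx, hy⟩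
      simp only [f1, indicator_of_mem this, gint]
      rw [← mul_assoc, ← ENNReal.ofReal_mul' (norm_nonneg _)]
      gcongr
      exact hvL i hi x hx y hy
    · push Not at hxy
      have hx : ENNReal.ofReal |v x| * ker (d + σ) (x - y) ≤ ∑ i ∈ I, f2 i (x, y) := by
        by_cases h : ∃ i ∈ I, x ∈ T i
        · obtain ⟨i, hi, hx⟩ := h
          refine le_trans ?_ (Finset.single_le_sum (f := fun i => f2 i (x, y))
            (fun _ _ => zero_le) hi)
          have : (x, y) ∈ T i ×ˢ (T i)ᶜ := ⟨hx, hxy i hi hx⟩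
          simp only [f2, indicator_of_mem this]
          gcongr
          exact hvm i hi x hx
        · push Not at h
          simp [hv0 x h]
      have hy : ENNReal.ofReal |v y| * ker (d + σ) (x - y) ≤ ∑ i ∈ I, f3 i (x, y) := by
        by_cases h : ∃ i ∈ I, y ∈ T i
        · obtain ⟨i, hi, hy⟩ := h
          refine le_trans ?_ (Finset.single_le_sum (f := fun i => f3 i (x, y))
            (fun _ _ => zero_le) hi)
          have : (x, y) ∈ (T i)ᶜ ×ˢ T i := ⟨fun hx => hxy i hi hx hy, hy⟩
          simp only [f3, indicator_of_mem this]
          gcongr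
          exact hvm i hi y hy
        · push Not at h
          simp [hv0 y h]
      calc gint σ v (x, y)
          ≤ ENNReal.ofReal |v x| * ker (d + σ) (x - y) +
              ENNReal.ofReal |v y| * ker (d + σ) (x - y) := by
            rw [← add_mul, ← ENNReal.ofReal_add (abs_nonneg _) (abs_nonneg _), gint]
            gcongr
            exact abs_sub _ _
        _ ≤ ∑ i ∈ I, f2 i (x, y) + ∑ i ∈ I, f3 i (x, y) := add_le_add hx hy
        _ ≤ _ := by
            rw [← Finset.sum_add_distrib]
            refine Finset.sum_le_sum fun i _ => ?_
            rw [add_assoc]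
            exact le_add_left le_rfl
  rw [gagliardo_eq, Measure.restrict_univ]
  refine (lintegral_mono hpt).trans ?_
  rw [lintegral_finsetSum (f := fun i z => f1 i z + f2 i z + f3 i z) I
    fun i hi => ((hmf1 i hi).add (hmf2 i hi)).add (hmf3 i hi), Finset.mul_sum]
  refine Finset.sum_le_sum fun i hi => ?_
  rw [lintegral_add_right _ (hmf3 i hi), lintegral_add_left (hmf1 i hi)]
  have hr := (hT i hi).pos
  have hm0 : 0 ≤ m i := by
    obtain ⟨c, hc⟩ := (hT i hi).ball
    exact (abs_nonneg _).trans (hvm i hi c (hc (Metric.mem_closedBall_self hr.le)))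
  have i1 : ∫⁻ z, f1 i z ≤ ENNReal.ofReal (κ ^ (1 - σ)) * kerConst d σ *
      (ENNReal.ofReal (m i * r i ^ (-σ)) * volume (T i)) := by
    simp only [f1]
    rw [lintegral_indicator (hm1 i hi), lintegral_const_mul _ (by fun_prop)]
    refine (mul_le_mul_right ((hT i hi).lintegral_norm_mul_ker_le hκ σ) _).trans (le_of_eq ?_)
    have : ENNReal.ofReal (m i / r i) * ENNReal.ofReal ((κ * r i) ^ (1 - σ)) =
        ENNReal.ofReal (κ ^ (1 - σ)) * ENNReal.ofReal (m i * r i ^ (-σ)) := by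
      rw [← ENNReal.ofReal_mul (by positivity), ← ENNReal.ofReal_mul (by positivity),
        Real.mul_rpow hκ.le hr.le, sub_eq_add_neg (1 : ℝ) σ, Real.rpow_add hr, Real.rpow_one]
      congr 1
      field_simp
    rw [← mul_assoc, ← mul_assoc, this]
    ring
  have hwt : ENNReal.ofReal (m i) * ∫⁻ x in T i, wt σ (T i)ᶜ x ≤
      d * kerConst d σ * (ENNReal.ofReal (m i * r i ^ (-σ)) * volume (T i)) := by
    refine (mul_le_mul_right ((hT i hi).lintegral_wt_compl_le hd σ) _).trans (le_of_eq ?_)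
    rw [ENNReal.ofReal_mul hm0]
    ring
  have i2 : ∫⁻ z, f2 i z = ENNReal.ofReal (m i) * ∫⁻ x in T i, wt σ (T i)ᶜ x := by
    simp only [f2]
    rw [lintegral_indicator (hm2 i hi), ← lintegral_const_mul _ (measurable_wt _ _)]
    exact lintegral_mul_wt σ (T i) (T i)ᶜ (f := fun _ => ENNReal.ofReal (m i)) measurable_const
  have i3 : ∫⁻ z, f3 i z = ENNReal.ofReal (m i) * ∫⁻ x in T i, wt σ (T i)ᶜ x := by
    simp only [f3]
    rw [lintegral_indicator (hm3 i hi), ← lintegral_const_mul _ (measurable_wt _ _)]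
    exact lintegral_mul_wt' σ (T i)ᶜ (T i) (f := fun _ => ENNReal.ofReal (m i)) measurable_const
  rw [i2, i3]
  refine (add_le_add (add_le_add i1 hwt) hwt).trans (le_of_eq ?_)
  ring

end

section

/-! ### Meshes and nodal functions -/

variable {d : ℕ} {K : Cplx d} {Λ Ω : Set (Eucl d)}

theorem isCompact_elt (t : Finset (Eucl d)) : IsCompact (elt t) :=
  t.finite_toSet.isCompact_convexHull ℝ

theorem measurableSet_elt (t : Finset (Eucl d)) : MeasurableSet (elt t) :=
  (isCompact_elt t).isClosed.measurableSet

theorem affineSpan_eq_top_iff_card {t : Finset (Eucl d)}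
    (ht : AffineIndependent ℝ ((↑) : t → Eucl d)) :
    affineSpan ℝ (t : Set (Eucl d)) = ⊤ ↔ t.card = d + 1 := by
  have := ht.affineSpan_eq_top_iff_card_eq_finrank_add_one
  rw [Subtype.range_coe, Fintype.card_coe, finrank_euclideanSpace, Fintype.card_fin] at this
  exact this

theorem affineSpan_cell {t : Finset (Eucl d)} (ht : t ∈ cells K) :
    affineSpan ℝ (t : Set (Eucl d)) = ⊤ := (affineSpan_eq_top_iff_card (K.indep ht.1)).2 ht.2

theorem interior_elt_nonempty {t : Finset (Eucl d)} (ht : t ∈ cells K) :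
    (interior (elt t)).Nonempty :=
  interior_convexHull_nonempty_iff_affineSpan_eq_top.2 (affineSpan_cell ht)

theorem volume_elt_pos {t : Finset (Eucl d)} (ht : t ∈ cells K) : 0 < volume (elt t) :=
  Measure.measure_pos_of_nonempty_interior _ (interior_elt_nonempty ht)

/-- Distinct cells overlap in a null set. -/
theorem volume_elt_inter {t t' : Finset (Eucl d)} (ht : t ∈ cells K) (ht' : t' ∈ cells K)
    (hne : t ≠ t') : volume (elt t ∩ elt t') = 0 := by
  classical
  have hsub : elt t ∩ elt t' ⊆ affineSpan ℝ ((t ∩ t' : Finset (Eucl d)) : Set (Eucl d)) := by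
    refine (K.inter_subset_convexHull ht.1 ht'.1).trans ?_
    rw [← Finset.coe_inter]
    exact convexHull_subset_affineSpan _
  refine measure_mono_null hsub (Measure.addHaar_affineSubspace _ _ ?_)
  have hind : AffineIndependent ℝ ((↑) : (t ∩ t' : Finset (Eucl d)) → Eucl d) :=
    (K.indep ht.1).mono (by simp)
  rw [Ne, affineSpan_eq_top_iff_card hind]
  intro hcard
  have h1 : t ∩ t' = t := Finset.eq_of_subset_of_card_le Finset.inter_subset_left
    (by rw [hcard, ht.2])
  have h2 : t ∩ t' = t' := Finset.eq_of_subset_of_card_le Finset.inter_subset_right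
    (by rw [hcard, ht'.2])
  exact hne (h1.symm.trans h2)

theorem IsMesh.finite_cells (hK : IsMesh Λ Ω K) : (cells K).Finite :=
  hK.finite.subset fun _ h => h.1

theorem IsMesh.elt_subset (hK : IsMesh Λ Ω K) {t : Finset (Eucl d)} (ht : t ∈ cells K) :
    elt t ⊆ Λ := by
  rw [← hK.covers]
  exact subset_biUnion_of_mem (u := fun t => elt t) ht

theorem IsMesh.isCompact (hK : IsMesh Λ Ω K) : IsCompact Λ := by
  rw [← hK.covers]
  exact hK.finite_cells.isCompact_biUnion fun t _ => isCompact_elt t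

/-- A cell that is not contained in `closure Ω` does not meet the open set `Ω`. -/
theorem IsMesh.disjoint_of_not_subset (hK : IsMesh Λ Ω K) (hΩ : IsOpen Ω)
    {t : Finset (Eucl d)} (ht : t ∈ cells K) (hts : ¬ elt t ⊆ closure Ω) :
    Disjoint (elt t) Ω := by
  rw [Set.disjoint_left]
  intro x hx hxΩ
  -- A cell is the closure of its interior, so a cell meeting `Ω` shares an open set with it. That
  -- set is covered by the cells inside `closure Ω`, which overlap this one in null sets only.
  have hcl : x ∈ closure (interior (elt t)) := by
    have hc : Convex ℝ (elt t) := convex_convexHull ℝ _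
    rw [hc.closure_interior_eq_closure_of_nonempty_interior (interior_elt_nonempty ht)]
    exact subset_closure hx
  obtain ⟨y, hyΩ, hyt⟩ := mem_closure_iff.1 hcl Ω hΩ hxΩ
  have hpos : 0 < volume (Ω ∩ interior (elt t)) :=
    (hΩ.inter isOpen_interior).measure_pos _ ⟨y, hyΩ, hyt⟩
  refine hpos.ne' ?_
  have hsub : Ω ∩ interior (elt t) ⊆
      ⋃ t' ∈ {t' ∈ cells K | elt t' ⊆ closure Ω}, elt t ∩ elt t' := by
    rintro z ⟨hzΩ, hzt⟩
    have := subset_closure hzΩ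
    rw [← hK.exact] at this
    simp only [mem_iUnion] at this ⊢
    obtain ⟨t', ht', hz⟩ := this
    exact ⟨t', ht', interior_subset hzt, hz⟩
  refine measure_mono_null hsub ?_
  rw [measure_biUnion_null_iff (hK.finite_cells.subset (sep_subset _ _)).countable]
  rintro t' ⟨ht', ht's⟩
  refine volume_elt_inter ht ht' ?_
  rintro rfl
  exact hts ht's

/-- The finite set of cells of a mesh. -/
def IsMesh.cellFinset (hK : IsMesh Λ Ω K) : Finset (Finset (Eucl d)) := hK.finite_cells.toFinset

theorem IsMesh.mem_cellFinset (hK : IsMesh Λ Ω K) {t : Finset (Eucl d)} :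
    t ∈ hK.cellFinset ↔ t ∈ cells K := by simp [IsMesh.cellFinset]

open Classical in
/-- The finite set of cells contained in the closure of `Ω`. -/
def IsMesh.innerCells (hK : IsMesh Λ Ω K) : Finset (Finset (Eucl d)) :=
  hK.cellFinset.filter fun t => elt t ⊆ closure Ω

open Classical in
/-- The finite set of cells not contained in the closure of `Ω`. -/
def IsMesh.outerCells (hK : IsMesh Λ Ω K) : Finset (Finset (Eucl d)) :=
  hK.cellFinset.filter fun t => ¬ elt t ⊆ closure Ω

theorem IsMesh.mem_innerCells (hK : IsMesh Λ Ω K) {t : Finset (Eucl d)} :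
    t ∈ hK.innerCells ↔ t ∈ cells K ∧ elt t ⊆ closure Ω := by
  simp [IsMesh.innerCells, hK.mem_cellFinset]

theorem IsMesh.mem_outerCells (hK : IsMesh Λ Ω K) {t : Finset (Eucl d)} :
    t ∈ hK.outerCells ↔ t ∈ cells K ∧ ¬ elt t ⊆ closure Ω := by
  simp [IsMesh.outerCells, hK.mem_cellFinset]

theorem IsMesh.exists_innerCell (hK : IsMesh Λ Ω K) {x : Eucl d} (hx : x ∈ closure Ω) :
    ∃ t ∈ hK.innerCells, x ∈ elt t := by
  rw [← hK.exact] at hx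
  simp only [mem_iUnion] at hx
  obtain ⟨t, ht, hx⟩ := hx
  exact ⟨t, hK.mem_innerCells.2 ht, hx⟩

theorem IsMesh.exists_cell (hK : IsMesh Λ Ω K) {x : Eucl d} (hx : x ∈ Λ) :
    ∃ t ∈ cells K, x ∈ elt t := by
  rw [← hK.covers] at hx
  simpa only [mem_iUnion, exists_prop] using hx

theorem IsMesh.exists_outerCell (hK : IsMesh Λ Ω K) {x : Eucl d} (hx : x ∈ Λ)
    (hxΩ : x ∉ closure Ω) : ∃ t ∈ hK.outerCells, x ∈ elt t := by
  obtain ⟨t, ht, hxt⟩ := hK.exists_cell hx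
  exact ⟨t, hK.mem_outerCells.2 ⟨ht, fun h => hxΩ (h hxt)⟩, hxt⟩

theorem mem_vertices_of_mem_cell {t : Finset (Eucl d)} (ht : t ∈ cells K) {p : Eucl d}
    (hp : p ∈ t) : p ∈ K.vertices :=
  K.down_closed ht.1 (Finset.singleton_subset_iff.2 hp) (Finset.singleton_nonempty p)

/-- Every point of the exterior closed region that is interior to `Λ` lies in an outer cell. -/
theorem IsMesh.exists_outerCell_of_notMem (hK : IsMesh Λ Ω K) (hΩ : IsBoundedLipschitzDomain Ω)
    (hΛ : closure Ω ⊆ interior Λ) {p : Eucl d} (hp : p ∈ Λ) (hpΩ : p ∉ Ω) :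
    ∃ t ∈ hK.outerCells, p ∈ elt t := by
  by_cases hcl : p ∈ closure Ω
  · have hfr : p ∈ frontier Ω := by rw [hΩ.isOpen.frontier_eq]; exact ⟨hcl, hpΩ⟩
    have h1 := hΩ.frontier_subset hfr
    -- A boundary point is a limit of points of `Λ` outside `closure Ω`. These lie in outer cells,
    -- and a finite union of compact cells is closed.
    have hclosed : IsClosed (⋃ t ∈ (hK.outerCells : Set (Finset (Eucl d))), elt t) :=
      (hK.outerCells.finite_toSet.isCompact_biUnion fun t _ => isCompact_elt t).isClosed
    have h2 : p ∈ ⋃ t ∈ (hK.outerCells : Set (Finset (Eucl d))), elt t := by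
      rw [← hclosed.closure_eq, mem_closure_iff]
      intro o ho hpo
      obtain ⟨y, ⟨hyo, hyΛ⟩, hyΩ⟩ := mem_closure_iff.1 h1 (o ∩ interior Λ)
        (ho.inter isOpen_interior) ⟨hpo, hΛ hcl⟩
      refine ⟨y, hyo, ?_⟩
      obtain ⟨t, ht, hyt⟩ := hK.exists_outerCell (interior_subset hyΛ) hyΩ
      simp only [mem_iUnion]
      exact ⟨t, ht, hyt⟩
    simp only [mem_iUnion] at h2
    obtain ⟨t, ht, hpt⟩ := h2
    exact ⟨t, ht, hpt⟩
  · exact hK.exists_outerCell hp hcl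

/-- The affine function with prescribed values at the vertices of a cell. -/
theorem exists_affine_eq {t : Finset (Eucl d)} (ht : t ∈ cells K) (c : Eucl d → ℝ) :
    ∃ q : Eucl d →ᵃ[ℝ] ℝ, ∀ p ∈ t, q p = c p := by
  classical
  let b : AffineBasis t ℝ (Eucl d) := ⟨(↑), K.indep ht.1, by
    rw [Subtype.range_coe]; exact affineSpan_cell ht⟩
  refine ⟨∑ i : t, c i • b.coord i, fun p hp => ?_⟩
  have e : ∀ (s : Finset t) (x : Eucl d), (∑ i ∈ s, c i • b.coord i) x
      = ∑ i ∈ s, c i * b.coord i x := by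
    intro s x
    induction s using Finset.induction_on with
    | empty => simp
    | insert a s ha ih => 
      rw [Finset.sum_insert ha, Finset.sum_insert ha, ← ih]
      rfl
  rw [e]
  have hb : ∀ i : t, b.coord i p = if i = ⟨p, hp⟩ then 1 else 0 := fun i =>
    b.coord_apply i ⟨p, hp⟩
  simp [hb]

theorem exists_isBary {t : Finset (Eucl d)} (ht : t ∈ K.faces) {x : Eucl d} (hx : x ∈ elt t) :
    ∃ w, IsBary K x w ∧ (∀ p ∉ t, w p = 0) ∧ (∀ p ∈ t, 0 ≤ w p) ∧ ∑ p ∈ t, w p = 1 ∧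
      ∑ p ∈ t, w p • p = x := by
  classical
  obtain ⟨w, h0, h1, hx⟩ := Finset.mem_convexHull'.1 hx
  let w' : Eucl d → ℝ := fun p => if p ∈ t then w p else 0
  have hw : ∀ p ∈ t, w' p = w p := fun p hp => if_pos hp
  have hn : ∀ p ∉ t, w' p = 0 := fun p hp => if_neg hp
  have h0' : ∀ p ∈ t, 0 ≤ w' p := fun p hp => by rw [hw p hp]; exact h0 p hp
  have h1' : ∑ p ∈ t, w' p = 1 := by rw [← h1]; exact Finset.sum_congr rfl hw
  have hx' : ∑ p ∈ t, w' p • p = x := by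
    rw [← hx]; exact Finset.sum_congr rfl fun p hp => by rw [hw p hp]
  exact ⟨w', ⟨t, ht, h0', hn, h1', hx'⟩, hn, h0', h1', hx'⟩

theorem affine_eq_sum {t : Finset (Eucl d)} {w : Eucl d → ℝ} {x : Eucl d}
    (h1 : ∑ p ∈ t, w p = 1) (hx : ∑ p ∈ t, w p • p = x) (q : Eucl d →ᵃ[ℝ] ℝ) :
    q x = ∑ p ∈ t, w p * q p := by
  have e := t.affineCombination_eq_linear_combination (fun p => p) w h1
  rw [hx] at e
  rw [← e, Finset.map_affineCombination _ _ _ h1,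
    Finset.affineCombination_eq_linear_combination _ _ _ h1]
  simp

/-- The finite element function with nodal values `c`. -/
def nodal (K : Cplx d) (c : Eucl d → ℝ) (x : Eucl d) : ℝ := ∑ᶠ p ∈ K.vertices, c p * hat K p x

/-- On a cell the hat functions are its barycentric coordinates, and those of all other vertices
vanish. Any affine function with the prescribed vertex values may serve as `q`. -/
theorem nodal_eq {t : Finset (Eucl d)} (ht : t ∈ cells K) {x : Eucl d} (hx : x ∈ elt t)
    {c : Eucl d → ℝ} {q : Eucl d →ᵃ[ℝ] ℝ} (hq : ∀ p ∈ t, q p = c p) : nodal K c x = q x := by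
  obtain ⟨w, hw, hn, -, h1, hwx⟩ := exists_isBary ht.1 hx
  rw [affine_eq_sum h1 hwx q, nodal]
  simp only [hat_eq hw]
  rw [finsum_mem_eq_sum_of_inter_support_eq (t := t)]
  · exact Finset.sum_congr rfl fun p hp => by rw [hq p hp, mul_comm]
  · ext p
    simp only [mem_inter_iff, Finset.mem_coe]
    constructor
    · rintro ⟨hp, hs⟩
      refine ⟨?_, hs⟩
      by_contra hpt
      rw [Function.mem_support, hn p hpt, mul_zero] at hs
      exact hs rfl
    · rintro ⟨hp, hs⟩
      exact ⟨mem_vertices_of_mem_cell ht hp, hs⟩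

theorem IsMesh.hat_eq_zero (hK : IsMesh Λ Ω K) {x : Eucl d} (hx : x ∉ Λ) (p : Eucl d) :
    hat K p x = 0 := by
  rw [hat, dif_neg]
  rintro ⟨w, t, ht, h0, -, h1, hwx⟩
  obtain ⟨t', ht', htt'⟩ := hK.pure t ht
  refine hx (hK.elt_subset ht' ?_)
  exact convexHull_mono (Finset.coe_subset.2 htt') (Finset.mem_convexHull'.2 ⟨w, h0, h1, hwx⟩)

theorem IsMesh.nodal_eq_zero (hK : IsMesh Λ Ω K) {x : Eucl d} (hx : x ∉ Λ) (c : Eucl d → ℝ) :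
    nodal K c x = 0 := by
  simp [nodal, hK.hat_eq_zero hx]

theorem IsMesh.continuousOn (hK : IsMesh Λ Ω K) {v : Eucl d → ℝ}
    (hv : ∀ t ∈ cells K, ∃ q : Eucl d →ᵃ[ℝ] ℝ, EqOn v q (elt t)) : ContinuousOn v Λ := by
  rw [← hK.covers, biUnion_eq_iUnion]
  have : Finite (cells K) := hK.finite_cells
  refine (locallyFinite_of_finite _).continuousOn_iUnion
    (fun t => (isCompact_elt t.1).isClosed) fun t => ?_
  obtain ⟨q, hq⟩ := hv t t.2
  exact (q.continuous_of_finiteDimensional.continuousOn).congr hq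

theorem IsMesh.nodal_mem (hK : IsMesh Λ Ω K) (c : Eucl d → ℝ) : nodal K c ∈ feSpace Λ K := by
  have : ∀ t ∈ cells K, ∃ q : Eucl d →ᵃ[ℝ] ℝ, EqOn (nodal K c) q (elt t) := by
    intro t ht
    obtain ⟨q, hq⟩ := exists_affine_eq ht c
    exact ⟨q, fun x hx => nodal_eq ht hx hq⟩
  exact ⟨hK.continuousOn this, this, fun x hx => hK.nodal_eq_zero hx c⟩

theorem IsMesh.measurable_of_mem (hK : IsMesh Λ Ω K) {v : Eucl d → ℝ} (hv : v ∈ feSpace Λ K) :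
    Measurable v := by
  have hΛ : MeasurableSet Λ := hK.isCompact.isClosed.measurableSet
  classical
  have : v = Λ.piecewise v fun _ => 0 := by
    ext x
    by_cases hx : x ∈ Λ
    · rw [piecewise_eq_of_mem _ _ _ hx]
    · rw [piecewise_eq_of_notMem _ _ _ hx, hv.2.2 x hx]
  rw [this]
  exact hv.1.measurable_piecewise continuousOn_const hΛ

/-- A value in the cell is a convex combination of the vertex values. -/
theorem nodal_abs_le {t : Finset (Eucl d)} (ht : t ∈ cells K) {x : Eucl d} (hx : x ∈ elt t)
    {c : Eucl d → ℝ} {m : ℝ} (hm : ∀ p ∈ t, |c p| ≤ m) : |nodal K c x| ≤ m := by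
  obtain ⟨q, hq⟩ := exists_affine_eq ht c
  obtain ⟨w, -, -, h0, h1, hwx⟩ := exists_isBary ht.1 hx
  rw [nodal_eq ht hx hq, affine_eq_sum h1 hwx q]
  refine (Finset.abs_sum_le_sum_abs _ _).trans ?_
  rw [← one_mul m, ← h1, Finset.sum_mul]
  refine Finset.sum_le_sum fun p hp => ?_
  rw [abs_mul, abs_of_nonneg (h0 p hp), hq p hp]
  exact mul_le_mul_of_nonneg_left (hm p hp) (h0 p hp)

theorem nodal_sub {t : Finset (Eucl d)} (ht : t ∈ cells K) {x : Eucl d} (hx : x ∈ elt t)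
    (c c' : Eucl d → ℝ) :
    nodal K c x - nodal K c' x = nodal K (fun p => c p - c' p) x := by
  obtain ⟨q, hq⟩ := exists_affine_eq ht c
  obtain ⟨q', hq'⟩ := exists_affine_eq ht c'
  rw [nodal_eq ht hx hq, nodal_eq ht hx hq', nodal_eq ht hx (q := q - q')]
  · simp
  · intro p hp
    simp [hq p hp, hq' p hp]

theorem nodal_const {t : Finset (Eucl d)} (ht : t ∈ cells K) {x : Eucl d} (hx : x ∈ elt t)
    (a : ℝ) : nodal K (fun _ => a) x = a := by
  rw [nodal_eq ht hx (q := AffineMap.const ℝ _ a) (fun p _ => by simp)]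
  simp

theorem nodal_sq_le {t : Finset (Eucl d)} (ht : t ∈ cells K) {x : Eucl d} (hx : x ∈ elt t)
    (c : Eucl d → ℝ) : (nodal K c x) ^ 2 ≤ ∑ p ∈ t, c p ^ 2 := by
  have hm : ∀ p ∈ t, |c p| ≤ √(∑ p ∈ t, c p ^ 2) := fun p hp => by
    rw [← Real.sqrt_sq_eq_abs]
    exact Real.sqrt_le_sqrt (Finset.single_le_sum (f := fun p => c p ^ 2)
      (fun _ _ => sq_nonneg _) hp)
  have := nodal_abs_le ht hx hm
  rw [← sq_abs, ← Real.sq_sqrt (Finset.sum_nonneg fun p _ => sq_nonneg (c p))]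
  gcongr

open Classical in
theorem exteriorClement_eq (K : Cplx d) (Ω : Set (Eucl d)) (g : Eucl d → ℝ) (x : Eucl d) :
    exteriorClement K Ω g x =
      nodal K (fun p => if p ∈ Ω then 0 else l2Proj (star K p ∩ Ωᶜ) g p) x := by
  rw [exteriorClement, nodal, finsum_mem_def, finsum_mem_def]
  refine finsum_congr fun p => ?_
  by_cases h1 : p ∈ K.vertices <;> by_cases h2 : p ∈ Ω <;> simp [indicator, h1, h2]

theorem diam_le_meshSize (hK : IsMesh Λ Ω K) {t : Finset (Eucl d)} (ht : t ∈ cells K) :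
    Metric.diam (elt t) ≤ meshSize K :=
  le_csSup (hK.finite_cells.image _).bddAbove (mem_image_of_mem _ ht)

theorem diam_elt_pos (hd : 1 ≤ d) {t : Finset (Eucl d)} (ht : t ∈ cells K) :
    0 < Metric.diam (elt t) := by
  obtain ⟨p, hp, q, hq, hpq⟩ := Finset.one_lt_card.1 (show 1 < t.card by rw [ht.2]; omega)
  have h1 : 0 < dist p q := dist_pos.2 hpq
  refine h1.trans_le (Metric.dist_le_diam_of_mem (isCompact_elt t).isBounded ?_ ?_)
  · exact subset_convexHull ℝ _ hp
  · exact subset_convexHull ℝ _ hq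

/-- In a shape-regular mesh, each cell is fat, with parameter controlled by the regularity
constant. -/
theorem isFat_elt (hd : 1 ≤ d) {σ : ℝ} {t : Finset (Eucl d)} (ht : t ∈ cells K)
    (h : Metric.diam (elt t) ≤ σ * inDiam (elt t)) :
    IsFat (4 * |σ| + 1) (Metric.diam (elt t) / (4 * |σ| + 1)) (elt t) := by
  have hD := diam_elt_pos hd ht
  have hκ : 0 < 4 * |σ| + 1 := by positivity
  have hin0 : inDiam (elt t) ≠ 0 := by
    intro h0
    rw [h0, mul_zero] at h
    linarith
  have hnn : 0 ≤ inDiam (elt t) := Real.sSup_nonneg fun ρ hρ => hρ.1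
  have hpos : 0 < inDiam (elt t) := lt_of_le_of_ne hnn hin0.symm
  have hne : {ρ : ℝ | 0 ≤ ρ ∧ ∃ c, Metric.closedBall c (ρ / 2) ⊆ elt t}.Nonempty := by
    rw [nonempty_iff_ne_empty]
    intro he
    rw [inDiam, he, Real.sSup_empty] at hpos
    exact lt_irrefl _ hpos
  -- A ball of diameter above half the supremum avoids showing that the supremum is attained. Then
  -- `diam ≤ 2 |σ| ρ`, so the radius `ρ / 2` is at least `diam / (4 |σ| + 1)`; the `+ 1` keeps the
  -- denominator positive.
  obtain ⟨ρ, ⟨hρ0, c, hc⟩, hρ⟩ := exists_lt_of_lt_csSup hne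
    (show inDiam (elt t) / 2 < inDiam (elt t) by linarith)
  refine ⟨isCompact_elt t, convex_convexHull ℝ _, by positivity, ⟨c, ?_⟩, ?_⟩
  · refine (Metric.closedBall_subset_closedBall ?_).trans hc
    rw [div_le_iff₀ hκ]
    have h1 : σ * inDiam (elt t) ≤ |σ| * inDiam (elt t) := by
      gcongr; exact le_abs_self σ
    have h2 : |σ| * inDiam (elt t) ≤ |σ| * (2 * ρ) := by gcongr; linarith
    nlinarith [abs_nonneg σ]
  · intro x hx y hy
    rw [mul_div_cancel₀ _ hκ.ne']
    exact Metric.dist_le_diam_of_mem (isCompact_elt t).isBounded hx hy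

end

section

/-! ### Local `L²`-projections onto affine functions -/

variable {d : ℕ}

theorem memLp_two_of_bounded {A : Set (Eucl d)} (hA : MeasurableSet A)
    (hAb : Bornology.IsBounded A) {f : Eucl d → ℝ} (hf : Measurable f) {M : ℝ}
    (hM : ∀ x ∈ A, |f x| ≤ M) : MemLp f 2 (volume.restrict A) := by
  have : IsFiniteMeasure (volume.restrict A) := ⟨by simpa using hAb.measure_lt_top⟩
  refine MemLp.of_bound hf.aestronglyMeasurable M ?_
  filter_upwards [ae_restrict_mem hA] with x hx using hM x hx

theorem measurable_affine (q : Eucl d →ᵃ[ℝ] ℝ) : Measurable q :=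
  q.continuous_of_finiteDimensional.measurable

theorem exists_abs_affine_le (q : Eucl d →ᵃ[ℝ] ℝ) {A : Set (Eucl d)}
    (hAb : Bornology.IsBounded A) : ∃ M, ∀ x ∈ A, |q x| ≤ M := by
  obtain ⟨M, hM⟩ := hAb.isCompact_closure.exists_bound_of_continuousOn
    q.continuous_of_finiteDimensional.continuousOn
  exact ⟨M, fun x hx => hM x (subset_closure hx)⟩

theorem memLp_two_affine (q : Eucl d →ᵃ[ℝ] ℝ) {A : Set (Eucl d)} (hA : MeasurableSet A)
    (hAb : Bornology.IsBounded A) : MemLp q 2 (volume.restrict A) := by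
  obtain ⟨M, hM⟩ := exists_abs_affine_le q hAb
  exact memLp_two_of_bounded hA hAb (measurable_affine q) hM

/-- The `L²`-projection onto affine functions exists. -/
theorem exists_isL2Proj {A : Set (Eucl d)} (hA : MeasurableSet A) (hAb : Bornology.IsBounded A)
    {g : Eucl d → ℝ} (hg : MemLp g 2 (volume.restrict A)) : ∃ q, IsL2Proj A g q := by
  -- Affine functions have a finite-dimensional image in `L²`, onto which the orthogonal projection
  -- exists.
  let Φ : (Eucl d →ᵃ[ℝ] ℝ) →ₗ[ℝ] Lp ℝ 2 (volume.restrict A) :=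
    { toFun := fun q => (memLp_two_affine q hA hAb).toLp q
      map_add' := fun q q' => MemLp.toLp_add _ _
      map_smul' := fun c q => MemLp.toLp_const_smul c (memLp_two_affine q hA hAb) }
  obtain ⟨q, hq⟩ := (LinearMap.range Φ).starProjection_apply_mem (hg.toLp g)
  refine ⟨q, fun p => ?_⟩
  have h := (Submodule.mem_orthogonal _ _).1
    ((LinearMap.range Φ).sub_starProjection_mem_orthogonal (hg.toLp g)) (Φ p) ⟨p, rfl⟩
  rw [← hq, L2.inner_def] at h
  rw [← h]
  refine integral_congr_ae ?_
  filter_upwards [Lp.coeFn_sub (hg.toLp g) (Φ q), hg.coeFn_toLp,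
    (memLp_two_affine q hA hAb).coeFn_toLp, (memLp_two_affine p hA hAb).coeFn_toLp]
    with x h1 h2 h3 h4
  have h3' : (Φ q : Eucl d → ℝ) x = q x := h3
  have h4' : (Φ p : Eucl d → ℝ) x = p x := h4
  rw [h1, Pi.sub_apply, h2, h3', h4']
  rfl

/-- The orthogonality relations are linear, so estimates for differences of projections hold for
whichever projections were chosen, and uniqueness is never needed. -/
theorem IsL2Proj.sub {A : Set (Eucl d)} (hA : MeasurableSet A) (hAb : Bornology.IsBounded A)
    {f g : Eucl d → ℝ} (hf : MemLp f 2 (volume.restrict A)) (hg : MemLp g 2 (volume.restrict A))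
    {q q' : Eucl d →ᵃ[ℝ] ℝ} (h : IsL2Proj A f q) (h' : IsL2Proj A g q') :
    IsL2Proj A (fun x => f x - g x) (q - q') := by
  intro p
  have hp := memLp_two_affine p hA hAb
  have h1 : Integrable (fun x => (f x - q x) * p x) (volume.restrict A) :=
    (hf.sub (memLp_two_affine q hA hAb)).integrable_mul hp
  have h2 : Integrable (fun x => (g x - q' x) * p x) (volume.restrict A) :=
    (hg.sub (memLp_two_affine q' hA hAb)).integrable_mul hp
  have := integral_sub h1 h2
  rw [h p, h' p, sub_zero] at this
  rw [← this]
  refine integral_congr_ae (ae_of_all _ fun x => ?_)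
  have : (q - q') x = q x - q' x := rfl
  simp only [this]
  ring

theorem isL2Proj_const (A : Set (Eucl d)) (a : ℝ) :
    IsL2Proj A (fun _ => a) (AffineMap.const ℝ (Eucl d) a) := by
  intro p
  simp

theorem isL2Proj_congr_set {A B : Set (Eucl d)} (h : A =ᵐ[volume] B) {g : Eucl d → ℝ}
    {q : Eucl d →ᵃ[ℝ] ℝ} (hq : IsL2Proj A g q) : IsL2Proj B g q := fun p => by
  rw [← hq p]
  exact setIntegral_congr_set h.symm

theorem IsL2Proj.lintegral_sq_le {A : Set (Eucl d)} (hA : MeasurableSet A)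
    (hAb : Bornology.IsBounded A) {g : Eucl d → ℝ} (hg : MemLp g 2 (volume.restrict A))
    {q : Eucl d →ᵃ[ℝ] ℝ} (h : IsL2Proj A g q) :
    ∫⁻ x in A, ENNReal.ofReal (q x ^ 2) ≤ ∫⁻ x in A, ENNReal.ofReal (g x ^ 2) := by
  have hq := memLp_two_affine q hA hAb
  have h1 : Integrable (fun x => (g x - q x) * q x) (volume.restrict A) :=
    (hg.sub hq).integrable_mul hq
  have h2 : Integrable (fun x => g x ^ 2) (volume.restrict A) := hg.integrable_sq
  have h3 : Integrable (fun x => q x ^ 2) (volume.restrict A) := hq.integrable_sq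
  rw [← ofReal_integral_eq_lintegral_ofReal h2 (ae_of_all _ fun x => sq_nonneg _),
    ← ofReal_integral_eq_lintegral_ofReal h3 (ae_of_all _ fun x => sq_nonneg _)]
  refine ENNReal.ofReal_le_ofReal ?_
  have h4 : ∫ x in A, q x ^ 2 + 2 * ((g x - q x) * q x) ≤ ∫ x in A, g x ^ 2 := by
    refine integral_mono (h3.add (h1.const_mul 2)) h2 fun x => ?_
    nlinarith [sq_nonneg (g x - q x)]
  rw [integral_add h3 (h1.const_mul 2), integral_const_mul, h q] at h4
  linarith

theorem lintegral_half_smul_add (f : Eucl d → ℝ≥0∞) (hf : Measurable f) (c : Eucl d) :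
    ∫⁻ y, f ((1 / 2 : ℝ) • y + c) = 2 ^ d * ∫⁻ y, f y := by
  have h2 : (1 / 2 : ℝ) ≠ 0 := by norm_num
  have hm := Measure.map_addHaar_smul (volume : Measure (Eucl d)) h2
  rw [← lintegral_map (f := fun y => f (y + c)) (by fun_prop) (measurable_const_smul (1 / 2 : ℝ)),
    hm, lintegral_smul_measure, lintegral_add_right_eq_self, finrank_euclideanSpace,
    Fintype.card_fin, smul_eq_mul]
  congr 1
  rw [abs_of_pos (by positivity), one_div, inv_pow, inv_inv,
    ENNReal.ofReal_pow (by norm_num), ENNReal.ofReal_ofNat]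

/-- The constant in the pointwise bound of an affine function by its mean square. -/
def affConst (d : ℕ) : ℝ≥0∞ := 8 * 2 ^ d + 2

theorem affConst_ne_top : affConst d ≠ ∞ := by
  unfold affConst
  exact ENNReal.add_ne_top.2 ⟨ENNReal.mul_ne_top (by simp) (by simp), by simp⟩

/-- An affine function is controlled at `p` by its mean square on a set that is star-shaped
with respect to `p`. -/
theorem volume_mul_sq_le {A : Set (Eucl d)} (hA : MeasurableSet A) {p : Eucl d}
    (hstar : ∀ y ∈ A, (1 / 2 : ℝ) • y + (1 / 2 : ℝ) • p ∈ A) (q : Eucl d →ᵃ[ℝ] ℝ) :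
    volume A * ENNReal.ofReal (q p ^ 2) ≤
      affConst d * ∫⁻ x in A, ENNReal.ofReal (q x ^ 2) := by
  have hq : Measurable q := measurable_affine q
  have hmid : ∀ y, q ((1 / 2 : ℝ) • y + (1 / 2 : ℝ) • p) = (q y + q p) / 2 := by
    intro y
    rw [show (1 / 2 : ℝ) • y + (1 / 2 : ℝ) • p = AffineMap.lineMap p y (1 / 2 : ℝ) by
      rw [AffineMap.lineMap_apply_module, add_comm]; norm_num, AffineMap.apply_lineMap,
      AffineMap.lineMap_apply_module]
    simp only [smul_eq_mul]
    ring
  let G : Eucl d → ℝ≥0∞ := A.indicator fun x => ENNReal.ofReal (q x ^ 2)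
  have hG : Measurable G := Measurable.indicator (by fun_prop) hA
  -- Affinity gives `q p = 2 q(m) - q y` at the midpoint `m` of `y` and `p`, hence `q(p)² ≤ 8 q(m)²
  -- + 2 q(y)²`. Integrated over `y`, the midpoint map contributes the factor `2^d`.
  have key : ∀ y ∈ A, ENNReal.ofReal (q p ^ 2) ≤
      8 * G ((1 / 2 : ℝ) • y + (1 / 2 : ℝ) • p) + 2 * ENNReal.ofReal (q y ^ 2) := by
    intro y hy
    simp only [G, indicator_of_mem (hstar y hy), hmid]
    have e8 : (8 : ℝ≥0∞) = ENNReal.ofReal 8 := (ENNReal.ofReal_ofNat 8).symm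
    have e2 : (2 : ℝ≥0∞) = ENNReal.ofReal 2 := (ENNReal.ofReal_ofNat 2).symm
    simp only [e8, e2]
    rw [← ENNReal.ofReal_mul (by norm_num), ← ENNReal.ofReal_mul (by norm_num),
      ← ENNReal.ofReal_add (by positivity) (by positivity)]
    refine ENNReal.ofReal_le_ofReal ?_
    nlinarith [sq_nonneg ((q y + q p) + q y)]
  calc volume A * ENNReal.ofReal (q p ^ 2) = ∫⁻ y in A, ENNReal.ofReal (q p ^ 2) := by
        rw [setLIntegral_const, mul_comm]
    _ ≤ ∫⁻ y in A, 8 * G ((1 / 2 : ℝ) • y + (1 / 2 : ℝ) • p) +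
          2 * ENNReal.ofReal (q y ^ 2) := setLIntegral_mono' hA key
    _ = 8 * (∫⁻ y in A, G ((1 / 2 : ℝ) • y + (1 / 2 : ℝ) • p)) +
          2 * ∫⁻ y in A, ENNReal.ofReal (q y ^ 2) := by
        rw [lintegral_add_left (by fun_prop), lintegral_const_mul _ (by fun_prop),
          lintegral_const_mul _ (by fun_prop)]
    _ ≤ 8 * (∫⁻ y, G ((1 / 2 : ℝ) • y + (1 / 2 : ℝ) • p)) +
          2 * ∫⁻ y in A, ENNReal.ofReal (q y ^ 2) := by
        gcongr
        exact Measure.restrict_le_self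
    _ = _ := by
        rw [lintegral_half_smul_add G hG, lintegral_indicator hA, affConst]
        ring

/-! ### The exterior Clément interpolant -/

variable {K : Cplx d} {Λ Ω : Set (Eucl d)}

/-- The union of the outer cells containing `p`. -/
def outerPatch (K : Cplx d) (Ω : Set (Eucl d)) (p : Eucl d) : Set (Eucl d) :=
  ⋃ t ∈ {t ∈ cells K | ¬ elt t ⊆ closure Ω ∧ p ∈ elt t}, elt t

theorem IsMesh.measurableSet_outerPatch (hK : IsMesh Λ Ω K) (p : Eucl d) :
    MeasurableSet (outerPatch K Ω p) :=
  (hK.finite_cells.subset (sep_subset _ _)).measurableSet_biUnion fun t _ => measurableSet_elt t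

theorem IsMesh.outerPatch_subset (hK : IsMesh Λ Ω K) (p : Eucl d) : outerPatch K Ω p ⊆ Λ :=
  iUnion₂_subset fun _ ht => hK.elt_subset ht.1

/-- Every cell of the patch is convex and contains `p`, so the patch is star-shaped about `p`
although it need not be convex. -/
theorem midpoint_mem_outerPatch {p y : Eucl d} (hy : y ∈ outerPatch K Ω p) :
    (1 / 2 : ℝ) • y + (1 / 2 : ℝ) • p ∈ outerPatch K Ω p := by
  simp only [outerPatch, mem_iUnion] at hy ⊢
  obtain ⟨t, ht, hy⟩ := hy
  exact ⟨t, ht, (convex_convexHull ℝ _) hy ht.2.2 (by norm_num) (by norm_num) (by norm_num)⟩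

theorem IsMesh.dist_le_of_mem_outerPatch (hK : IsMesh Λ Ω K) {p y : Eucl d}
    (hy : y ∈ outerPatch K Ω p) : dist y p ≤ meshSize K := by
  simp only [outerPatch, mem_iUnion] at hy
  obtain ⟨t, ht, hy⟩ := hy
  exact (Metric.dist_le_diam_of_mem (isCompact_elt t).isBounded hy ht.2.2).trans
    (diam_le_meshSize hK ht.1)

theorem IsMesh.vertices_subset (hK : IsMesh Λ Ω K) : K.vertices ⊆ Λ := by
  intro p hp
  obtain ⟨t, ht, hpt⟩ := hK.pure _ hp
  exact hK.elt_subset ht (subset_convexHull ℝ _ (hpt (Finset.mem_singleton_self p)))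

theorem IsMesh.volume_outerPatch_pos (hK : IsMesh Λ Ω K) (hΩ : IsBoundedLipschitzDomain Ω)
    (hΛ : closure Ω ⊆ interior Λ) {p : Eucl d} (hp : p ∈ K.vertices) (hpΩ : p ∉ Ω) :
    0 < volume (outerPatch K Ω p) := by
  obtain ⟨t, ht, hpt⟩ := hK.exists_outerCell_of_notMem hΩ hΛ (hK.vertices_subset hp) hpΩ
  rw [hK.mem_outerCells] at ht
  exact (volume_elt_pos ht.1).trans_le
    (measure_mono (subset_biUnion_of_mem (u := fun t => elt t)
      (show t ∈ {t ∈ cells K | ¬ elt t ⊆ closure Ω ∧ p ∈ elt t} from ⟨ht.1, ht.2, hpt⟩)))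

theorem IsMesh.isBounded (hK : IsMesh Λ Ω K) : Bornology.IsBounded Λ := hK.isCompact.isBounded

theorem IsMesh.measurableSet (hK : IsMesh Λ Ω K) : MeasurableSet Λ :=
  hK.isCompact.isClosed.measurableSet

/-- Inner cells of the star meet `Ωᶜ` only in the null frontier of `Ω`, and outer cells do not meet
`Ω`. The projections may therefore be analysed on whole cells. -/
theorem IsMesh.outerPatch_ae_eq (hK : IsMesh Λ Ω K) (hΩ : IsBoundedLipschitzDomain Ω)
    (p : Eucl d) : (star K p ∩ Ωᶜ : Set (Eucl d)) =ᵐ[volume] outerPatch K Ω p := by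
  refine ae_eq_set.2 ⟨measure_mono_null ?_ hΩ.volume_frontier, ?_⟩
  · rintro x ⟨⟨hx, hxΩ⟩, hxo⟩
    simp only [star, mem_iUnion] at hx
    obtain ⟨t, ht, hx⟩ := hx
    rw [hΩ.isOpen.frontier_eq]
    refine ⟨?_, hxΩ⟩
    by_contra hcl
    refine hxo ?_
    simp only [outerPatch, mem_iUnion]
    exact ⟨t, ⟨ht.1, fun h => hcl (h hx), ht.2⟩, hx⟩
  · have : outerPatch K Ω p \ (star K p ∩ Ωᶜ) = ∅ := by
      refine sdiff_eq_bot_iff.2 ?_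
      intro x hx
      simp only [outerPatch, mem_iUnion] at hx
      obtain ⟨t, ht, hx⟩ := hx
      refine ⟨?_, fun h => Set.disjoint_left.1
        (hK.disjoint_of_not_subset hΩ.isOpen ht.1 ht.2.1) hx h⟩
      simp only [star, mem_iUnion]
      exact ⟨t, ⟨ht.1, ht.2.2⟩, hx⟩
    rw [this, measure_empty]

theorem IsMesh.isBounded_outerPatch (hK : IsMesh Λ Ω K) (p : Eucl d) :
    Bornology.IsBounded (outerPatch K Ω p) := hK.isBounded.subset (hK.outerPatch_subset p)

theorem IsMesh.volume_outerPatch_ne_top (hK : IsMesh Λ Ω K) (p : Eucl d) :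
    volume (outerPatch K Ω p) ≠ ∞ := (hK.isBounded_outerPatch p).measure_lt_top.ne

/-- The nodal value of the exterior Clément interpolant. -/
def clementValue (K : Cplx d) (Ω : Set (Eucl d)) (g : Eucl d → ℝ) (p : Eucl d) : ℝ :=
  l2Proj (star K p ∩ Ωᶜ) g p

/-- A bounded measurable function. -/
def BddMeas (g : Eucl d → ℝ) (M : ℝ) : Prop := Measurable g ∧ ∀ x, |g x| ≤ M

theorem BddMeas.sub {f g : Eucl d → ℝ} {M N : ℝ} (hf : BddMeas f M) (hg : BddMeas g N) :
    BddMeas (fun x => f x - g x) (M + N) :=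
  ⟨hf.1.sub hg.1, fun x => (abs_sub _ _).trans (add_le_add (hf.2 x) (hg.2 x))⟩

theorem BddMeas.memLp {g : Eucl d → ℝ} {M : ℝ} (hg : BddMeas g M) {A : Set (Eucl d)}
    (hA : MeasurableSet A) (hAb : Bornology.IsBounded A) : MemLp g 2 (volume.restrict A) :=
  memLp_two_of_bounded hA hAb hg.1 fun x _ => hg.2 x

theorem IsMesh.isL2Proj_outerPatch (hK : IsMesh Λ Ω K) (hΩ : IsBoundedLipschitzDomain Ω)
    {g : Eucl d → ℝ} {M : ℝ} (hg : BddMeas g M) (p : Eucl d) :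
    IsL2Proj (outerPatch K Ω p) g (l2Proj (star K p ∩ Ωᶜ) g) := by
  refine isL2Proj_congr_set (hK.outerPatch_ae_eq hΩ p) (Classical.epsilon_spec ?_)
  obtain ⟨q, hq⟩ := exists_isL2Proj (hK.measurableSet_outerPatch p) (hK.isBounded_outerPatch p)
    (hg.memLp (hK.measurableSet_outerPatch p) (hK.isBounded_outerPatch p))
  exact ⟨q, isL2Proj_congr_set (hK.outerPatch_ae_eq hΩ p).symm hq⟩

theorem IsMesh.volume_mul_sq_le_of_isL2Proj (hK : IsMesh Λ Ω K) {f : Eucl d → ℝ} {M : ℝ}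
    (hf : BddMeas f M) {p : Eucl d} {q : Eucl d →ᵃ[ℝ] ℝ} (hq : IsL2Proj (outerPatch K Ω p) f q) :
    volume (outerPatch K Ω p) * ENNReal.ofReal (q p ^ 2) ≤
      affConst d * ∫⁻ x in outerPatch K Ω p, ENNReal.ofReal (f x ^ 2) := by
  have hm := hK.measurableSet_outerPatch (Ω := Ω) p
  have hb := hK.isBounded_outerPatch (Ω := Ω) p
  refine (volume_mul_sq_le hm (fun y hy => midpoint_mem_outerPatch hy) q).trans ?_
  exact mul_le_mul_right (hq.lintegral_sq_le hm hb (hf.memLp hm hb)) _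

theorem IsMesh.volume_mul_clementValue_sub_sq_le (hK : IsMesh Λ Ω K)
    (hΩ : IsBoundedLipschitzDomain Ω) {f g : Eucl d → ℝ} {M N : ℝ} (hf : BddMeas f M)
    (hg : BddMeas g N) (p : Eucl d) :
    volume (outerPatch K Ω p) *
        ENNReal.ofReal ((clementValue K Ω f p - clementValue K Ω g p) ^ 2) ≤
      affConst d * ∫⁻ x in outerPatch K Ω p, ENNReal.ofReal ((f x - g x) ^ 2) := by
  have hm := hK.measurableSet_outerPatch (Ω := Ω) p
  have hb := hK.isBounded_outerPatch (Ω := Ω) p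
  exact hK.volume_mul_sq_le_of_isL2Proj (hf.sub hg)
    ((hK.isL2Proj_outerPatch hΩ hf p).sub hm hb (hf.memLp hm hb) (hg.memLp hm hb)
      (hK.isL2Proj_outerPatch hΩ hg p))

/-- Projection preserves constants, so the mean-square bound applies to `f - a` on the patch, and
the patch volume cancels. The constant depends only on `d`. -/
theorem IsMesh.abs_clementValue_sub_le (hK : IsMesh Λ Ω K) (hΩ : IsBoundedLipschitzDomain Ω)
    (hΛ : closure Ω ⊆ interior Λ) {f : Eucl d → ℝ} {M : ℝ} (hf : BddMeas f M) {p : Eucl d}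
    (hp : p ∈ K.vertices) (hpΩ : p ∉ Ω) {a ω : ℝ} (hω : 0 ≤ ω)
    (h : ∀ y, dist y p ≤ meshSize K → |f y - a| ≤ ω) :
    |clementValue K Ω f p - a| ≤ (affConst d).toReal * ω := by
  have hm := hK.measurableSet_outerPatch (Ω := Ω) p
  have hb := hK.isBounded_outerPatch (Ω := Ω) p
  have hc : BddMeas (fun _ : Eucl d => a) |a| := ⟨measurable_const, fun _ => le_rfl⟩
  have h1 := hK.volume_mul_sq_le_of_isL2Proj (hf.sub hc)
    ((hK.isL2Proj_outerPatch hΩ hf p).sub hm hb (hf.memLp hm hb) (hc.memLp hm hb)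
      (isL2Proj_const _ a))
  have h2 : ∫⁻ x in outerPatch K Ω p, ENNReal.ofReal ((f x - a) ^ 2) ≤
      ENNReal.ofReal (ω ^ 2) * volume (outerPatch K Ω p) := by
    rw [← setLIntegral_const]
    refine setLIntegral_mono' hm fun x hx => ENNReal.ofReal_le_ofReal ?_
    rw [← sq_abs]
    have := h x (hK.dist_le_of_mem_outerPatch hx)
    gcongr
  have h3 := h1.trans (mul_le_mul_right h2 (affConst d))
  rw [← mul_assoc, mul_comm (volume _)] at h3
  have h4 := (ENNReal.mul_le_mul_iff_left (hK.volume_outerPatch_pos hΩ hΛ hp hpΩ).ne'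
    (hK.volume_outerPatch_ne_top p)).1 h3
  set C := (affConst d).toReal with hC
  -- Allows `C` in place of `√C` when the square root is taken.
  have hC1 : 1 ≤ C := by
    rw [hC, ← ENNReal.toReal_one]
    refine ENNReal.toReal_mono affConst_ne_top ?_
    unfold affConst
    exact le_add_left (by norm_num)
  rw [← ENNReal.ofReal_toReal affConst_ne_top, ← hC, ← ENNReal.ofReal_mul (by positivity),
    ENNReal.ofReal_le_ofReal_iff (by positivity)] at h4
  have h5 : (clementValue K Ω f p - a) ^ 2 ≤ (C * ω) ^ 2 := by
    refine le_trans h4 ?_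
    rw [mul_pow]
    have : C ≤ C ^ 2 := by nlinarith
    gcongr
  exact abs_le_of_sq_le_sq h5 (by positivity)

end

section

/-! ### Convergence of the exterior Clément interpolant -/

variable {d : ℕ} {K : Cplx d} {Λ Ω : Set (Eucl d)}

theorem IsMesh.notMem_of_outerCell (hK : IsMesh Λ Ω K) (hΩ : IsOpen Ω) {t : Finset (Eucl d)}
    (ht : t ∈ hK.outerCells) {x : Eucl d} (hx : x ∈ elt t) : x ∉ Ω := fun h => by
  rw [hK.mem_outerCells] at ht
  exact Set.disjoint_left.1 (hK.disjoint_of_not_subset hΩ ht.1 ht.2) hx h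

theorem mem_elt_of_mem {t : Finset (Eucl d)} {p : Eucl d} (hp : p ∈ t) : p ∈ elt t :=
  subset_convexHull ℝ _ hp

theorem pairwise_aedisjoint_elt {I : Finset (Finset (Eucl d))} (hI : ∀ t ∈ I, t ∈ cells K) :
    (I : Set (Finset (Eucl d))).Pairwise (Function.onFun (AEDisjoint volume) elt) :=
  fun t ht t' ht' hne => volume_elt_inter (hI t ht) (hI t' ht') hne

theorem lintegral_biUnion_elt {I : Finset (Finset (Eucl d))} (hI : ∀ t ∈ I, t ∈ cells K)
    (f : Eucl d → ℝ≥0∞) : ∫⁻ x in ⋃ t ∈ I, elt t, f x = ∑ t ∈ I, ∫⁻ x in elt t, f x :=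
  lintegral_biUnion_finset₀ (pairwise_aedisjoint_elt hI)
    (fun t _ => (measurableSet_elt t).nullMeasurableSet) f

open Classical in
theorem IsMesh.outerPatch_eq (hK : IsMesh Λ Ω K) {p : Eucl d} (hp : p ∈ K.vertices) :
    outerPatch K Ω p = ⋃ t ∈ hK.outerCells.filter (p ∈ ·), elt t := by
  ext x
  simp only [outerPatch, mem_iUnion, Finset.mem_filter, hK.mem_outerCells, mem_ofPred_eq,
    exists_prop]
  refine exists_congr fun t => and_congr_left fun _ => ?_
  constructor
  · rintro ⟨h1, h2, h3⟩
    exact ⟨⟨h1, h2⟩, (Geometry.SimplicialComplex.vertex_mem_convexHull_iff hp h1.1).1 h3⟩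
  · rintro ⟨⟨h1, h2⟩, h3⟩
    exact ⟨h1, h2, mem_elt_of_mem h3⟩

open Classical in
theorem IsMesh.lintegral_outerPatch (hK : IsMesh Λ Ω K) {p : Eucl d} (hp : p ∈ K.vertices)
    (f : Eucl d → ℝ≥0∞) : ∫⁻ x in outerPatch K Ω p, f x =
      ∑ t ∈ hK.outerCells.filter (p ∈ ·), ∫⁻ x in elt t, f x := by
  rw [hK.outerPatch_eq hp, lintegral_biUnion_elt]
  intro t ht
  exact (hK.mem_outerCells.1 (Finset.mem_filter.1 ht).1).1

theorem IsMesh.diff_ae_eq (hK : IsMesh Λ Ω K) (hΩ : IsBoundedLipschitzDomain Ω) :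
    (Λ \ Ω : Set (Eucl d)) =ᵐ[volume] ⋃ t ∈ hK.outerCells, elt t := by
  refine ae_eq_set.2 ⟨measure_mono_null ?_ hΩ.volume_frontier, ?_⟩
  · rintro x ⟨⟨hx, hxΩ⟩, hxo⟩
    rw [hΩ.isOpen.frontier_eq]
    refine ⟨?_, hxΩ⟩
    by_contra hcl
    refine hxo ?_
    obtain ⟨t, ht, hxt⟩ := hK.exists_outerCell hx hcl
    simp only [mem_iUnion]
    exact ⟨t, ht, hxt⟩
  · have : (⋃ t ∈ hK.outerCells, elt t) \ (Λ \ Ω) = ∅ := by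
      refine sdiff_eq_bot_iff.2 ?_
      refine iUnion₂_subset fun t ht x hx => ⟨?_, hK.notMem_of_outerCell hΩ.isOpen ht hx⟩
      exact hK.elt_subset (hK.mem_outerCells.1 ht).1 hx
    rw [this, measure_empty]

theorem IsMesh.lintegral_diff (hK : IsMesh Λ Ω K) (hΩ : IsBoundedLipschitzDomain Ω)
    (f : Eucl d → ℝ≥0∞) :
    ∫⁻ x in Λ \ Ω, f x = ∑ t ∈ hK.outerCells, ∫⁻ x in elt t, f x := by
  rw [setLIntegral_congr (hK.diff_ae_eq hΩ), lintegral_biUnion_elt]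
  exact fun t ht => (hK.mem_outerCells.1 ht).1

/-- The exterior Clément interpolant is stable in `L²`. -/
theorem IsMesh.lintegral_clement_sub_sq_le (hK : IsMesh Λ Ω K) (hΩ : IsBoundedLipschitzDomain Ω)
    {f g : Eucl d → ℝ} {M N : ℝ} (hf : BddMeas f M) (hg : BddMeas g N) :
    ∫⁻ x in Λ \ Ω, ENNReal.ofReal
        ((nodal K (clementValue K Ω f) x - nodal K (clementValue K Ω g) x) ^ 2) ≤
      affConst d * (d + 1) * ∫⁻ x in Λ \ Ω, ENNReal.ofReal ((f x - g x) ^ 2) := by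
  classical
  set e : Eucl d → ℝ≥0∞ := fun p =>
    ENNReal.ofReal ((clementValue K Ω f p - clementValue K Ω g p) ^ 2) with he
  set F : Eucl d → ℝ≥0∞ := fun x => ENNReal.ofReal ((f x - g x) ^ 2)
  set O := hK.outerCells with hO
  set P := O.biUnion id with hP
  -- Exchanging sums over cells and over vertices turns cell bounds into patch bounds and back. A
  -- cell lies in the patches of its `d + 1` vertices only, so the overlap constant requires no
  -- shape regularity.
  have hcomm : ∀ G : Finset (Eucl d) → Eucl d → ℝ≥0∞,
      ∑ t ∈ O, ∑ p ∈ t, G t p = ∑ p ∈ P, ∑ t ∈ O.filter (p ∈ ·), G t p := by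
    intro G
    refine Finset.sum_comm' fun t p => ?_
    simp only [hP, Finset.mem_biUnion, Finset.mem_filter, id]
    constructor
    · rintro ⟨h1, h2⟩
      exact ⟨⟨h1, h2⟩, t, h1, h2⟩
    · rintro ⟨⟨h1, h2⟩, -⟩
      exact ⟨h1, h2⟩
  have hPv : ∀ p ∈ P, p ∈ K.vertices := by
    intro p hp
    simp only [hP, Finset.mem_biUnion, id] at hp
    obtain ⟨t, ht, hpt⟩ := hp
    exact mem_vertices_of_mem_cell (hK.mem_outerCells.1 ht).1 hpt
  calc _ ≤ ∑ t ∈ O, ∑ p ∈ t, volume (elt t) * e p := by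
        rw [hK.lintegral_diff hΩ]
        refine Finset.sum_le_sum fun t ht => ?_
        rw [← Finset.mul_sum, mul_comm, ← setLIntegral_const]
        refine setLIntegral_mono' (measurableSet_elt t) fun x hx => ?_
        have htc := (hK.mem_outerCells.1 ht).1
        rw [nodal_sub htc hx, he, ← ENNReal.ofReal_sum_of_nonneg fun _ _ => sq_nonneg _]
        exact ENNReal.ofReal_le_ofReal (nodal_sq_le htc hx _)
    _ = ∑ p ∈ P, volume (outerPatch K Ω p) * e p := by
        rw [hcomm]
        refine Finset.sum_congr rfl fun p hp => ?_
        rw [← Finset.sum_mul]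
        have := hK.lintegral_outerPatch (hPv p hp) fun _ => 1
        simp only [setLIntegral_one] at this
        rw [this]
    _ ≤ ∑ p ∈ P, affConst d * ∑ t ∈ O.filter (p ∈ ·), ∫⁻ x in elt t, F x := by
        refine Finset.sum_le_sum fun p hp => ?_
        rw [← hK.lintegral_outerPatch (hPv p hp)]
        exact hK.volume_mul_clementValue_sub_sq_le hΩ hf hg p
    _ = affConst d * ∑ t ∈ O, ∑ p ∈ t, ∫⁻ x in elt t, F x := by
        rw [hcomm, Finset.mul_sum]
    _ = _ := by
        rw [hK.lintegral_diff hΩ, mul_assoc, Finset.mul_sum _ _ ((d : ℝ≥0∞) + 1)]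
        congr 1
        refine Finset.sum_congr rfl fun t ht => ?_
        rw [Finset.sum_const, (hK.mem_outerCells.1 ht).1.2, nsmul_eq_mul]
        push_cast
        rfl

theorem exteriorClement_eq_of_outerCell (hK : IsMesh Λ Ω K) (hΩ : IsOpen Ω)
    {t : Finset (Eucl d)} (ht : t ∈ hK.outerCells) {x : Eucl d} (hx : x ∈ elt t)
    (g : Eucl d → ℝ) :
    exteriorClement K Ω g x = nodal K (clementValue K Ω g) x := by
  classical
  have htc := (hK.mem_outerCells.1 ht).1
  obtain ⟨q, hq⟩ := exists_affine_eq htc (clementValue K Ω g)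
  rw [exteriorClement_eq, nodal_eq htc hx hq, nodal_eq htc hx]
  intro p hp
  rw [if_neg (hK.notMem_of_outerCell hΩ ht (mem_elt_of_mem hp)), hq p hp, clementValue]

theorem IsMesh.abs_clement_sub_le (hK : IsMesh Λ Ω K) (hΩ : IsBoundedLipschitzDomain Ω)
    (hΛ : closure Ω ⊆ interior Λ) {f : Eucl d → ℝ} {M : ℝ} (hf : BddMeas f M) {ω : ℝ}
    (hω : 0 ≤ ω) (h : ∀ x y, dist x y ≤ meshSize K → |f x - f y| ≤ ω)
    {t : Finset (Eucl d)} (ht : t ∈ hK.outerCells) {x : Eucl d} (hx : x ∈ elt t) :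
    |nodal K (clementValue K Ω f) x - f x| ≤ ((affConst d).toReal + 1) * ω := by
  have htc := (hK.mem_outerCells.1 ht).1
  have h1 := nodal_sub htc hx (clementValue K Ω f) fun _ => f x
  rw [nodal_const htc hx] at h1
  rw [h1]
  refine nodal_abs_le htc hx fun p hp => ?_
  have h2 := hK.abs_clementValue_sub_le hΩ hΛ hf (mem_vertices_of_mem_cell htc hp)
    (hK.notMem_of_outerCell hΩ.isOpen ht (mem_elt_of_mem hp)) hω (a := f p) fun y hy => h y p hy
  have h3 := h p x ((Metric.dist_le_diam_of_mem (isCompact_elt t).isBounded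
    (mem_elt_of_mem hp) hx).trans (diam_le_meshSize hK htc))
  have h4 := abs_sub_le (clementValue K Ω f p) (f p) (f x)
  linarith

/-- Passes from `L²` to `L¹` smallness on sets of finite measure by Young's inequality. -/
theorem ofReal_abs_le_sq {η : ℝ} (hη : 0 < η) (a : ℝ) :
    ENNReal.ofReal |a| ≤ ENNReal.ofReal η⁻¹ * ENNReal.ofReal (a ^ 2) + ENNReal.ofReal η := by
  rw [← ENNReal.ofReal_mul (by positivity), ← ENNReal.ofReal_add (by positivity) hη.le]
  refine ENNReal.ofReal_le_ofReal ?_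
  rw [← sq_abs, inv_mul_eq_div, ← sub_le_iff_le_add, le_div_iff₀ hη]
  nlinarith [sq_nonneg (|a| - η), abs_nonneg a]

/-- Approximate `g` in `L²(Λ)` by a continuous compactly supported `ψ`. The interpolant of `ψ`
converges uniformly by uniform continuity, and the remainder `g - ψ` is absorbed by `L²` stability.
-/
theorem tendsto_clement (hΩ : IsBoundedLipschitzDomain Ω)
    (hΛ : closure Ω ⊆ interior Λ) (hΛm : MeasurableSet Λ) (hΛb : Bornology.IsBounded Λ)
    {g : Eucl d → ℝ} {M : ℝ} (hg : BddMeas g M) {ε : ℝ} (hε : 0 < ε) :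
    ∃ δ > 0, ∀ K : Cplx d, IsMesh Λ Ω K → meshSize K < δ →
      ∫⁻ x in Λ \ Ω, ENNReal.ofReal |exteriorClement K Ω g x - g x| ≤ ENNReal.ofReal ε := by
  set C := (affConst d).toReal with hC
  set V := (volume Λ).toReal with hV
  -- Chosen so that the contributions below add up to `η (B - 1)`, which is less than `η B = ε`.
  set B := C * (d + 1) + 1 + (2 + (C + 1)) * V + 1 with hB
  have hBpos : 0 < B := by positivity
  set η := ε / B with hη
  have hη0 : 0 < η := by positivity
  have hΛtop : volume Λ ≠ ∞ := hΛb.measure_lt_top.ne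
  obtain ⟨ψ, hψs, hψ2, hψc, -⟩ := MemLp.exists_hasCompactSupport_integral_rpow_sub_le
    (μ := (volume : Measure (Eucl d))) (p := 2) two_pos (f := Λ.indicator g) (by
      rw [ENNReal.ofReal_ofNat, memLp_indicator_iff_restrict hΛm]
      exact hg.memLp hΛm hΛb) (ε := η ^ 2) (by positivity)
  obtain ⟨N, hN⟩ := hψs.exists_bound_of_continuous hψc
  have hψb : BddMeas ψ N := ⟨hψc.measurable, hN⟩
  have hgψ : ∫⁻ x in Λ \ Ω, ENNReal.ofReal ((g x - ψ x) ^ 2) ≤ ENNReal.ofReal (η ^ 2) := by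
    refine (lintegral_mono_set sdiff_subset).trans ?_
    have hint : IntegrableOn (fun x => (g x - ψ x) ^ 2) Λ :=
      ((hg.sub hψb).memLp hΛm hΛb).integrable_sq
    rw [← ofReal_integral_eq_lintegral_ofReal hint (ae_of_all _ fun x => sq_nonneg _)]
    refine ENNReal.ofReal_le_ofReal (le_trans ?_ hψ2)
    have hmem : MemLp (Λ.indicator g) 2 (volume : Measure (Eucl d)) := by
      rw [memLp_indicator_iff_restrict hΛm]; exact hg.memLp hΛm hΛb
    have hint2 : Integrable (fun x => ‖Λ.indicator g x - ψ x‖ ^ (2 : ℝ)) := by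
      have := (hmem.sub (hψc.memLp_of_hasCompactSupport hψs)).integrable_sq
      refine this.congr (ae_of_all _ fun x => ?_)
      simp [Real.norm_eq_abs, sq_abs]
    rw [← integral_indicator hΛm]
    refine integral_mono (hint.integrable_indicator hΛm) hint2 fun x => ?_
    by_cases hx : x ∈ Λ
    · simp [hx, sq_abs]
    · rw [indicator_of_notMem hx]
      positivity
  obtain ⟨δ, hδ, hδψ⟩ := Metric.uniformContinuous_iff.1
    (hψs.uniformContinuous_of_continuous hψc) η hη0
  refine ⟨δ, hδ, fun K hK hKδ => ?_⟩
  have hosc : ∀ x y, dist x y ≤ meshSize K → |ψ x - ψ y| ≤ η := fun x y hxy => by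
    have := hδψ (hxy.trans_lt hKδ)
    rw [Real.dist_eq] at this
    exact this.le
  have hstab := hK.lintegral_clement_sub_sq_le hΩ hg hψb
  set Ng := nodal K (clementValue K Ω g)
  set Nψ := nodal K (clementValue K Ω ψ)
  have hNg : Measurable Ng := hK.measurable_of_mem (hK.nodal_mem _)
  have hNψ : Measurable Nψ := hK.measurable_of_mem (hK.nodal_mem _)
  have hψm := hψb.1
  have hgm := hg.1
  have hpt : ∀ᵐ x, x ∈ Λ \ Ω → ENNReal.ofReal |exteriorClement K Ω g x - g x| ≤
      (ENNReal.ofReal η⁻¹ * ENNReal.ofReal ((Ng x - Nψ x) ^ 2) +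
        ENNReal.ofReal η⁻¹ * ENNReal.ofReal ((g x - ψ x) ^ 2)) +
        ENNReal.ofReal ((2 + (C + 1)) * η) := by
    filter_upwards [(hK.diff_ae_eq hΩ).mem_iff] with x hx hxd
    have := hx.1 hxd
    simp only [mem_iUnion] at this
    obtain ⟨t, ht, hxt⟩ := this
    rw [exteriorClement_eq_of_outerCell hK hΩ.isOpen ht hxt]
    have h1 := hK.abs_clement_sub_le hΩ hΛ hψb hη0.le hosc ht hxt
    have h2 := ofReal_abs_le_sq hη0 (Ng x - Nψ x)
    have h3 := ofReal_abs_le_sq hη0 (g x - ψ x)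
    have h4 : |Ng x - g x| ≤ (|Ng x - Nψ x| + |g x - ψ x|) + (C + 1) * η := by
      have e1 := abs_sub_le (Ng x) (Nψ x) (g x)
      have e2 := abs_sub_le (Nψ x) (ψ x) (g x)
      rw [abs_sub_comm (ψ x)] at e2
      linarith
    refine (ENNReal.ofReal_le_ofReal h4).trans ?_
    rw [ENNReal.ofReal_add (by positivity) (by positivity),
      ENNReal.ofReal_add (by positivity) (by positivity),
      show (2 + (C + 1)) * η = η + η + (C + 1) * η by ring,
      ENNReal.ofReal_add (by positivity) (by positivity), ENNReal.ofReal_add hη0.le hη0.le]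
    refine (add_le_add_left (add_le_add h2 h3) _).trans (le_of_eq ?_)
    ring
  have hae : MeasurableSet (Λ \ Ω) := hΛm.diff hΩ.measurableSet
  refine (setLIntegral_mono_ae' hae hpt).trans ?_
  rw [lintegral_add_right _ measurable_const, lintegral_add_left (by fun_prop),
    lintegral_const_mul _ (by fun_prop), lintegral_const_mul _ (by fun_prop), setLIntegral_const]
  have hvol : volume (Λ \ Ω) ≤ ENNReal.ofReal V := by
    rw [hV, ENNReal.ofReal_toReal hΛtop]
    exact measure_mono sdiff_subset
  have hA : affConst d * (d + 1) = ENNReal.ofReal (C * (d + 1)) := by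
    rw [hC, ENNReal.ofReal_mul ENNReal.toReal_nonneg, ENNReal.ofReal_toReal affConst_ne_top,
      ENNReal.ofReal_add (by positivity) zero_le_one, ENNReal.ofReal_natCast, ENNReal.ofReal_one]
  rw [hA] at hstab
  calc _ ≤ ENNReal.ofReal η⁻¹ * (ENNReal.ofReal (C * (d + 1)) * ENNReal.ofReal (η ^ 2)) +
        ENNReal.ofReal η⁻¹ * ENNReal.ofReal (η ^ 2) +
        ENNReal.ofReal ((2 + (C + 1)) * η) * ENNReal.ofReal V := by
        have := hstab.trans (mul_le_mul_right hgψ (ENNReal.ofReal (C * (d + 1))))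
        gcongr
    _ = ENNReal.ofReal (η⁻¹ * (C * (d + 1) * η ^ 2) + η⁻¹ * η ^ 2 + (2 + (C + 1)) * η * V) := by
        rw [ENNReal.ofReal_add (by positivity) (by positivity),
          ENNReal.ofReal_add (by positivity) (by positivity),
          ← ENNReal.ofReal_mul (by positivity), ← ENNReal.ofReal_mul (by positivity),
          ← ENNReal.ofReal_mul (by positivity), ← ENNReal.ofReal_mul (by positivity)]
    _ ≤ _ := by
        refine ENNReal.ofReal_le_ofReal ?_
        have e1 : η⁻¹ * (C * (d + 1) * η ^ 2) + η⁻¹ * η ^ 2 + (2 + (C + 1)) * η * V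
            = η * (B - 1) := by
          rw [hB]; field_simp; ring
        have e2 : η * B = ε := by rw [hη]; field_simp
        rw [e1]
        nlinarith

end

section

/-! ### Density of bounded Lipschitz functions -/

variable {d : ℕ}

/-- Translations act continuously on `L¹`. The map `j` covers both ordinary translations of `ℝ^d`
and diagonal translations of `ℝ^d × ℝ^d`. -/
theorem tendsto_lintegral_translate_sub {X : Type*} [NormedAddCommGroup X] [MeasurableSpace X]
    [BorelSpace X] {μ : Measure X} [μ.IsAddRightInvariant] [IsLocallyFiniteMeasure μ]
    [μ.InnerRegularCompactLTTop] {E : Type*} [NormedAddCommGroup E] {j : E → X}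
    (hj : Continuous j) (hj0 : j 0 = 0) {f : X → ℝ} (hf : Integrable f μ) :
    Tendsto (fun w => ∫⁻ z, ‖f (z - j w) - f z‖ₑ ∂μ) (𝓝 0) (𝓝 0) := by
  let G : C(E, C(X, X)) := (ContinuousMap.mk (fun p : E × X => p.2 - j p.1)
    (continuous_snd.sub (hj.comp continuous_fst))).curry
  have hG : ∀ w, MeasurePreserving (G w) μ μ := fun w => measurePreserving_sub_right μ (j w)
  have hf1 : MemLp f 1 μ := memLp_one_iff_integrable.2 hf
  have hcont : Continuous fun w => Lp.compMeasurePreserving (G w) (hG w) (hf1.toLp f) :=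
    continuous_const.compMeasurePreservingLp G.continuous hG ENNReal.one_ne_top
  have h0 : Lp.compMeasurePreserving (G 0) (hG 0) (hf1.toLp f) = hf1.toLp f := by
    rw [Lp.toLp_compMeasurePreserving]
    congr 1
    funext z
    simp [G, hj0]
  have h1 := hcont.tendsto 0
  rw [h0, tendsto_iff_edist_tendsto_0] at h1
  refine h1.congr fun w => ?_
  rw [Lp.toLp_compMeasurePreserving, Lp.edist_toLp_toLp, eLpNorm_one_eq_lintegral_enorm]
  rfl

theorem gint_eq_enorm (σ : ℝ) (v : Eucl d → ℝ) (z : Eucl d × Eucl d) :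
    gint σ v z = ‖(v z.1 - v z.2) * ‖z.1 - z.2‖ ^ (-((d : ℝ) + σ))‖ₑ := by
  rw [gint, ker, Real.enorm_eq_ofReal_abs, abs_mul, ENNReal.ofReal_mul (abs_nonneg _),
    abs_of_nonneg (Real.rpow_nonneg (norm_nonneg _) _)]

/-- The seminorm is the `L¹` norm of a weighted difference on `ℝ^d × ℝ^d`. As the kernel depends on
`x - y` only, translating `v` translates that function diagonally. -/
theorem tendsto_gagliardo_translate_sub {σ : ℝ} {v : Eucl d → ℝ} (hv : Measurable v)
    (hfin : gagliardo σ univ v ≠ ∞) :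
    Tendsto (fun w => gagliardo σ univ fun x => v (x - w) - v x) (𝓝 0) (𝓝 0) := by
  let V : Eucl d × Eucl d → ℝ := fun z => (v z.1 - v z.2) * ‖z.1 - z.2‖ ^ (-((d : ℝ) + σ))
  have hV : Integrable V := by
    refine ⟨(show Measurable V by fun_prop).aestronglyMeasurable, ?_⟩
    rw [hasFiniteIntegral_iff_enorm]
    rw [gagliardo_eq, Measure.restrict_univ] at hfin
    simp only [gint_eq_enorm] at hfin
    exact hfin.lt_top
  have : (volume : Measure (Eucl d × Eucl d)).IsAddHaarMeasure :=
    inferInstanceAs ((volume : Measure (Eucl d)).prod (volume : Measure (Eucl d))).IsAddHaarMeasure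
  have h := tendsto_lintegral_translate_sub (E := Eucl d) (j := fun w => (w, w))
    (by fun_prop) rfl hV
  refine h.congr fun w => ?_
  rw [gagliardo_eq, Measure.restrict_univ]
  refine lintegral_congr fun z => ?_
  rw [gint_eq_enorm]
  congr 1
  simp only [V, Prod.fst_sub, Prod.snd_sub, sub_sub_sub_cancel_right]
  ring

/-- Cut the weight at height `n`: the excess has small integral and meets only the bound `N`, while
the bounded part meets the small `L¹` norm. The resulting `δ` is uniform in `f`. -/
theorem exists_lintegral_mul_le {A : Set (Eucl d)} (hA : MeasurableSet A) {W : Eucl d → ℝ≥0∞}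
    (hW : Measurable W) (hfin : ∫⁻ x in A, W x ≠ ∞) (N : ℝ) {ε : ℝ≥0∞} (hε : 0 < ε) :
    ∃ δ : ℝ≥0∞, 0 < δ ∧ ∀ f : Eucl d → ℝ, Measurable f → (∀ x ∈ A, |f x| ≤ N) →
      ∫⁻ x in A, ENNReal.ofReal |f x| ≤ δ → ∫⁻ x in A, ENNReal.ofReal |f x| * W x ≤ ε := by
  have hlim : Tendsto (fun n : ℕ => ∫⁻ x in A, W x - min (W x) n) atTop
      (𝓝 (∫⁻ _ in A, 0)) := by
    refine tendsto_lintegral_of_dominated_convergence W (fun n => by fun_prop)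
      (fun n => ae_of_all _ fun x => tsub_le_self) hfin ?_
    filter_upwards [ae_lt_top hW hfin] with x hx
    obtain ⟨n, hn⟩ := ENNReal.exists_nat_gt hx.ne
    refine tendsto_const_nhds.congr' ?_
    filter_upwards [eventually_ge_atTop n] with m hm
    have : W x ≤ m := hn.le.trans (by exact_mod_cast hm)
    rw [min_eq_left this, tsub_self]
  rw [lintegral_zero] at hlim
  have hlim2 := ENNReal.Tendsto.const_mul hlim (Or.inr (ENNReal.ofReal_ne_top (r := N)))
  rw [mul_zero] at hlim2
  have hε2 : 0 < ε / 2 := ENNReal.half_pos hε.ne'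
  obtain ⟨n, hn⟩ := (hlim2.eventually (ge_mem_nhds hε2)).exists
  refine ⟨ε / 2 / (n + 1), ENNReal.div_pos hε2.ne' (by simp), fun f hf hfN hfδ => ?_⟩
  calc ∫⁻ x in A, ENNReal.ofReal |f x| * W x
      ≤ ∫⁻ x in A, ENNReal.ofReal N * (W x - min (W x) n) + n * ENNReal.ofReal |f x| := by
        refine setLIntegral_mono' hA fun x hx => ?_
        have h1 : W x ≤ (W x - min (W x) n) + min (W x) n := le_tsub_add
        calc ENNReal.ofReal |f x| * W x
            ≤ ENNReal.ofReal |f x| * ((W x - min (W x) n) + min (W x) n) := by gcongr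
          _ = ENNReal.ofReal |f x| * (W x - min (W x) n) +
              min (W x) n * ENNReal.ofReal |f x| := by ring
          _ ≤ _ := by
              gcongr
              · exact hfN x hx
              · exact min_le_right _ _
    _ = ENNReal.ofReal N * (∫⁻ x in A, W x - min (W x) n) +
          n * ∫⁻ x in A, ENNReal.ofReal |f x| := by
        rw [lintegral_add_left (by fun_prop), lintegral_const_mul _ (by fun_prop),
          lintegral_const_mul _ (by fun_prop)]
    _ ≤ ε / 2 + ε / 2 := by
        refine add_le_add hn ?_
        refine (mul_le_mul_right hfδ _).trans ?_
        refine (mul_le_mul_left (le_self_add : (n : ℝ≥0∞) ≤ n + 1) _).trans ?_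
        exact ENNReal.mul_div_le
    _ = ε := ENNReal.add_halves ε

/-- Mollification by a normalized bump function. -/
def mollify (φ : ContDiffBump (0 : Eucl d)) (v : Eucl d → ℝ) (x : Eucl d) : ℝ :=
  ∫ w, φ.normed volume w * v (x - w)

theorem BddMeas.integrable_bump {v : Eucl d → ℝ} {N : ℝ} (hv : BddMeas v N)
    (φ : ContDiffBump (0 : Eucl d)) (x : Eucl d) :
    Integrable fun w => φ.normed volume w * v (x - w) := by
  have h1 := (φ.integrable_normed (μ := volume)).mul_bdd (c := N) (g := fun w => v (x - w))
    (hv.1.comp (by fun_prop : Measurable fun w => x - w)).aestronglyMeasurable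
    (ae_of_all _ fun w => hv.2 _)
  exact h1

theorem mollify_sub_eq {v : Eucl d → ℝ} {N : ℝ} (hv : BddMeas v N)
    (φ : ContDiffBump (0 : Eucl d)) (x : Eucl d) :
    mollify φ v x - v x = ∫ w, φ.normed volume w * (v (x - w) - v x) := by
  have h2 : ∫ w, φ.normed volume w * v x = v x := by
    rw [integral_mul_const, φ.integral_normed, one_mul]
  have h3 : mollify φ v x - v x = mollify φ v x - ∫ w, φ.normed volume w * v x := by rw [h2]
  rw [h3, mollify, ← integral_sub (hv.integrable_bump φ x) (φ.integrable_normed.mul_const _)]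
  simp only [mul_sub]

theorem abs_mollify_le {v : Eucl d → ℝ} {N : ℝ} (hv : BddMeas v N)
    (φ : ContDiffBump (0 : Eucl d)) (x : Eucl d) : |mollify φ v x| ≤ N := by
  have h := norm_integral_le_of_norm_le (φ.integrable_normed.mul_const N)
    (f := fun w => φ.normed volume w * v (x - w)) (μ := volume) (ae_of_all _ fun w => by
      rw [norm_mul, Real.norm_of_nonneg (φ.nonneg_normed w)]
      exact mul_le_mul_of_nonneg_left (hv.2 _) (φ.nonneg_normed w))
  rwa [integral_mul_const, φ.integral_normed, one_mul] at h

theorem exists_lipschitzWith_mollify {v : Eucl d → ℝ} {N : ℝ} (hv : BddMeas v N)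
    {A : Set (Eucl d)} (hA : MeasurableSet A) (hAtop : volume A ≠ ∞) (hvA : ∀ x ∉ A, v x = 0)
    (φ : ContDiffBump (0 : Eucl d)) : ∃ L, LipschitzWith L (mollify φ v) := by
  obtain ⟨C, hC⟩ := ContDiff.lipschitzWith_of_hasCompactSupport
    (φ.hasCompactSupport_normed (μ := volume))
    (φ.contDiff_normed (n := 1)) (by simp)
  have hN : 0 ≤ N := (abs_nonneg _).trans (hv.2 0)
  have e : ∀ x, mollify φ v x = ∫ w, φ.normed volume (x - w) * v w := by
    intro x
    rw [mollify, ← integral_sub_left_eq_self (fun w => φ.normed volume w * v (x - w)) volume x]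
    simp
  have hint : ∀ x, Integrable fun w => φ.normed volume (x - w) * v w := by
    intro x
    have := (hv.integrable_bump φ x).comp_sub_left x
    simpa using this
  refine ⟨Real.toNNReal (C * N * (volume A).toReal), LipschitzWith.of_dist_le' fun x y => ?_⟩
  rw [Real.dist_eq, e, e, ← integral_sub (hint x) (hint y), ← Real.norm_eq_abs]
  have hb : Integrable (A.indicator fun _ => (C * dist x y * N : ℝ)) :=
    (integrableOn_const hAtop).integrable_indicator hA
  refine (norm_integral_le_of_norm_le hb (ae_of_all _ fun w => ?_)).trans (le_of_eq ?_)
  · by_cases hw : w ∈ A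
    · rw [indicator_of_mem hw, ← sub_mul, norm_mul]
      have h1 := hC.dist_le_mul (x - w) (y - w)
      rw [dist_sub_right, Real.dist_eq] at h1
      exact mul_le_mul h1 (hv.2 w) (norm_nonneg _) (by positivity)
    · simp [hvA w hw, hw]
  · rw [integral_indicator hA, setIntegral_const, smul_eq_mul, Measure.real]
    ring

theorem ofReal_mollify_sub_le {v : Eucl d → ℝ} {N : ℝ} (hv : BddMeas v N)
    (φ : ContDiffBump (0 : Eucl d)) (x : Eucl d) :
    ENNReal.ofReal |mollify φ v x - v x| ≤
      ∫⁻ w, ‖φ.normed volume w‖ₑ * ENNReal.ofReal |v (x - w) - v x| := by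
  rw [mollify_sub_eq hv, ← Real.enorm_eq_ofReal_abs]
  refine (enorm_integral_le_lintegral_enorm _).trans (le_of_eq ?_)
  refine lintegral_congr fun w => ?_
  rw [enorm_mul, Real.enorm_eq_ofReal_abs (v (x - w) - v x)]

theorem gint_mollify_sub_le {v : Eucl d → ℝ} {N : ℝ} (hv : BddMeas v N)
    (φ : ContDiffBump (0 : Eucl d)) (σ : ℝ) (z : Eucl d × Eucl d) :
    gint σ (fun x => mollify φ v x - v x) z ≤
      ∫⁻ w, ‖φ.normed volume w‖ₑ * gint σ (fun x => v (x - w) - v x) z := by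
  have hvm := hv.1
  have hi : ∀ x, Integrable fun w => φ.normed volume w * (v (x - w) - v x) := fun x => by
    simp only [mul_sub]
    exact (hv.integrable_bump φ x).sub (φ.integrable_normed.mul_const _)
  have hm : Measurable fun w => ‖φ.normed volume w‖ₑ *
      ENNReal.ofReal |v (z.1 - w) - v z.1 - (v (z.2 - w) - v z.2)| := by
    have : Measurable (φ.normed (volume : Measure (Eucl d))) := φ.continuous_normed.measurable
    fun_prop
  simp only [gint, ← mul_assoc]
  rw [lintegral_mul_const _ hm]
  gcongr
  rw [mollify_sub_eq hv, mollify_sub_eq hv, ← integral_sub (hi _) (hi _),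
    ← Real.enorm_eq_ofReal_abs]
  refine (enorm_integral_le_lintegral_enorm _).trans (le_of_eq ?_)
  refine lintegral_congr fun w => ?_
  rw [← mul_sub, enorm_mul, Real.enorm_eq_ofReal_abs (_ - _)]

theorem lintegral_enorm_normed (φ : ContDiffBump (0 : Eucl d)) :
    ∫⁻ w, ‖φ.normed volume w‖ₑ = 1 := by
  rw [← ofReal_integral_norm_eq_lintegral_enorm φ.integrable_normed]
  simp only [Real.norm_of_nonneg (φ.nonneg_normed _)]
  rw [φ.integral_normed, ENNReal.ofReal_one]

theorem lintegral_bump_le (φ : ContDiffBump (0 : Eucl d)) {F : Eucl d → ℝ≥0∞} {ε : ℝ≥0∞}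
    (hF : ∀ w ∈ Metric.ball 0 φ.rOut, F w ≤ ε) : ∫⁻ w, ‖φ.normed volume w‖ₑ * F w ≤ ε := by
  calc _ ≤ ∫⁻ w, ‖φ.normed volume w‖ₑ * ε := by
        refine lintegral_mono fun w => ?_
        by_cases hw : w ∈ Metric.ball 0 φ.rOut
        · exact mul_le_mul_right (hF w hw) _
        · rw [← φ.support_normed_eq (μ := volume), Function.mem_support, not_not] at hw
          simp [hw]
    _ = ε := by
        rw [lintegral_mul_const _ φ.continuous_normed.measurable.enorm, lintegral_enorm_normed,
          one_mul]

/-- The mollification error is an average of translation errors over the support of the bump, so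
Minkowski's inequality transfers the bound. -/
theorem gagliardo_mollify_sub_le {v : Eucl d → ℝ} {N : ℝ} (hv : BddMeas v N)
    (φ : ContDiffBump (0 : Eucl d)) {σ : ℝ} {ε : ℝ≥0∞}
    (h : ∀ w ∈ Metric.ball 0 φ.rOut, gagliardo σ univ (fun x => v (x - w) - v x) ≤ ε) :
    gagliardo σ univ (fun x => mollify φ v x - v x) ≤ ε := by
  have hvm := hv.1
  have hφ : Measurable (φ.normed (volume : Measure (Eucl d))) := φ.continuous_normed.measurable
  rw [gagliardo_eq, Measure.restrict_univ]
  refine (lintegral_mono fun z => gint_mollify_sub_le hv φ σ z).trans ?_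
  rw [lintegral_lintegral_swap]
  · refine le_trans (le_of_eq ?_) (lintegral_bump_le φ h)
    refine lintegral_congr fun w => ?_
    have : Measurable fun x => v (x - w) - v x := by fun_prop
    rw [lintegral_const_mul _ (measurable_gint σ this), gagliardo_eq, Measure.restrict_univ]
  · apply Measurable.aemeasurable
    unfold gint
    fun_prop

theorem lintegral_mollify_sub_le {v : Eucl d → ℝ} {N : ℝ} (hv : BddMeas v N)
    (φ : ContDiffBump (0 : Eucl d)) {ε : ℝ≥0∞}
    (h : ∀ w ∈ Metric.ball 0 φ.rOut, ∫⁻ x, ENNReal.ofReal |v (x - w) - v x| ≤ ε) :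
    ∫⁻ x, ENNReal.ofReal |mollify φ v x - v x| ≤ ε := by
  have hvm := hv.1
  have hφ : Measurable (φ.normed (volume : Measure (Eucl d))) := φ.continuous_normed.measurable
  refine (lintegral_mono fun z => ofReal_mollify_sub_le hv φ z).trans ?_
  rw [lintegral_lintegral_swap]
  · refine le_trans (le_of_eq ?_) (lintegral_bump_le φ h)
    refine lintegral_congr fun w => ?_
    rw [lintegral_const_mul _ (by fun_prop)]
  · apply Measurable.aemeasurable
    fun_prop

end

/-! ### Truncation, and approximation by bounded Lipschitz functions -/

section

variable {d : ℕ}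

/-- Truncation at height `N`. -/
def clamp (N a : ℝ) : ℝ := max (-N) (min a N)

theorem clamp_sub_le (N a b : ℝ) : |clamp N a - clamp N b| ≤ |a - b| := by
  unfold clamp
  refine (abs_max_sub_max_le_max _ _ _ _).trans ?_
  rw [sub_self, abs_zero, max_eq_right (abs_nonneg _)]
  refine (abs_min_sub_min_le_max _ _ _ _).trans ?_
  rw [sub_self, abs_zero, max_eq_left (abs_nonneg _)]

/-- The part removed by truncation is again a 1-Lipschitz function of the value, which supplies the
majorant for dominated convergence in the seminorm. -/
theorem sub_clamp_sub_le (N a b : ℝ) : |(clamp N a - a) - (clamp N b - b)| ≤ |a - b| := by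
  unfold clamp
  rcases max_cases (-N) (min a N) with ⟨h1, h1'⟩ | ⟨h1, h1'⟩ <;>
  rcases max_cases (-N) (min b N) with ⟨h2, h2'⟩ | ⟨h2, h2'⟩ <;>
  rcases min_cases a N with ⟨h3, h3'⟩ | ⟨h3, h3'⟩ <;>
  rcases min_cases b N with ⟨h4, h4'⟩ | ⟨h4, h4'⟩ <;>
  rw [h1, h2] <;> rcases abs_cases (a - b) with ⟨h5, h5'⟩ | ⟨h5, h5'⟩ <;>
  rw [abs_le] <;> constructor <;> linarith

theorem clamp_zero {N : ℝ} (hN : 0 ≤ N) : clamp N 0 = 0 := by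
  simp [clamp, hN]

theorem abs_clamp_le {N : ℝ} (hN : 0 ≤ N) (a : ℝ) : |clamp N a| ≤ N :=
  abs_le.2 ⟨le_max_left _ _, max_le (by linarith) (min_le_right _ _)⟩

theorem clamp_of_le {N a : ℝ} (h : |a| ≤ N) : clamp N a = a := by
  rw [clamp, min_eq_left (abs_le.1 h).2, max_eq_right (abs_le.1 h).1]

theorem continuous_clamp (N : ℝ) : Continuous (clamp N) := by
  unfold clamp
  fun_prop

theorem tendsto_gagliardo_clamp {σ : ℝ} {A : Set (Eucl d × Eucl d)} {u : Eucl d → ℝ}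
    (hu : Measurable u) (hfin : gagliardo σ A u ≠ ∞) :
    Tendsto (fun n : ℕ => gagliardo σ A fun x => clamp n (u x) - u x) atTop (𝓝 0) := by
  simp only [gagliardo_eq] at hfin ⊢
  rw [show (0 : ℝ≥0∞) = ∫⁻ _ in A, 0 by simp]
  have hc := fun n : ℕ => (continuous_clamp n).measurable.comp hu
  refine tendsto_lintegral_of_dominated_convergence (gint σ u)
    (fun n => measurable_gint σ ((hc n).sub hu)) (fun n => ae_of_all _ fun z => ?_) hfin
    (ae_of_all _ fun z => ?_)
  · unfold gint
    gcongr ENNReal.ofReal ?_ * _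
    exact sub_clamp_sub_le _ _ _
  · refine tendsto_const_nhds.congr' ?_
    filter_upwards [eventually_ge_atTop (Nat.ceil (max |u z.1| |u z.2|))] with n hn
    have h := Nat.ceil_le.1 hn
    rw [gint, clamp_of_le ((le_max_left _ _).trans h), clamp_of_le ((le_max_right _ _).trans h)]
    simp

theorem tendsto_lintegral_clamp {A : Set (Eucl d)} {u : Eucl d → ℝ} (hu : Measurable u)
    {W : Eucl d → ℝ≥0∞} (hW : Measurable W)
    (hfin : ∫⁻ x in A, ENNReal.ofReal |u x| * W x ≠ ∞) :
    Tendsto (fun n : ℕ => ∫⁻ x in A, ENNReal.ofReal |clamp n (u x) - u x| * W x) atTop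
      (𝓝 0) := by
  rw [show (0 : ℝ≥0∞) = ∫⁻ _ in A, 0 by simp]
  have hc := fun n : ℕ => (continuous_clamp n).measurable.comp hu
  refine tendsto_lintegral_of_dominated_convergence (fun x => ENNReal.ofReal |u x| * W x)
    (fun n => ?_) (fun n => ae_of_all _ fun x => ?_) hfin (ae_of_all _ fun x => ?_)
  · have := hc n
    simp only [Function.comp_def] at this
    fun_prop
  · refine mul_le_mul_left (ENNReal.ofReal_le_ofReal ?_) _
    have := sub_clamp_sub_le n (u x) 0
    rwa [clamp_zero n.cast_nonneg, sub_zero, sub_zero, sub_zero] at this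
  · refine tendsto_const_nhds.congr' ?_
    filter_upwards [eventually_ge_atTop (Nat.ceil |u x|)] with n hn
    rw [clamp_of_le (Nat.ceil_le.1 hn)]
    simp

theorem gagliardo_eqOn {σ : ℝ} {A B : Set (Eucl d)} (hA : MeasurableSet A) (hB : MeasurableSet B)
    {v w : Eucl d → ℝ} (h : EqOn v w A) (h' : EqOn v w B) :
    gagliardo σ (A ×ˢ B) v = gagliardo σ (A ×ˢ B) w := by
  refine setLIntegral_congr_fun (hA.prod hB) fun z hz => ?_
  simp only [h hz.1, h' hz.2]

/-- Pairs outside `Q Ω` contribute nothing, and on the two cross blocks only the point in `Ω`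
carries a value. -/
theorem gagliardo_univ_le {Ω : Set (Eucl d)} (hΩ : MeasurableSet Ω) (σ : ℝ) {v : Eucl d → ℝ}
    (hv : Measurable v) (h0 : ∀ x ∉ Ω, v x = 0) :
    gagliardo σ univ v ≤ gagliardo σ (Ω ×ˢ Ω) v +
      2 * ∫⁻ x in Ω, ENNReal.ofReal |v x| * wt σ Ωᶜ x := by
  have h1 : gagliardo σ univ v = gagliardo σ (Q Ω) v := by
    rw [gagliardo_eq, gagliardo_eq, Measure.restrict_univ,
      ← lintegral_add_compl _ (measurableSet_Q hΩ), setLIntegral_congr_fun (g := fun _ => 0)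
        (measurableSet_Q hΩ).compl, lintegral_zero, add_zero]
    intro z hz
    rw [Q, compl_compl] at hz
    simp [gint, h0 _ hz.1, h0 _ hz.2]
  rw [h1]
  refine (gagliardo_Q_le σ Ω hv).trans ?_
  gcongr
  refine (gagliardo_prod_le σ Ω Ωᶜ hv).trans (le_of_eq ?_)
  rw [setLIntegral_congr_fun (g := fun _ => 0) hΩ.compl, lintegral_zero, add_zero]
  intro x hx
  simp [h0 _ hx]

/-- Truncate, extend by zero, mollify. The weighted `L¹` hypothesis makes the zero extension of
finite global seminorm, so no extension operator is needed. The weighted error is small because the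
truncated functions are bounded and the fractional perimeter is finite. -/
theorem exists_lipschitz_approx {Ω : Set (Eucl d)} (hd : 1 ≤ d)
    (hΩ : IsBoundedLipschitzDomain Ω) {σ : ℝ} (h0 : 0 < σ) (h1 : σ < 1) {u : Eucl d → ℝ}
    (hu : Measurable u) (hfin : gagliardo σ (Ω ×ˢ Ω) u ≠ ∞)
    (hW : ∫⁻ x in Ω, ENNReal.ofReal |u x| * wt σ Ωᶜ x ≠ ∞) {ε : ℝ≥0∞} (hε : 0 < ε) :
    ∃ ψ : Eucl d → ℝ, ∃ (N : ℝ) (L : NNReal), LipschitzWith L ψ ∧ (∀ x, |ψ x| ≤ N) ∧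
      gagliardo σ (Ω ×ˢ Ω) (fun x => ψ x - u x) ≤ ε ∧
      ∫⁻ x in Ω, ENNReal.ofReal |ψ x - u x| * wt σ Ωᶜ x ≤ ε := by
  have hε2 : 0 < ε / 2 := ENNReal.half_pos hε.ne'
  have hwt := measurable_wt σ Ωᶜ
  obtain ⟨n, hn1, hn2⟩ := (((tendsto_gagliardo_clamp hu hfin).eventually (ge_mem_nhds hε2)).and
    ((tendsto_lintegral_clamp hu hwt hW).eventually (ge_mem_nhds hε2))).exists
  have hΩm := hΩ.measurableSet
  have hn0 : (0 : ℝ) ≤ n := n.cast_nonneg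
  set v : Eucl d → ℝ := Ω.indicator fun x => clamp n (u x) with hvdef
  have hcm : Measurable fun x => clamp n (u x) := (continuous_clamp n).measurable.comp hu
  have hvm : Measurable v := hcm.indicator hΩm
  have hvΩ : ∀ x ∈ Ω, v x = clamp n (u x) := fun x hx => indicator_of_mem hx _
  have hvn : ∀ x ∉ Ω, v x = 0 := fun x hx => indicator_of_notMem hx _
  have hvb : BddMeas v n := ⟨hvm, fun x => by
    by_cases hx : x ∈ Ω
    · rw [hvΩ x hx]; exact abs_clamp_le hn0 _
    · rw [hvn x hx, abs_zero]; exact hn0⟩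
  have hvint : Integrable v := by
    refine (Measure.integrableOn_of_bounded (M := n) hΩ.volume_ne_top hcm.aestronglyMeasurable
      (ae_of_all _ fun x => abs_clamp_le hn0 _)).integrable_indicator hΩm
  have hvfin : gagliardo σ univ v ≠ ∞ := by
    refine ne_top_of_le_ne_top ?_ (gagliardo_univ_le hΩm σ hvm hvn)
    refine ENNReal.add_ne_top.2 ⟨ne_top_of_le_ne_top hfin ?_, ENNReal.mul_ne_top (by simp)
      (ne_top_of_le_ne_top hW ?_)⟩
    · rw [gagliardo_eqOn hΩm hΩm hvΩ hvΩ, gagliardo_eq, gagliardo_eq]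
      refine lintegral_mono fun z => ?_
      unfold gint
      gcongr ENNReal.ofReal ?_ * _
      exact clamp_sub_le _ _ _
    · refine setLIntegral_mono' hΩm fun x hx => ?_
      rw [hvΩ x hx]
      gcongr ENNReal.ofReal ?_ * _
      have := clamp_sub_le n (u x) 0
      rwa [clamp_zero hn0, sub_zero, sub_zero] at this
  obtain ⟨δ, hδ, hδ'⟩ := exists_lintegral_mul_le hΩm hwt
    (lintegral_wt_compl_ne_top hd hΩ h0 h1) (n + n) hε2
  have ht1 := (tendsto_gagliardo_translate_sub hvm hvfin).eventually (ge_mem_nhds hε2)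
  have ht2 := (tendsto_lintegral_translate_sub (E := Eucl d) (j := fun w => w) continuous_id rfl
    hvint).eventually (ge_mem_nhds hδ)
  obtain ⟨R, hR, hball⟩ := Metric.eventually_nhds_iff_ball.1 (ht1.and ht2)
  let φ : ContDiffBump (0 : Eucl d) := ⟨R / 2, R, half_pos hR, half_lt_self hR⟩
  obtain ⟨L, hL⟩ := exists_lipschitzWith_mollify hvb hΩm hΩ.volume_ne_top hvn φ
  have hψm : Measurable (mollify φ v) := hL.continuous.measurable
  refine ⟨mollify φ v, n, L, hL, abs_mollify_le hvb φ, ?_, ?_⟩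
  · have e : (fun x => mollify φ v x - u x) = fun x => (mollify φ v x - v x) + (v x - u x) := by
      funext x; ring
    rw [e]
    refine (gagliardo_add_le σ _ (hψm.sub hvm)).trans ?_
    rw [← ENNReal.add_halves ε]
    refine add_le_add ((gagliardo_mono (subset_univ _) _).trans
      (gagliardo_mollify_sub_le hvb φ fun w hw => (hball w hw).1)) (le_trans (le_of_eq ?_) hn1)
    exact gagliardo_eqOn hΩm hΩm (fun x hx => by simp only [hvΩ x hx])
      (fun x hx => by simp only [hvΩ x hx])
  · have hs : ∫⁻ x in Ω, ENNReal.ofReal |mollify φ v x - v x| ≤ δ :=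
      (setLIntegral_le_lintegral _ _).trans (lintegral_mollify_sub_le hvb φ fun w hw => by
        simpa only [Real.enorm_eq_ofReal_abs] using (hball w hw).2)
    have hs' := hδ' _ (hψm.sub hvm) (fun x _ => by
      refine (abs_sub _ _).trans (add_le_add (abs_mollify_le hvb φ x) (hvb.2 x))) hs
    calc ∫⁻ x in Ω, ENNReal.ofReal |mollify φ v x - u x| * wt σ Ωᶜ x
        ≤ ∫⁻ x in Ω, (ENNReal.ofReal |mollify φ v x - v x| * wt σ Ωᶜ x
            + ENNReal.ofReal |clamp n (u x) - u x| * wt σ Ωᶜ x) := by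
          refine setLIntegral_mono' hΩm fun x hx => ?_
          rw [← add_mul, ← ENNReal.ofReal_add (abs_nonneg _) (abs_nonneg _), ← hvΩ x hx]
          gcongr ENNReal.ofReal ?_ * _
          exact abs_sub_le _ _ _
      _ ≤ ε / 2 + ε / 2 := by
          rw [lintegral_add_left (by fun_prop)]
          exact add_le_add hs' hn2
      _ = ε := ENNReal.add_halves ε

end

section

/-! ### Consistency of the finite element spaces -/

variable {d : ℕ} {Λ Ω : Set (Eucl d)} {K : Cplx d}

open Classical in
/-- The finite element function with the nodal values of `ψ` in `Ω` and of the exterior Clément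
interpolant of `g` elsewhere. -/
def interp (K : Cplx d) (Ω : Set (Eucl d)) (ψ g : Eucl d → ℝ) : Eucl d → ℝ :=
  nodal K fun p => if p ∈ Ω then ψ p else clementValue K Ω g p

theorem interp_eq_of_outerCell (hK : IsMesh Λ Ω K) (hΩ : IsOpen Ω) (ψ g : Eucl d → ℝ)
    {t : Finset (Eucl d)} (ht : t ∈ hK.outerCells) {x : Eucl d} (hx : x ∈ elt t) :
    interp K Ω ψ g x = nodal K (clementValue K Ω g) x := by
  have htc := (hK.mem_outerCells.1 ht).1
  obtain ⟨q, hq⟩ := exists_affine_eq htc (clementValue K Ω g)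
  rw [nodal_eq htc hx hq, interp]
  refine nodal_eq htc hx fun p hp => ?_
  rw [if_neg (hK.notMem_of_outerCell hΩ ht (mem_elt_of_mem hp)), hq p hp]

theorem interp_mem (hK : IsMesh Λ Ω K) (hΩ : IsBoundedLipschitzDomain Ω)
    (hΛ : closure Ω ⊆ interior Λ) (ψ g : Eucl d → ℝ) : interp K Ω ψ g ∈ feSpaceBC Λ Ω K g := by
  refine ⟨hK.nodal_mem _, fun x hx => ?_⟩
  obtain ⟨t, ht, hxt⟩ := hK.exists_outerCell_of_notMem hΩ hΛ hx.1 hx.2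
  rw [interp_eq_of_outerCell hK hΩ.isOpen ψ g ht hxt,
    exteriorClement_eq_of_outerCell hK hΩ.isOpen ht hxt]

theorem IsMesh.abs_clementValue_le (hK : IsMesh Λ Ω K) (hΩ : IsBoundedLipschitzDomain Ω)
    (hΛ : closure Ω ⊆ interior Λ) {g : Eucl d → ℝ} {M : ℝ} (hg : BddMeas g M) {p : Eucl d}
    (hp : p ∈ K.vertices) (hpΩ : p ∉ Ω) :
    |clementValue K Ω g p| ≤ (affConst d).toReal * M := by
  have := hK.abs_clementValue_sub_le hΩ hΛ hg hp hpΩ (a := 0)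
    ((abs_nonneg _).trans (hg.2 0)) (fun y _ => by rw [sub_zero]; exact hg.2 y)
  rwa [sub_zero] at this

theorem closure_ae_eq (hΩ : IsBoundedLipschitzDomain Ω) : (closure Ω : Set _) =ᵐ[volume] Ω := by
  have h : closure Ω = Ω ∪ frontier Ω := by
    rw [closure_eq_interior_union_frontier, hΩ.isOpen.interior_eq]
  rw [h]
  exact union_ae_eq_left_of_ae_eq_empty (ae_eq_empty.2 hΩ.volume_frontier)

theorem IsMesh.innerCells_cover (hK : IsMesh Λ Ω K) :
    ⋃ t ∈ hK.innerCells, elt t = closure Ω := by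
  refine Subset.antisymm (iUnion₂_subset fun t ht => (hK.mem_innerCells.1 ht).2) fun x hx => ?_
  obtain ⟨t, ht, hxt⟩ := hK.exists_innerCell hx
  exact mem_biUnion ht hxt

theorem IsMesh.sum_lintegral_innerCells (hK : IsMesh Λ Ω K) (hΩ : IsBoundedLipschitzDomain Ω)
    (f : Eucl d → ℝ≥0∞) : ∑ t ∈ hK.innerCells, ∫⁻ x in elt t, f x = ∫⁻ x in Ω, f x := by
  rw [← lintegral_biUnion_elt fun t ht => (hK.mem_innerCells.1 ht).1, hK.innerCells_cover,
    setLIntegral_congr (closure_ae_eq hΩ)]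

/-- Absolute continuity of the integral of the weight, since thin layers have small volume. -/
theorem exists_lintegral_layer_le (hd : 1 ≤ d) (hΩ : IsBoundedLipschitzDomain Ω) {σ : ℝ}
    (h0 : 0 < σ) (h1 : σ < 1) {ε : ℝ≥0∞} (hε : 0 < ε) :
    ∃ δ > 0, ∫⁻ x in {x ∈ Ω | Metric.infDist x Ωᶜ < δ}, dinv σ Ω x ≤ ε := by
  obtain ⟨η, hη, h⟩ := exists_pos_setLIntegral_lt_of_measure_lt
    (lintegral_dinv_ne_top hd hΩ h0 h1) hε.ne'
  obtain ⟨C, hC, hlayer⟩ := hΩ.exists_volume_layer_le hd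
  obtain ⟨δ, hδ, hδη⟩ : ∃ δ : ℝ, 0 < δ ∧ ENNReal.ofReal (C * δ) < η := by
    have ht : Tendsto (fun t : ℝ => ENNReal.ofReal (C * t)) (𝓝[>] 0) (𝓝 0) := by
      have : Continuous fun t : ℝ => ENNReal.ofReal (C * t) :=
        ENNReal.continuous_ofReal.comp (continuous_const.mul continuous_id)
      have := (this.tendsto 0).mono_left (nhdsWithin_le_nhds (s := Ioi 0))
      simpa using this
    obtain ⟨δ, h1, h2⟩ := ((ht.eventually (gt_mem_nhds hη)).and self_mem_nhdsWithin).exists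
    exact ⟨δ, h2, h1⟩
  refine ⟨δ, hδ, ?_⟩
  have hsub : {x ∈ Ω | Metric.infDist x Ωᶜ < δ} ⊆ Ω := fun x hx => hx.1
  have := h {x ∈ Ω | Metric.infDist x Ωᶜ < δ} (by
    rw [Measure.restrict_apply' hΩ.measurableSet, inter_eq_left.2 hsub]
    exact (hlayer δ hδ).trans_lt hδη)
  rw [Measure.restrict_restrict_of_subset hsub] at this
  exact this.le

theorem exists_pos_mul_le {C ε : ℝ≥0∞} (hC : C ≠ ∞) (hε : 0 < ε) : ∃ η > 0, C * η ≤ ε :=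
  ⟨ε / C, ENNReal.div_pos hε.ne' hC, ENNReal.mul_div_le⟩

/-- Shape regularity of a mesh. -/
def IsRegular (ρ : ℝ) (K : Cplx d) : Prop :=
  ∀ t ∈ cells K, Metric.diam (elt t) ≤ ρ * inDiam (elt t)

/-- A finite element function is bounded, and the inverse estimate makes it Lipschitz on each of the
finitely many fat cells. -/
theorem gagliardo_feSpace_ne_top (hd : 1 ≤ d) {ρ : ℝ} (hK : IsMesh Λ Ω K) (hr : IsRegular ρ K)
    {σ : ℝ} (h0 : 0 < σ) (h1 : σ < 1) {v : Eucl d → ℝ} (hv : v ∈ feSpace Λ K) :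
    gagliardo σ univ v ≠ ∞ := by
  obtain ⟨M, hM⟩ := hK.isCompact.exists_bound_of_continuousOn hv.1
  have hκ : 0 < 4 * |ρ| + 1 := by positivity
  refine ne_top_of_le_ne_top ?_ (gagliardo_le_sum hd hK.cellFinset hκ (T := elt)
    (r := fun t => Metric.diam (elt t) / (4 * |ρ| + 1)) (m := fun _ => M)
    (fun t ht => isFat_elt hd (hK.mem_cellFinset.1 ht) (hr t (hK.mem_cellFinset.1 ht)))
    (fun x hx => hv.2.2 x fun hxΛ => ?_) (fun t ht x hx => ?_) (fun t ht x hx y hy => ?_))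
  · refine ENNReal.mul_ne_top (ENNReal.mul_ne_top ?_ (kerConst_ne_top hd h0 h1)) ?_
    · exact ENNReal.add_ne_top.2 ⟨ENNReal.ofReal_ne_top,
        ENNReal.mul_ne_top (by simp) (ENNReal.natCast_ne_top d)⟩
    · refine ENNReal.sum_ne_top.2 fun t ht => ENNReal.mul_ne_top ENNReal.ofReal_ne_top ?_
      exact (isCompact_elt t).measure_lt_top.ne
  · obtain ⟨t, ht, hxt⟩ := hK.exists_cell hxΛ
    exact hx t (hK.mem_cellFinset.2 ht) hxt
  · exact hM x (hK.elt_subset (hK.mem_cellFinset.1 ht) hx)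
  · have htc := hK.mem_cellFinset.1 ht
    obtain ⟨q, hq⟩ := hv.2.1 t htc
    rw [hq hx, hq hy]
    exact (isFat_elt hd htc (hr t htc)).abs_sub_le
      (fun z hz => by rw [← hq hz]; exact hM z (hK.elt_subset htc hz)) x y

theorem gagliardo_const_ne_top (hd : 1 ≤ d) {σ : ℝ} (h0 : 0 < σ) (h1 : σ < 1) (κ : ℝ) :
    (ENNReal.ofReal (κ ^ (1 - σ)) + 2 * d) * kerConst d σ ≠ ∞ :=
  ENNReal.mul_ne_top (ENNReal.add_ne_top.2 ⟨ENNReal.ofReal_ne_top,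
    ENNReal.mul_ne_top (by simp) (ENNReal.natCast_ne_top d)⟩) (kerConst_ne_top hd h0 h1)

theorem div_rpow_neg {a κ σ : ℝ} (ha : 0 ≤ a) (hκ : 0 < κ) :
    (a / κ) ^ (-σ) = κ ^ σ * a ^ (-σ) := by
  rw [Real.div_rpow ha hκ.le, Real.rpow_neg hκ.le, div_inv_eq_mul, mul_comm]

/-- The two interpolants differ only on cells with a vertex outside `Ω`, and there by a bounded
amount even though `ψ` does not match `g`. A point of such a cell is within the cell diameter of
`Ωᶜ`, so `diam^(-σ)` is bounded by `dinv`, and the sum over cells by the integral of `dinv` over a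
thin layer. -/
theorem exists_gagliardo_strip_le (hd : 1 ≤ d) (hΩ : IsBoundedLipschitzDomain Ω)
    (hΛ : closure Ω ⊆ interior Λ) {σ : ℝ} (h0 : 0 < σ) (h1 : σ < 1) {ψ g : Eucl d → ℝ}
    {N M : ℝ} (hψ : ∀ x, |ψ x| ≤ N) (hg : BddMeas g M) (ρ : ℝ) {ε : ℝ≥0∞} (hε : 0 < ε) :
    ∃ δ > 0, ∀ K : Cplx d, IsMesh Λ Ω K → IsRegular ρ K → meshSize K < δ →
      gagliardo σ univ ((closure Ω).indicator fun x => interp K Ω ψ g x - nodal K ψ x) ≤ ε := by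
  classical
  set κ : ℝ := 4 * |ρ| + 1 with hκdef
  have hκ : 0 < κ := by positivity
  set m : ℝ := (affConst d).toReal * M + N with hm
  have hM : 0 ≤ M := (abs_nonneg _).trans (hg.2 0)
  have hN : 0 ≤ N := (abs_nonneg _).trans (hψ 0)
  have hm0 : 0 ≤ m := by positivity
  obtain ⟨η, hη, hηε⟩ := exists_pos_mul_le (C := (ENNReal.ofReal (κ ^ (1 - σ)) + 2 * d) *
    kerConst d σ * ENNReal.ofReal (m * κ ^ σ))
    (ENNReal.mul_ne_top (gagliardo_const_ne_top hd h0 h1 κ) ENNReal.ofReal_ne_top) hε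
  obtain ⟨δ, hδ, hδη⟩ := exists_lintegral_layer_le hd hΩ h0 h1 hη
  refine ⟨δ, hδ, fun K hK hr hh => ?_⟩
  set S := {x ∈ Ω | Metric.infDist x Ωᶜ < δ} with hS
  have hSm : MeasurableSet S :=
    hΩ.measurableSet.inter ((Metric.continuous_infDist_pt Ωᶜ).measurable measurableSet_Iio)
  have hfat : ∀ t ∈ hK.innerCells, IsFat κ (Metric.diam (elt t) / κ) (elt t) := fun t ht =>
    isFat_elt hd (hK.mem_innerCells.1 ht).1 (hr t (hK.mem_innerCells.1 ht).1)
  let mt : Finset (Eucl d) → ℝ := fun t => if ∀ p ∈ t, p ∈ Ω then 0 else m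
  have hv : ∀ t ∈ hK.innerCells, ∃ q : Eucl d →ᵃ[ℝ] ℝ, (∀ x ∈ elt t,
      (closure Ω).indicator (fun x => interp K Ω ψ g x - nodal K ψ x) x = q x) ∧
      ∀ x ∈ elt t, |q x| ≤ mt t := by
    intro t ht
    obtain ⟨htc, hts⟩ := hK.mem_innerCells.1 ht
    obtain ⟨q, hq⟩ := exists_affine_eq htc
      fun p => (if p ∈ Ω then ψ p else clementValue K Ω g p) - ψ p
    refine ⟨q, fun x hx => ?_, fun x hx => ?_⟩
    · rw [indicator_of_mem (hts hx), interp, nodal_sub htc hx]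
      exact nodal_eq htc hx hq
    · rw [← nodal_eq htc hx hq]
      refine nodal_abs_le htc hx fun p hp => ?_
      by_cases hall : ∀ p ∈ t, p ∈ Ω
      · simp only [mt, if_pos hall, if_pos (hall p hp), sub_self, abs_zero, le_refl]
      · simp only [mt, if_neg hall]
        split_ifs with hpΩ
        · simpa using hm0
        · exact (abs_sub _ _).trans (add_le_add (hK.abs_clementValue_le hΩ hΛ hg
            (mem_vertices_of_mem_cell htc hp) hpΩ) (hψ p))
  refine (gagliardo_le_sum hd hK.innerCells hκ (T := elt)
    (r := fun t => Metric.diam (elt t) / κ) (m := mt) hfat (fun x hx => ?_)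
    (fun t ht x hx => ?_) (fun t ht x hx y hy => ?_)).trans (le_trans ?_ hηε)
  · refine indicator_of_notMem (fun hxΩ => ?_) _
    obtain ⟨t, ht, hxt⟩ := hK.exists_innerCell hxΩ
    exact hx t ht hxt
  · obtain ⟨q, hq, hqm⟩ := hv t ht
    rw [hq x hx]
    exact hqm x hx
  · obtain ⟨q, hq, hqm⟩ := hv t ht
    rw [hq x hx, hq y hy]
    exact (hfat t ht).abs_sub_le hqm x y
  · rw [mul_assoc _ (ENNReal.ofReal (m * κ ^ σ))]
    gcongr
    calc ∑ t ∈ hK.innerCells, ENNReal.ofReal (mt t * (Metric.diam (elt t) / κ) ^ (-σ)) *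
          volume (elt t)
        ≤ ∑ t ∈ hK.innerCells, ∫⁻ x in elt t,
            ENNReal.ofReal (m * κ ^ σ) * S.indicator (dinv σ Ω) x := by
          refine Finset.sum_le_sum fun t ht => ?_
          obtain ⟨htc, hts⟩ := hK.mem_innerCells.1 ht
          by_cases hall : ∀ p ∈ t, p ∈ Ω
          · simp only [mt, if_pos hall, zero_mul, ENNReal.ofReal_zero, zero_le]
          · simp only [mt, if_neg hall]
            push Not at hall
            obtain ⟨p, hp, hpΩ⟩ := hall
            rw [← setLIntegral_const]
            refine lintegral_mono_ae ?_
            have hae : ∀ᵐ x, x ∈ closure Ω → x ∈ Ω := by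
              filter_upwards [closure_ae_eq hΩ] with x hx
              exact hx.mp
            filter_upwards [ae_restrict_mem (measurableSet_elt t), ae_restrict_of_ae hae]
              with x hx hx'
            have hxΩ := hx' (hts hx)
            have hdist : Metric.infDist x Ωᶜ ≤ Metric.diam (elt t) :=
              (Metric.infDist_le_dist_of_mem hpΩ).trans (Metric.dist_le_diam_of_mem
                (isCompact_elt t).isBounded hx (mem_elt_of_mem hp))
            have hxS : x ∈ S := ⟨hxΩ, hdist.trans_lt ((diam_le_meshSize hK htc).trans_lt hh)⟩
            rw [indicator_of_mem hxS, div_rpow_neg Metric.diam_nonneg hκ, ← mul_assoc,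
              ENNReal.ofReal_mul (by positivity)]
            gcongr
            exact le_dinv hd hΩ h0.le hxΩ hdist
      _ = ∫⁻ x in Ω, ENNReal.ofReal (m * κ ^ σ) * S.indicator (dinv σ Ω) x :=
          hK.sum_lintegral_innerCells hΩ _
      _ ≤ ENNReal.ofReal (m * κ ^ σ) * η := by
          rw [lintegral_const_mul _ ((measurable_dinv σ Ω).indicator hSm)]
          gcongr
          refine (setLIntegral_le_lintegral _ _).trans ?_
          rw [lintegral_indicator hSm]
          exact hδη

/-- On each cell the interpolation error is `O(diam)` with Lipschitz constant `O(1)`, so the sum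
over cells is at most a multiple of `δ^(1-σ) |Ω|`. -/
theorem exists_gagliardo_interp_sub_le (hd : 1 ≤ d) (hΩ : IsBoundedLipschitzDomain Ω)
    {σ : ℝ} (h0 : 0 < σ) (h1 : σ < 1) {ψ : Eucl d → ℝ} {L : NNReal} (hψ : LipschitzWith L ψ)
    (ρ : ℝ) {ε : ℝ≥0∞} (hε : 0 < ε) :
    ∃ δ > 0, ∀ K : Cplx d, IsMesh Λ Ω K → IsRegular ρ K → meshSize K < δ →
      gagliardo σ univ ((closure Ω).indicator fun x => nodal K ψ x - ψ x) ≤ ε := by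
  set κ : ℝ := 4 * |ρ| + 1 with hκdef
  have hκ1 : 1 ≤ κ := by rw [hκdef]; linarith [abs_nonneg ρ]
  have hκ : 0 < κ := by positivity
  have hCt : (ENNReal.ofReal (κ ^ (1 - σ)) + 2 * d) * kerConst d σ * volume Ω ≠ ∞ :=
    ENNReal.mul_ne_top (gagliardo_const_ne_top hd h0 h1 κ) hΩ.volume_ne_top
  obtain ⟨δ, hδ, hδη⟩ : ∃ δ : ℝ, 0 < δ ∧
      (ENNReal.ofReal (κ ^ (1 - σ)) + 2 * d) * kerConst d σ * volume Ω *
        ENNReal.ofReal (2 * L * κ * κ ^ σ * δ ^ (1 - σ)) ≤ ε := by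
    have ht : Tendsto (fun t : ℝ => (ENNReal.ofReal (κ ^ (1 - σ)) + 2 * d) * kerConst d σ *
        volume Ω * ENNReal.ofReal (2 * L * κ * κ ^ σ * t ^ (1 - σ))) (𝓝[>] 0) (𝓝 0) := by
      have hc : Continuous fun t : ℝ => ENNReal.ofReal (2 * L * κ * κ ^ σ * t ^ (1 - σ)) :=
        ENNReal.continuous_ofReal.comp (continuous_const.mul
          (Real.continuous_rpow_const (by linarith)))
      have := (hc.tendsto 0).mono_left (nhdsWithin_le_nhds (s := Ioi 0))
      rw [Real.zero_rpow (by linarith), mul_zero, ENNReal.ofReal_zero] at this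
      simpa using ENNReal.Tendsto.const_mul this (Or.inr hCt)
    obtain ⟨δ, h1, h2⟩ := ((ht.eventually (ge_mem_nhds hε)).and self_mem_nhdsWithin).exists
    exact ⟨δ, h2, h1⟩
  refine ⟨δ, hδ, fun K hK hr hh => ?_⟩
  have hfat : ∀ t ∈ hK.innerCells, IsFat κ (Metric.diam (elt t) / κ) (elt t) := fun t ht =>
    isFat_elt hd (hK.mem_innerCells.1 ht).1 (hr t (hK.mem_innerCells.1 ht).1)
  have hb : ∀ t ∈ hK.innerCells, ∀ x ∈ elt t, ∀ y ∈ elt t,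
      |nodal K ψ x - ψ y| ≤ L * Metric.diam (elt t) := by
    intro t ht x hx y hy
    obtain ⟨htc, hts⟩ := hK.mem_innerCells.1 ht
    rw [← nodal_const htc hx (ψ y), nodal_sub htc hx]
    refine nodal_abs_le htc hx fun p hp => ?_
    have := hψ.dist_le_mul p y
    rw [Real.dist_eq] at this
    refine this.trans (mul_le_mul_of_nonneg_left ?_ L.2)
    exact Metric.dist_le_diam_of_mem (isCompact_elt t).isBounded (mem_elt_of_mem hp) hy
  -- With this `m`, the ratio `m / r` is `2 L κ²`. It dominates the Lipschitz constant `L κ + L` of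
  -- the error because `κ ≥ 1`.
  refine (gagliardo_le_sum hd hK.innerCells hκ (T := elt)
    (r := fun t => Metric.diam (elt t) / κ) (m := fun t => 2 * L * κ * Metric.diam (elt t)) hfat
    (fun x hx => ?_) (fun t ht x hx => ?_) (fun t ht x hx y hy => ?_)).trans (le_trans ?_ hδη)
  · refine indicator_of_notMem (fun hxΩ => ?_) _
    obtain ⟨t, ht, hxt⟩ := hK.exists_innerCell hxΩ
    exact hx t ht hxt
  · rw [indicator_of_mem ((hK.mem_innerCells.1 ht).2 hx)]
    refine (hb t ht x hx x hx).trans ?_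
    have hd0 : 0 ≤ Metric.diam (elt t) := Metric.diam_nonneg
    gcongr
    have : (0 : ℝ) ≤ L := L.2
    nlinarith
  · obtain ⟨htc, hts⟩ := hK.mem_innerCells.1 ht
    rw [indicator_of_mem (hts hx), indicator_of_mem (hts hy)]
    have hdp := diam_elt_pos hd htc
    obtain ⟨q, hq⟩ := exists_affine_eq htc ψ
    have hlip := (hfat t ht).abs_sub_le (q := q - AffineMap.const ℝ (Eucl d) (ψ x))
      (m := L * Metric.diam (elt t)) (fun z hz => by
        have := hb t ht z hz x hx
        rwa [nodal_eq htc hz hq] at this) x y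
    have hlip2 : |nodal K ψ x - nodal K ψ y| ≤ L * κ * ‖x - y‖ := by
      rw [nodal_eq htc hx hq, nodal_eq htc hy hq]
      calc |q x - q y| = |(q - AffineMap.const ℝ (Eucl d) (ψ x)) x -
            (q - AffineMap.const ℝ (Eucl d) (ψ x)) y| := by simp
        _ ≤ _ := hlip
        _ = L * κ * ‖x - y‖ := by field_simp
    have hlip3 := hψ.dist_le_mul x y
    rw [Real.dist_eq, dist_eq_norm] at hlip3
    have hL : (0 : ℝ) ≤ L := L.2
    calc |nodal K ψ x - ψ x - (nodal K ψ y - ψ y)|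
        = |(nodal K ψ x - nodal K ψ y) - (ψ x - ψ y)| := by congr 1; ring
      _ ≤ L * κ * ‖x - y‖ + L * ‖x - y‖ := (abs_sub _ _).trans (add_le_add hlip2 hlip3)
      _ ≤ 2 * L * κ * κ * ‖x - y‖ := by
          rw [← add_mul]
          refine mul_le_mul_of_nonneg_right ?_ (norm_nonneg _)
          nlinarith [mul_le_mul hκ1 hκ1 zero_le_one hκ.le, mul_nonneg hL hκ.le,
            mul_nonneg hL (sub_nonneg.2 hκ1), mul_nonneg (mul_nonneg hL hκ.le) (sub_nonneg.2 hκ1)]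
      _ = _ := by field_simp
  · rw [mul_assoc _ (volume Ω)]
    gcongr
    calc ∑ t ∈ hK.innerCells, ENNReal.ofReal (2 * L * κ * Metric.diam (elt t) *
          (Metric.diam (elt t) / κ) ^ (-σ)) * volume (elt t)
        ≤ ∑ t ∈ hK.innerCells, ∫⁻ x in elt t,
            ENNReal.ofReal (2 * L * κ * κ ^ σ * δ ^ (1 - σ)) := by
          refine Finset.sum_le_sum fun t ht => ?_
          have htc := (hK.mem_innerCells.1 ht).1
          have hdp := diam_elt_pos hd htc
          rw [setLIntegral_const]
          gcongr ENNReal.ofReal ?_ * _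
          have e : Metric.diam (elt t) * Metric.diam (elt t) ^ (-σ) =
              Metric.diam (elt t) ^ (1 - σ) := by
            rw [sub_eq_add_neg, Real.rpow_add hdp, Real.rpow_one]
          calc _ = 2 * L * κ * κ ^ σ * Metric.diam (elt t) ^ (1 - σ) := by
                rw [div_rpow_neg hdp.le hκ, ← e]; ring
            _ ≤ _ := by
                gcongr
                exact ((diam_le_meshSize hK htc).trans_lt hh).le
      _ = volume Ω * ENNReal.ofReal (2 * L * κ * κ ^ σ * δ ^ (1 - σ)) := by
          rw [hK.sum_lintegral_innerCells hΩ, setLIntegral_const, mul_comm]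

end

/-! ### Exterior error and consistency in the seminorm over `Q_Ω` -/

section

variable {d : ℕ} {Λ Ω : Set (Eucl d)} {K : Cplx d}

theorem IsMesh.abs_interp_le_of_notMem (hK : IsMesh Λ Ω K) (hΩ : IsBoundedLipschitzDomain Ω)
    (hΛ : closure Ω ⊆ interior Λ) {g : Eucl d → ℝ} {M : ℝ} (hg : BddMeas g M) (ψ : Eucl d → ℝ)
    {x : Eucl d} (hx : x ∉ Ω) : |interp K Ω ψ g x| ≤ (affConst d).toReal * M := by
  have hM : 0 ≤ M := (abs_nonneg _).trans (hg.2 0)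
  by_cases hxΛ : x ∈ Λ
  · obtain ⟨t, ht, hxt⟩ := hK.exists_outerCell_of_notMem hΩ hΛ hxΛ hx
    have htc := (hK.mem_outerCells.1 ht).1
    rw [interp_eq_of_outerCell hK hΩ.isOpen ψ g ht hxt]
    exact nodal_abs_le htc hxt fun p hp => hK.abs_clementValue_le hΩ hΛ hg
      (mem_vertices_of_mem_cell htc hp) (hK.notMem_of_outerCell hΩ.isOpen ht (mem_elt_of_mem hp))
  · rw [interp, hK.nodal_eq_zero hxΛ, abs_zero]
    positivity

/-- The exterior error is bounded and tends to 0 in `L¹`, while the weight is integrable over `Ωᶜ`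
by symmetry of the fractional perimeter. The values off `Ω` do not involve `ψ`, so `δ` precedes it.
-/
theorem exists_lintegral_outer_le (hd : 1 ≤ d) (hΩ : IsBoundedLipschitzDomain Ω)
    (hΛ : closure Ω ⊆ interior Λ) (hΛm : MeasurableSet Λ) (hΛb : Bornology.IsBounded Λ)
    {σ : ℝ} (h0 : 0 < σ) (h1 : σ < 1) {g : Eucl d → ℝ} {M : ℝ} (hg : BddMeas g M)
    (hgΛ : ∀ x ∉ Λ, g x = 0) {ε : ℝ≥0∞} (hε : 0 < ε) :
    ∃ δ > 0, ∀ K : Cplx d, IsMesh Λ Ω K → meshSize K < δ → ∀ ψ : Eucl d → ℝ,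
      ∫⁻ x in Ωᶜ, ENNReal.ofReal |interp K Ω ψ g x - g x| * wt σ Ω x ≤ ε := by
  have hΩm := hΩ.measurableSet
  have hfin : ∫⁻ x in Ωᶜ, wt σ Ω x ≠ ∞ := by
    rw [← lintegral_wt_comm]
    exact lintegral_wt_compl_ne_top hd hΩ h0 h1
  obtain ⟨η, hη, h⟩ := exists_lintegral_mul_le hΩm.compl (measurable_wt σ Ω) hfin
    ((affConst d).toReal * M + M) hε
  obtain ⟨η', hη', hηη'⟩ : ∃ η' : ℝ, 0 < η' ∧ ENNReal.ofReal η' ≤ η := by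
    obtain ⟨a, ha, ha'⟩ := exists_between hη
    exact ⟨a.toReal, ENNReal.toReal_pos ha.ne' ha'.ne_top,
      by rw [ENNReal.ofReal_toReal ha'.ne_top]; exact ha'.le⟩
  obtain ⟨δ, hδ, hδ'⟩ := tendsto_clement hΩ hΛ hΛm hΛb hg hη'
  refine ⟨δ, hδ, fun K hK hh ψ => ?_⟩
  have hm := interp_mem hK hΩ hΛ ψ g
  refine h _ ((hK.measurable_of_mem hm.1).sub hg.1) (fun x hx => ?_) ?_
  · exact (abs_sub _ _).trans
      (add_le_add (hK.abs_interp_le_of_notMem hΩ hΛ hg ψ hx) (hg.2 x))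
  · refine le_trans (le_of_eq ?_) ((hδ' K hK hh).trans hηη')
    rw [← inter_union_compl Ωᶜ Λ, lintegral_union (hΩm.compl.inter hΛm.compl)
      (disjoint_compl_right.mono inter_subset_right inter_subset_right),
      setLIntegral_congr_fun (s := Ωᶜ ∩ Λᶜ) (g := fun _ => 0) (hΩm.compl.inter hΛm.compl),
      lintegral_zero, add_zero, inter_comm, ← sdiff_eq]
    · refine setLIntegral_congr_fun (hΛm.diff hΩm) fun x hx => ?_
      simp only [hm.2 hx]
    · intro x hx
      simp [hm.1.2.2 x hx.2, hgΛ x hx.2]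

theorem lintegral_mul_wt_le_gagliardo (hΩ : IsBoundedLipschitzDomain Ω) (σ : ℝ)
    {v : Eucl d → ℝ} (hv : Measurable v) (h0 : ∀ᵐ x, x ∉ Ω → v x = 0) :
    ∫⁻ x in Ω, ENNReal.ofReal |v x| * wt σ Ωᶜ x ≤ gagliardo σ univ v := by
  refine (lintegral_mul_wt_le σ Ω Ωᶜ hv).trans ?_
  rw [lintegral_congr_ae (g := fun _ => 0), lintegral_zero, add_zero]
  · exact gagliardo_mono (subset_univ _) _
  · filter_upwards [ae_restrict_mem hΩ.measurableSet.compl, ae_restrict_of_ae h0] with x hx hx'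
    simp [hx' hx]

theorem exists_consistent (hd : 1 ≤ d) (hΩ : IsBoundedLipschitzDomain Ω)
    (hΛ : closure Ω ⊆ interior Λ) (hΛm : MeasurableSet Λ) (hΛb : Bornology.IsBounded Λ)
    {σ : ℝ} (h0 : 0 < σ) (h1 : σ < 1) {g : Eucl d → ℝ} {M : ℝ} (hg : BddMeas g M)
    (hgΛ : ∀ x ∉ Λ, g x = 0) {u : Eucl d → ℝ} (hu : Measurable u) (hug : ∀ x ∉ Ω, u x = g x)
    (hfin : gagliardo σ (Ω ×ˢ Ω) u ≠ ∞)
    (hW : ∫⁻ x in Ω, ENNReal.ofReal |u x| * wt σ Ωᶜ x ≠ ∞) (ρ : ℝ) {ε : ℝ≥0∞} (hε : 0 < ε) :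
    ∃ δ > 0, ∀ K : Cplx d, IsMesh Λ Ω K → IsRegular ρ K → meshSize K < δ →
      ∃ w ∈ feSpaceBC Λ Ω K g, gagliardo σ (Q Ω) (fun x => w x - u x) ≤ ε := by
  -- There are three errors inside `Ω`, and twice the cross term, which consists of the same three
  -- and the exterior one: `3 + 2 (3 + 1) = 11`.
  obtain ⟨η, hη, hηε⟩ := exists_pos_mul_le (C := 11) (by simp) hε
  obtain ⟨ψ, N, L, hL, hN, hψ1, hψ2⟩ := exists_lipschitz_approx hd hΩ h0 h1 hu hfin hW hη
  obtain ⟨δ₁, hδ₁, H₁⟩ := exists_gagliardo_strip_le hd hΩ hΛ h0 h1 hN hg ρ hη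
  obtain ⟨δ₂, hδ₂, H₂⟩ := exists_gagliardo_interp_sub_le (Λ := Λ) hd hΩ h0 h1 hL ρ hη
  obtain ⟨δ₃, hδ₃, H₃⟩ := exists_lintegral_outer_le hd hΩ hΛ hΛm hΛb h0 h1 hg hgΛ hη
  refine ⟨min δ₁ (min δ₂ δ₃), by positivity, fun K hK hr hh => ?_⟩
  have e₁ := H₁ K hK hr (hh.trans_le (min_le_left _ _))
  have e₂ := H₂ K hK hr (hh.trans_le ((min_le_right _ _).trans (min_le_left _ _)))
  have e₃ := H₃ K hK (hh.trans_le ((min_le_right _ _).trans (min_le_right _ _))) ψ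
  have hw := interp_mem hK hΩ hΛ ψ g
  refine ⟨_, hw, ?_⟩
  have hΩm := hΩ.measurableSet
  have hwm := hK.measurable_of_mem hw.1
  have hψm : Measurable ψ := hL.continuous.measurable
  have hIm := hK.measurable_of_mem (hK.nodal_mem ψ)
  set b := (closure Ω).indicator fun x => interp K Ω ψ g x - nodal K ψ x with hb
  set c := (closure Ω).indicator fun x => nodal K ψ x - ψ x with hc
  have hbm : Measurable b := (hwm.sub hIm).indicator isClosed_closure.measurableSet
  have hcm : Measurable c := (hIm.sub hψm).indicator isClosed_closure.measurableSet
  have hsum : ∀ x ∈ Ω, interp K Ω ψ g x - u x = b x + (c x + (ψ x - u x)) := fun x hx => by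
    rw [hb, hc, indicator_of_mem (subset_closure hx), indicator_of_mem (subset_closure hx)]
    ring
  have hae : ∀ᵐ x, x ∉ Ω → x ∉ closure Ω := by
    filter_upwards [closure_ae_eq hΩ] with x hx hx1 hx2
    exact hx1 (hx.mp hx2)
  have hb1 : ∫⁻ x in Ω, ENNReal.ofReal |b x| * wt σ Ωᶜ x ≤ η :=
    (lintegral_mul_wt_le_gagliardo hΩ σ hbm (by
      filter_upwards [hae] with x hx hx' using indicator_of_notMem (hx hx') _)).trans e₁
  have hc1 : ∫⁻ x in Ω, ENNReal.ofReal |c x| * wt σ Ωᶜ x ≤ η :=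
    (lintegral_mul_wt_le_gagliardo hΩ σ hcm (by
      filter_upwards [hae] with x hx hx' using indicator_of_notMem (hx hx') _)).trans e₂
  have hwt := measurable_wt σ Ωᶜ
  have hin : gagliardo σ (Ω ×ˢ Ω) (fun x => interp K Ω ψ g x - u x) ≤ η + (η + η) := by
    rw [gagliardo_eqOn hΩm hΩm hsum hsum]
    refine (gagliardo_add_le σ _ hbm).trans ?_
    refine add_le_add ((gagliardo_mono (subset_univ _) _).trans e₁) ?_
    refine (gagliardo_add_le σ _ hcm).trans ?_
    exact add_le_add ((gagliardo_mono (subset_univ _) _).trans e₂) hψ1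
  have hcross : ∫⁻ x in Ω, ENNReal.ofReal |interp K Ω ψ g x - u x| * wt σ Ωᶜ x
      ≤ η + (η + η) := by
    calc _ ≤ ∫⁻ x in Ω, (ENNReal.ofReal |b x| * wt σ Ωᶜ x + (ENNReal.ofReal |c x| * wt σ Ωᶜ x
          + ENNReal.ofReal |ψ x - u x| * wt σ Ωᶜ x)) := by
          refine setLIntegral_mono' hΩm fun x hx => ?_
          rw [hsum x hx, ← add_mul, ← add_mul, ← ENNReal.ofReal_add (abs_nonneg _) (abs_nonneg _),
            ← ENNReal.ofReal_add (abs_nonneg _) (by positivity)]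
          gcongr ENNReal.ofReal ?_ * _
          exact (abs_add_le _ _).trans (add_le_add le_rfl (abs_add_le _ _))
      _ ≤ _ := by
          rw [lintegral_add_left (by fun_prop), lintegral_add_left (by fun_prop)]
          exact add_le_add hb1 (add_le_add hc1 hψ2)
  have hout : ∫⁻ x in Ωᶜ, ENNReal.ofReal |interp K Ω ψ g x - u x| * wt σ Ω x ≤ η := by
    refine le_trans (le_of_eq ?_) e₃
    refine setLIntegral_congr_fun hΩm.compl fun x hx => ?_
    simp only [hug x hx]
  calc _ ≤ (η + (η + η)) + 2 * ((η + (η + η)) + η) := by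
        refine (gagliardo_Q_le σ Ω (hwm.sub hu)).trans ?_
        exact add_le_add hin (mul_le_mul_right
          ((gagliardo_prod_le σ Ω Ωᶜ (hwm.sub hu)).trans (add_le_add hcross hout)) 2)
    _ = 11 * η := by ring
    _ ≤ ε := hηε

end

section

/-! ### The energy -/

variable {d : ℕ} {s : ℝ} {Ω : Set (Eucl d)}

/-- The difference quotient of `v`. -/
def quot (v : Eucl d → ℝ) (z : Eucl d × Eucl d) : ℝ := (v z.1 - v z.2) / ‖z.1 - z.2‖

theorem measurable_quot {v : Eucl d → ℝ} (hv : Measurable v) : Measurable (quot v) := by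
  unfold quot
  fun_prop

theorem quot_add (v w : Eucl d → ℝ) (z : Eucl d × Eucl d) :
    quot (fun x => v x + w x) z = quot v z + quot w z := by
  simp only [quot]; ring

theorem quot_sub (v w : Eucl d → ℝ) (z : Eucl d × Eucl d) :
    quot (fun x => v x - w x) z = quot v z - quot w z := by
  simp only [quot]; ring

theorem quot_half (v : Eucl d → ℝ) (z : Eucl d × Eucl d) :
    quot (fun x => v x / 2) z = quot v z / 2 := by
  simp only [quot]; ring

/-- One power of the distance moves from the kernel into the difference quotient, so linear bounds
on `F` become bounds between energy and seminorm. -/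
theorem abs_quot_mul_ker (hd : 1 ≤ d) (hs : 0 < s) (v : Eucl d → ℝ) (z : Eucl d × Eucl d) :
    ENNReal.ofReal |quot v z| * ker (d + 2 * s - 1) (z.1 - z.2) = gint (2 * s) v z := by
  have hd' : (1 : ℝ) ≤ d := by exact_mod_cast hd
  rw [← mul_ker_eq (d + 2 * s) (by linarith), ← mul_assoc, gint, ← ENNReal.ofReal_mul (abs_nonneg _)]
  by_cases hz : z.1 - z.2 = 0
  · rw [sub_eq_zero] at hz
    simp [hz]
  · rw [quot, abs_div, abs_norm, div_mul_cancel₀ _ (norm_ne_zero_iff.2 hz)]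

theorem energy_eq (s : ℝ) (Ω : Set (Eucl d)) (v : Eucl d → ℝ) :
    energy s Ω v =
      ∫⁻ z in Q Ω, ENNReal.ofReal (F d s (quot v z)) * ker (d + 2 * s - 1) (z.1 - z.2) := by
  refine lintegral_congr fun z => ?_
  rw [ofReal_div_eq_mul_ker _ _ _ (F_nonneg _)]
  rfl

theorem energy_congr (s : ℝ) (Ω : Set (Eucl d)) {v w : Eucl d → ℝ} (h : ∀ᵐ x, v x = w x) :
    energy s Ω v = energy s Ω w := by
  refine lintegral_congr_ae (ae_restrict_of_ae ?_)
  filter_upwards [ae_prod_of_ae h] with z hz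
  rw [hz.1, hz.2]

theorem measurable_energy_density {v : Eucl d → ℝ} (hv : Measurable v) :
    Measurable fun z : Eucl d × Eucl d =>
      ENNReal.ofReal (F d s (quot v z)) * ker (d + 2 * s - 1) (z.1 - z.2) := by
  have h1 : Measurable fun z => F d s (quot v z) :=
    (continuous_F (d := d) (s := s)).measurable.comp (measurable_quot hv)
  fun_prop

theorem energy_le_add (hd : 1 ≤ d) (hs : 0 < s) {v w : Eucl d → ℝ} (hw : Measurable w) :
    energy s Ω v ≤ energy s Ω w + 2 * gagliardo (2 * s) (Q Ω) (fun x => v x - w x) := by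
  rw [energy_eq, energy_eq, gagliardo_eq, ← lintegral_const_mul' _ _ (by simp),
    ← lintegral_add_left (measurable_energy_density hw)]
  refine lintegral_mono fun z => ?_
  rw [← abs_quot_mul_ker hd hs, quot_sub, ← mul_assoc, ← add_mul]
  gcongr
  rw [show (2 : ℝ≥0∞) = ENNReal.ofReal 2 by simp, ← ENNReal.ofReal_mul (by norm_num),
    ← ENNReal.ofReal_add (F_nonneg _) (by positivity)]
  exact ENNReal.ofReal_le_ofReal (by linarith [F_sub_le hd hs.le (quot v z) (quot w z)])

theorem energy_le_gagliardo (hd : 1 ≤ d) (hs : 0 < s) (v : Eucl d → ℝ) :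
    energy s Ω v ≤ 2 * gagliardo (2 * s) (Q Ω) v := by
  have h := energy_le_add (Ω := Ω) hd hs (v := v) (w := fun _ => 0) measurable_const
  have h0 : energy s Ω (fun _ => 0) = 0 := by simp [energy_eq, quot, F_zero]
  simpa [h0] using h

/-- The integral over `Q_Ω` of the convexity gap of the energy density between `u` and `u + e`. -/
def energyGap (s : ℝ) (Ω : Set (Eucl d)) (u e : Eucl d → ℝ) : ℝ≥0∞ :=
  ∫⁻ z in Q Ω, ENNReal.ofReal (convexityGap d s (quot u z) (quot u z + quot e z)) *
    ker (d + 2 * s - 1) (z.1 - z.2)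

/-- Integrated definition of the convexity gap, written as a sum so that it is valid in `[0, ∞]`
without finiteness assumptions. -/
theorem two_mul_energy_mid_add {u e : Eucl d → ℝ} (hu : Measurable u) (he : Measurable e) :
    2 * (energy s Ω (fun x => u x + e x / 2) + energyGap s Ω u e) =
      energy s Ω u + energy s Ω (fun x => u x + e x) := by
  rw [energy_eq, energy_eq, energy_eq, energyGap,
    ← lintegral_add_left (measurable_energy_density (by fun_prop)),
    ← lintegral_add_left (measurable_energy_density hu), ← lintegral_const_mul' _ _ (by simp)]
  have two : ∀ a : ℝ, 2 * ENNReal.ofReal a = ENNReal.ofReal (2 * a) := fun a => by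
    rw [ENNReal.ofReal_mul (by norm_num), ENNReal.ofReal_ofNat]
  refine lintegral_congr fun z => ?_
  rw [← add_mul, ← add_mul, ← mul_assoc, quot_add, quot_half, quot_add,
    ← ENNReal.ofReal_add (F_nonneg _) (convexityGap_nonneg _ _),
    ← ENNReal.ofReal_add (F_nonneg _) (F_nonneg _), two]
  congr 2
  rw [convexityGap, show (quot u z + (quot u z + quot e z)) / 2 = quot u z + quot e z / 2 by ring]
  ring

/-- If `u` does not exceed the midpoint in energy and `u + e` is nearly optimal, the convexity
inequality at the midpoint is nearly an equality. -/
theorem energyGap_le {u e : Eucl d → ℝ} (hu : Measurable u) (he : Measurable e) {ε : ℝ≥0∞}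
    (hfin : energy s Ω u ≠ ∞) (h1 : energy s Ω u ≤ energy s Ω fun x => u x + e x / 2)
    (h2 : energy s Ω (fun x => u x + e x) ≤ energy s Ω u + 2 * ε) : energyGap s Ω u e ≤ ε := by
  have h3 : 2 * energy s Ω u + 2 * energyGap s Ω u e ≤ 2 * energy s Ω u + 2 * ε := by
    calc _ ≤ 2 * (energy s Ω (fun x => u x + e x / 2) + energyGap s Ω u e) := by
          rw [mul_add]; gcongr
      _ ≤ energy s Ω u + (energy s Ω u + 2 * ε) := by
          rw [two_mul_energy_mid_add hu he]; gcongr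
      _ = _ := by ring
  have h4 := (ENNReal.add_le_add_iff_left (ENNReal.mul_ne_top (by simp) hfin)).1 h3
  exact (ENNReal.mul_le_mul_iff_right (by simp) (by simp)).1 h4

/-- The positive and negative parts of `h` have the same finite integral, which cancels. Thus `f`
and `g` may have infinite integrals. -/
theorem lintegral_ofReal_le_of_add_le {α : Type*} [MeasurableSpace α] {μ : Measure α}
    {f g h : α → ℝ} (hf : Measurable f) (hg : Measurable g)
    (hf0 : ∀ x, 0 ≤ f x) (hg0 : ∀ x, 0 ≤ g x) (hi : Integrable h μ) (hz : ∫ x, h x ∂μ = 0)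
    (hle : ∀ x, f x + h x ≤ g x) :
    ∫⁻ x, ENNReal.ofReal (f x) ∂μ ≤ ∫⁻ x, ENNReal.ofReal (g x) ∂μ := by
  have hp : ∫⁻ x, ENNReal.ofReal (h x) ∂μ ≠ ∞ := hi.lintegral_lt_top.ne
  have hn : ∫⁻ x, ENNReal.ofReal (-h x) ∂μ ≠ ∞ := hi.neg.lintegral_lt_top.ne
  rw [integral_eq_lintegral_pos_part_sub_lintegral_neg_part hi, sub_eq_zero,
    ENNReal.toReal_eq_toReal_iff' hp hn] at hz
  have h1 : ∫⁻ x, ENNReal.ofReal (f x) ∂μ + ∫⁻ x, ENNReal.ofReal (h x) ∂μ ≤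
      ∫⁻ x, ENNReal.ofReal (g x) ∂μ + ∫⁻ x, ENNReal.ofReal (h x) ∂μ := by
    nth_rewrite 2 [hz]
    rw [← lintegral_add_left (by fun_prop), ← lintegral_add_left (by fun_prop)]
    refine lintegral_mono fun x => ?_
    rcases le_total 0 (h x) with h0 | h0
    · rw [ENNReal.ofReal_of_nonpos (neg_nonpos.2 h0), add_zero, ← ENNReal.ofReal_add (hf0 x) h0]
      exact ENNReal.ofReal_le_ofReal (hle x)
    · rw [ENNReal.ofReal_of_nonpos h0, add_zero,
        ← ENNReal.ofReal_add (hg0 x) (neg_nonneg.2 h0)]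
      exact ENNReal.ofReal_le_ofReal (by linarith [hle x])
  exact (ENNReal.add_le_add_iff_right hp).1 h1

theorem form_congr (s : ℝ) (Ω : Set (Eucl d)) {u v u' v' : Eucl d → ℝ} (hu : ∀ᵐ x, u x = u' x)
    (hv : ∀ᵐ x, v x = v' x) : form s Ω u u v = form s Ω u' u' v' := by
  refine integral_congr_ae (ae_restrict_of_ae ?_)
  filter_upwards [ae_prod_of_ae hu, ae_prod_of_ae hv] with z hz hz'
  rw [hz.1, hz.2, hz'.1, hz'.2]

/-- Integrate the tangent inequality for `F`: its linear term is the vanishing form, integrable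
because `F'` is bounded. -/
theorem energy_le_of_form_eq_zero (hd : 1 ≤ d) (hs : 0 < s) {u v : Eucl d → ℝ}
    (hu : Measurable u) (hv : Measurable v)
    (hfin : gagliardo (2 * s) (Q Ω) (fun x => v x - u x) ≠ ∞)
    (h : form s Ω u u (fun x => v x - u x) = 0) : energy s Ω u ≤ energy s Ω v := by
  let k : Eucl d × Eucl d → ℝ := fun z => ‖z.1 - z.2‖ ^ (-((d : ℝ) + 2 * s - 1))
  have hk0 : ∀ z, 0 ≤ k z := fun z => Real.rpow_nonneg (norm_nonneg _) _
  have hkm : Measurable k := by fun_prop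
  have hum := measurable_quot hu
  have hvm := measurable_quot hv
  have hFu : Measurable fun z => F d s (quot u z) := (continuous_F).measurable.comp hum
  have hFv : Measurable fun z => F d s (quot v z) := (continuous_F).measurable.comp hvm
  have hF' : Measurable fun z => F' d s (quot u z) := (continuous_F').measurable.comp hum
  let H : Eucl d × Eucl d → ℝ := fun z => F' d s (quot u z) * (quot v z - quot u z) * k z
  have hHm : Measurable H := (hF'.mul (hvm.sub hum)).mul hkm
  have hi : Integrable H (volume.restrict (Q Ω)) := by
    refine ⟨hHm.aestronglyMeasurable, ?_⟩
    rw [hasFiniteIntegral_iff_enorm]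
    refine lt_of_le_of_lt ?_ (ENNReal.mul_lt_top (ENNReal.ofNat_lt_top (n := 2)) hfin.lt_top)
    rw [gagliardo_eq, ← lintegral_const_mul' _ _ (by simp)]
    refine lintegral_mono fun z => ?_
    rw [← abs_quot_mul_ker hd hs, quot_sub, Real.enorm_eq_ofReal_abs, abs_mul, abs_mul,
      abs_of_nonneg (hk0 z), ENNReal.ofReal_mul (by positivity), ENNReal.ofReal_mul (by positivity),
      ← mul_assoc]
    refine mul_le_mul_left (mul_le_mul_left ?_ _) _
    rw [show (2 : ℝ≥0∞) = ENNReal.ofReal 2 by simp]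
    exact ENNReal.ofReal_le_ofReal (abs_F'_le hd hs.le _)
  have hz : ∫ z in Q Ω, H z = 0 := by
    rw [← h]
    refine integral_congr_ae (ae_of_all _ fun z => ?_)
    simp only [H, k]
    rw [F'_eq, ← quot_sub]
    simp only [quot]
    by_cases hz : ‖z.1 - z.2‖ = 0
    · rw [norm_eq_zero, sub_eq_zero] at hz
      simp [hz]
    · have hp : 0 < ‖z.1 - z.2‖ := lt_of_le_of_ne (norm_nonneg _) (Ne.symm hz)
      rw [show -((d : ℝ) + 2 * s - 1) = 2 - (d + 1 + 2 * s) by ring, Real.rpow_sub hp,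
        Real.rpow_two]
      field_simp
  have key := lintegral_ofReal_le_of_add_le (μ := volume.restrict (Q Ω))
    (f := fun z => F d s (quot u z) * k z) (g := fun z => F d s (quot v z) * k z)
    (hFu.mul hkm) (hFv.mul hkm) (fun z => mul_nonneg (F_nonneg _) (hk0 z))
    (fun z => mul_nonneg (F_nonneg _) (hk0 z)) hi hz (fun z => by
      simp only [H]
      rw [← add_mul]
      exact mul_le_mul_of_nonneg_right (F_tangent _ _) (hk0 z))
  simp only [ENNReal.ofReal_mul (F_nonneg _)] at key
  rw [energy_eq, energy_eq]
  exact key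

theorem gagliardo_prod_le_energy (hd : 1 ≤ d) (hs : 0 < s) {B : Set (Eucl d)}
    {v : Eucl d → ℝ} (hv : Measurable v) :
    ENNReal.ofReal (F d s 1) * gagliardo (2 * s) (Ω ×ˢ B) v ≤ energy s Ω v +
      ENNReal.ofReal (F d s 1) * ∫⁻ z in Ω ×ˢ B, ker (d + 2 * s - 1) (z.1 - z.2) := by
  rw [energy_eq]
  refine le_trans ?_ (add_le_add (lintegral_mono_set (prod_subset_Q Ω B)) le_rfl)
  rw [gagliardo_eq, ← lintegral_const_mul' _ _ (by simp), ← lintegral_const_mul' _ _ (by simp),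
    ← lintegral_add_left (measurable_energy_density hv)]
  refine lintegral_mono fun z => ?_
  rw [← abs_quot_mul_ker hd hs, ← mul_assoc, ← add_mul, ← ENNReal.ofReal_mul (F_nonneg _),
    ← ENNReal.ofReal_add (F_nonneg _) (F_nonneg _)]
  gcongr ENNReal.ofReal ?_ * _
  linarith [F_growth (d := d) (s := s) (quot v z)]

/-- The kernel order `d + 2s - 1` is below `d`, so only large distances could cause divergence, and
they are excluded by `R`. -/
theorem lintegral_ker_prod_ne_top (hd : 1 ≤ d) (hs0 : 0 < s) (hs1 : s < 1 / 2)
    (hΩ : MeasurableSet Ω) (hfin : volume Ω ≠ ∞) {B : Set (Eucl d)} (hB : MeasurableSet B) {R : ℝ}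
    (hR : 0 < R) (h : ∀ x ∈ Ω, ∀ y ∈ B, ‖x - y‖ ≤ R) :
    ∫⁻ z in Ω ×ˢ B, ker (d + 2 * s - 1) (z.1 - z.2) ≠ ∞ := by
  have hd' : (1 : ℝ) ≤ d := by exact_mod_cast hd
  rw [lintegral_prod_restrict (by fun_prop)]
  have hb : ∫⁻ x in Ω, ∫⁻ y in B, ker (d + 2 * s - 1) (x - y) ≤
      ∫⁻ _ in Ω, ENNReal.ofReal (R ^ (1 - 2 * s)) * kerConst d (2 * s) := by
    refine setLIntegral_mono' hΩ fun x hx => ?_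
    refine le_trans (le_of_eq ?_) (lintegral_norm_mul_ker_le (2 * s) hB hR (h x hx))
    refine lintegral_congr fun y => ?_
    rw [mul_ker_eq (d + 2 * s) (by linarith)]
  refine ne_top_of_le_ne_top ?_ hb
  rw [setLIntegral_const]
  exact ENNReal.mul_ne_top (ENNReal.mul_ne_top ENNReal.ofReal_ne_top
    (kerConst_ne_top hd (by linarith) (by linarith))) hfin

end

section

/-! ### Stability -/

variable {d : ℕ} {s : ℝ} {Ω : Set (Eucl d)}

/-- A region of positive measure at positive, bounded distance from `Λ`, where functions vanishing
off `Λ` are zero. Differences against its points reveal values in `Ω`. -/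
theorem exists_far_ball (hd : 1 ≤ d) {Λ : Set (Eucl d)} (hΛ : Bornology.IsBounded Λ) :
    ∃ (D : Set (Eucl d)) (R : ℝ), MeasurableSet D ∧ 0 < volume D ∧ volume D ≠ ∞ ∧ 0 < R ∧
      ∀ x ∈ Λ, ∀ y ∈ D, 1 ≤ ‖x - y‖ ∧ ‖x - y‖ ≤ R := by
  have : Nonempty (Fin d) := ⟨⟨0, hd⟩⟩
  obtain ⟨r, hr, hΛr⟩ := hΛ.subset_closedBall_lt 0 0
  obtain ⟨c, hc⟩ := exists_norm_eq (Eucl d) (show 0 ≤ r + 2 by linarith)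
  refine ⟨Metric.ball c 1, 2 * r + 3, measurableSet_ball,
    Metric.measure_ball_pos _ _ one_pos, measure_ball_lt_top.ne, by linarith,
    fun x hx y hy => ?_⟩
  have h1 := mem_closedBall_zero_iff.1 (hΛr hx)
  have h2 := mem_ball_iff_norm.1 hy
  have h3 : ‖c‖ ≤ ‖x‖ + ‖x - y‖ + ‖y - c‖ := by
    calc ‖c‖ = ‖x - (x - y) - (y - c)‖ := by congr 1; abel
      _ ≤ ‖x - (x - y)‖ + ‖y - c‖ := norm_sub_le _ _
      _ ≤ _ := by gcongr; exact norm_sub_le _ _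
  have h4 : ‖x - y‖ ≤ ‖x‖ + ‖c‖ + ‖y - c‖ := by
    calc ‖x - y‖ = ‖x - c - (y - c)‖ := by congr 1; abel
      _ ≤ ‖x - c‖ + ‖y - c‖ := norm_sub_le _ _
      _ ≤ _ := by gcongr; exact norm_sub_le _ _
  constructor <;> linarith

theorem wt_ge {σ : ℝ} (hσ : 0 ≤ (d : ℝ) + σ) {D : Set (Eucl d)} (hD : MeasurableSet D) {R : ℝ}
    {x : Eucl d} (h : ∀ y ∈ D, 1 ≤ ‖x - y‖ ∧ ‖x - y‖ ≤ R) :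
    ENNReal.ofReal (R ^ (-((d : ℝ) + σ))) * volume D ≤ wt σ D x := by
  rw [wt, ← setLIntegral_const]
  refine setLIntegral_mono' hD fun y hy => ?_
  exact ker_anti hσ (norm_pos_iff.1 (one_pos.trans_le (h y hy).1)) (h y hy).2

/-- A Poincaré inequality: for `y` in the far ball the difference is just `f x`, and the kernel is
bounded below there. -/
theorem exists_lintegral_le_gagliardo (hd : 1 ≤ d) {Λ : Set (Eucl d)}
    (hΛ : Bornology.IsBounded Λ) (hΩΛ : Ω ⊆ Λ) (hΩ : MeasurableSet Ω) {σ : ℝ} (hσ : 0 < σ) :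
    ∃ C : ℝ≥0∞, C ≠ ∞ ∧ ∀ f : Eucl d → ℝ, Measurable f → (∀ x ∉ Λ, f x = 0) →
      ∫⁻ x in Ω, ENNReal.ofReal |f x| ≤ C * gagliardo σ (Q Ω) f := by
  obtain ⟨D, R, hD, hD0, hDt, hR, h⟩ := exists_far_ball hd hΛ
  set c : ℝ≥0∞ := ENNReal.ofReal (R ^ (-((d : ℝ) + σ))) * volume D with hc
  have hc0 : c ≠ 0 := mul_ne_zero (by rw [Ne, ENNReal.ofReal_eq_zero, not_le]; positivity) hD0.ne'
  have hct : c ≠ ∞ := ENNReal.mul_ne_top ENNReal.ofReal_ne_top hDt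
  refine ⟨c⁻¹, ENNReal.inv_ne_top.2 hc0, fun f hf hf0 => ?_⟩
  rw [← ENNReal.mul_le_mul_iff_right hc0 hct, ← mul_assoc, ENNReal.mul_inv_cancel hc0 hct, one_mul,
    ← lintegral_const_mul' _ _ hct]
  calc ∫⁻ x in Ω, c * ENNReal.ofReal |f x| ≤ ∫⁻ x in Ω, ENNReal.ofReal |f x| * wt σ D x := by
        refine setLIntegral_mono' hΩ fun x hx => ?_
        rw [mul_comm]
        gcongr
        exact wt_ge (by positivity) hD (h x (hΩΛ hx))
    _ ≤ gagliardo σ (Ω ×ˢ D) f := by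
        refine (lintegral_mul_wt_le σ Ω D hf).trans (le_of_eq ?_)
        rw [setLIntegral_congr_fun (g := fun _ => 0) hD, lintegral_zero, add_zero]
        intro y hy
        have : y ∉ Λ := fun hyΛ => by
          have := (h y hyΛ y hy).1
          simp at this
          linarith
        simp [hf0 y this]
    _ ≤ _ := gagliardo_mono (prod_subset_Q Ω D) f

/-- Where `|u| ≤ N` and `|e| > η`, pairing with the far ball gives a quotient of `u` bounded by `N`
and one of `e` of size at least `η / R`. The convexity gap is then uniformly positive, so the set of
such points is small; Chebyshev's inequality handles large `|u|`. -/
theorem exists_measure_le_of_energyGap_le (hd : 1 ≤ d) (hs : 0 < s) {Λ : Set (Eucl d)}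
    (hΛ : Bornology.IsBounded Λ) (hΩΛ : Ω ⊆ Λ) (hΩ : MeasurableSet Ω)
    {u : Eucl d → ℝ} (hu : Measurable u) (hu0 : ∀ x ∉ Λ, u x = 0)
    (hu1 : ∫⁻ x in Ω, ENNReal.ofReal |u x| ≠ ∞) {η : ℝ} (hη : 0 < η) {ν : ℝ≥0∞} (hν : 0 < ν) :
    ∃ ε > 0, ∀ e : Eucl d → ℝ, Measurable e → (∀ x ∉ Ω, e x = 0) → energyGap s Ω u e ≤ ε →
      volume {x | η < |e x|} ≤ ν := by
  have hd' : (1 : ℝ) ≤ d := by exact_mod_cast hd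
  obtain ⟨D, R, hD, hD0, hDt, hR, h⟩ := exists_far_ball hd hΛ
  have hDΛ : ∀ y ∈ D, y ∉ Λ := fun y hy hyΛ => by
    have := (h y hyΛ y hy).1
    simp at this
    linarith
  have hν2 : 0 < ν / 2 := ENNReal.half_pos hν.ne'
  obtain ⟨N, hN, hNν⟩ : ∃ N : ℝ, 0 < N ∧ volume {x ∈ Ω | N < |u x|} ≤ ν / 2 := by
    obtain ⟨k, hk, hkν⟩ := exists_pos_mul_le (C := ∫⁻ x in Ω, ENNReal.ofReal |u x|) hu1
      hν2
    obtain ⟨k', hk', hkk'⟩ := exists_between hk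
    have hkt : k' ≠ ∞ := hkk'.ne_top
    refine ⟨(k'⁻¹).toReal, ENNReal.toReal_pos (ENNReal.inv_ne_zero.2 hkt)
      (ENNReal.inv_ne_top.2 hk'.ne'), ?_⟩
    have hm := mul_meas_ge_le_lintegral₀ (μ := volume.restrict Ω)
      (f := fun x => ENNReal.ofReal |u x|) (by fun_prop) k'⁻¹
    have hsub : {x ∈ Ω | (k'⁻¹).toReal < |u x|} ⊆ {x | k'⁻¹ ≤ ENNReal.ofReal |u x|} ∩ Ω := by
      rintro x ⟨hx, hx'⟩
      refine ⟨?_, hx⟩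
      rw [mem_ofPred_eq, ← ENNReal.ofReal_toReal (ENNReal.inv_ne_top.2 hk'.ne')]
      exact ENNReal.ofReal_le_ofReal hx'.le
    rw [Measure.restrict_apply' hΩ] at hm
    calc _ ≤ volume ({x | k'⁻¹ ≤ ENNReal.ofReal |u x|} ∩ Ω) := measure_mono hsub
      _ = k' * (k'⁻¹ * volume ({x | k'⁻¹ ≤ ENNReal.ofReal |u x|} ∩ Ω)) := by
          rw [← mul_assoc, ENNReal.mul_inv_cancel hk'.ne' hkt, one_mul]
      _ ≤ k * ∫⁻ x in Ω, ENNReal.ofReal |u x| := by gcongr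
      _ ≤ ν / 2 := by rw [mul_comm]; exact hkν
  obtain ⟨c, hc, hcgap⟩ := exists_le_convexityGap d s N (div_pos hη hR)
  set c' : ℝ≥0∞ := ENNReal.ofReal c * (ENNReal.ofReal (R ^ (-((d : ℝ) + (2 * s - 1)))) * volume D)
    with hc'
  have hc0 : c' ≠ 0 := mul_ne_zero (by rwa [Ne, ENNReal.ofReal_eq_zero, not_le])
    (mul_ne_zero (by rw [Ne, ENNReal.ofReal_eq_zero, not_le]; positivity) hD0.ne')
  have hct : c' ≠ ∞ := ENNReal.mul_ne_top ENNReal.ofReal_ne_top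
    (ENNReal.mul_ne_top ENNReal.ofReal_ne_top hDt)
  refine ⟨c' * (ν / 2), ENNReal.mul_pos hc0 hν2.ne', fun e he he0 hgap => ?_⟩
  set S := {x ∈ Ω | η < |e x| ∧ |u x| ≤ N} with hS
  have hSm : MeasurableSet S := hΩ.inter
    ((measurableSet_lt measurable_const (by fun_prop : Measurable fun x => |e x|)).inter
      (measurableSet_le (by fun_prop : Measurable fun x => |u x|) measurable_const))
  have hSΩ : S ⊆ Ω := fun x hx => hx.1
  have hSν : volume S ≤ ν / 2 := by
    rw [← ENNReal.mul_le_mul_iff_right hc0 hct]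
    refine le_trans ?_ hgap
    calc c' * volume S = ∫⁻ x in S, c' := by rw [setLIntegral_const]
      _ ≤ ∫⁻ x in S, ENNReal.ofReal c * wt (2 * s - 1) D x := by
          refine setLIntegral_mono' hSm fun x hx => ?_
          rw [hc']
          gcongr
          exact wt_ge (by linarith) hD (h x (hΩΛ (hSΩ hx)))
      _ = ∫⁻ z in S ×ˢ D, ENNReal.ofReal c * ker (d + (2 * s - 1)) (z.1 - z.2) := by
          rw [lintegral_mul_wt (2 * s - 1) S D (f := fun _ => ENNReal.ofReal c) measurable_const]
      _ ≤ ∫⁻ z in S ×ˢ D, ENNReal.ofReal (convexityGap d s (quot u z) (quot u z + quot e z)) *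
            ker (d + 2 * s - 1) (z.1 - z.2) := by
          refine setLIntegral_mono' (hSm.prod hD) fun z hz => ?_
          rw [← add_sub_assoc]
          gcongr ENNReal.ofReal ?_ * _
          obtain ⟨hz1, hz2⟩ := h z.1 (hΩΛ (hSΩ hz.1)) z.2 hz.2
          have hu2 := hu0 z.2 (hDΛ z.2 hz.2)
          have he2 := he0 z.2 (fun hm => hDΛ z.2 hz.2 (hΩΛ hm))
          have hpos : 0 < ‖z.1 - z.2‖ := one_pos.trans_le hz1
          refine hcgap _ _ ?_ ?_
          · rw [quot, hu2, sub_zero, abs_div, abs_norm, div_le_iff₀ hpos]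
            nlinarith [hz.1.2.2]
          · rw [add_sub_cancel_left, quot, he2, sub_zero, abs_div, abs_norm]
            exact div_le_div₀ (abs_nonneg _) hz.1.2.1.le hpos hz2
      _ ≤ energyGap s Ω u e :=
          lintegral_mono_set ((prod_mono_left hSΩ).trans (prod_subset_Q Ω D))
  calc volume {x | η < |e x|} ≤ volume (S ∪ {x ∈ Ω | N < |u x|}) := by
        refine measure_mono fun x hx => ?_
        have hxΩ : x ∈ Ω := by
          by_contra hxΩ
          rw [mem_ofPred_eq, he0 x hxΩ, abs_zero] at hx
          linarith
        rcases le_or_gt |u x| N with h1 | h1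
        · exact Or.inl ⟨hxΩ, hx, h1⟩
        · exact Or.inr ⟨hxΩ, h1⟩
    _ ≤ ν / 2 + ν / 2 := (measure_union_le _ _).trans (add_le_add hSν hNν)
    _ = ν := ENNReal.add_halves ν

/-- Around every point, at least half of a ball of radius `R` consists of `y` with `|e y| ≤ η`.
Averaging `|e x| ≤ |e x - e y| + η` over these `y` bounds the `L¹` norm by multiples of `R^σ M` and
`η`. This takes the place of a compact embedding. -/
theorem exists_lintegral_le_of_measure_le (hd : 1 ≤ d) (hΩ : MeasurableSet Ω)
    (hfin : volume Ω ≠ ∞) {B : Set (Eucl d)} (hΩB : ∀ x ∈ Ω, Metric.ball x 1 ⊆ B)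
    {σ : ℝ} (h0 : 0 < σ) {M : ℝ≥0∞} (hM : M ≠ ∞) {τ : ℝ≥0∞} (hτ : 0 < τ) :
    ∃ (η : ℝ) (ν : ℝ≥0∞), 0 < η ∧ 0 < ν ∧ ∀ e : Eucl d → ℝ, Measurable e →
      gagliardo σ (Ω ×ˢ B) e ≤ M → volume {x | η < |e x|} ≤ ν →
      ∫⁻ x in Ω, ENNReal.ofReal |e x| ≤ τ := by
  have : Nonempty (Fin d) := ⟨⟨0, hd⟩⟩
  have hτ4 : 0 < τ / 2 / 2 := ENNReal.half_pos (ENNReal.half_pos hτ.ne').ne'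
  set V₁ : ℝ≥0∞ := volume (Metric.ball (0 : Eucl d) 1) with hV₁
  have hV₁0 : 0 < V₁ := Metric.measure_ball_pos _ _ one_pos
  have hV₁t : V₁ ≠ ∞ := measure_ball_lt_top.ne
  -- Parameters are fixed in the order `R`, `η`, `ν`. The radius makes the seminorm term small and
  -- is at most 1 so that balls stay in `B`; `ν` will be half the volume of a ball of radius `R`.
  obtain ⟨R, hR, hR1, hRM⟩ : ∃ R : ℝ, 0 < R ∧ R ≤ 1 ∧
      M * ENNReal.ofReal (R ^ σ) ≤ V₁ * (τ / 2 / 2) := by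
    have ht : Tendsto (fun t : ℝ => M * ENNReal.ofReal (t ^ σ)) (𝓝[>] 0) (𝓝 0) := by
      have hc : Continuous fun t : ℝ => ENNReal.ofReal (t ^ σ) :=
        ENNReal.continuous_ofReal.comp (Real.continuous_rpow_const h0.le)
      have := (hc.tendsto 0).mono_left (nhdsWithin_le_nhds (s := Ioi 0))
      rw [Real.zero_rpow h0.ne', ENNReal.ofReal_zero] at this
      simpa using ENNReal.Tendsto.const_mul this (Or.inr hM)
    have h1 := ht.eventually (ge_mem_nhds (ENNReal.mul_pos hV₁0.ne' hτ4.ne'))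
    have h2 : ∀ᶠ t : ℝ in 𝓝[>] 0, t ∈ Ioc 0 1 := Ioc_mem_nhdsGT one_pos
    obtain ⟨R, h1, h2⟩ := (h1.and h2).exists
    exact ⟨R, h2.1, h2.2, h1⟩
  obtain ⟨η, hη, hηΩ⟩ : ∃ η : ℝ, 0 < η ∧ volume Ω * ENNReal.ofReal η ≤ τ / 2 / 2 := by
    obtain ⟨k, hk, hkτ⟩ := exists_pos_mul_le hfin hτ4
    obtain ⟨k', hk', hkk'⟩ := exists_between hk
    refine ⟨k'.toReal, ENNReal.toReal_pos hk'.ne' hkk'.ne_top, le_trans ?_ hkτ⟩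
    rw [ENNReal.ofReal_toReal hkk'.ne_top]
    gcongr
  set V : ℝ≥0∞ := ENNReal.ofReal (R ^ d) * V₁ with hV
  have hVball : ∀ x : Eucl d, volume (Metric.ball x R) = V := fun x => by
    rw [Measure.addHaar_ball _ _ hR.le, finrank_euclideanSpace_fin]
  have hV0 : V ≠ 0 := mul_ne_zero (by rw [Ne, ENNReal.ofReal_eq_zero, not_le]; positivity) hV₁0.ne'
  have hVt : V ≠ ∞ := ENNReal.mul_ne_top ENNReal.ofReal_ne_top hV₁t
  refine ⟨η, V / 2, hη, ENNReal.half_pos hV0, fun e he hgag hν => ?_⟩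
  set E := {x | η < |e x|} with hE
  have hEm : MeasurableSet E := measurableSet_lt measurable_const (by fun_prop)
  have hgm := measurable_gint σ he
  have hpt : ∀ x ∈ Ω, V / 2 * ENNReal.ofReal |e x| ≤
      ENNReal.ofReal (R ^ ((d : ℝ) + σ)) * (∫⁻ y in B, gint σ e (x, y)) +
        ENNReal.ofReal η * V := by
    intro x hx
    have hvol : V / 2 ≤ volume (Metric.ball x R \ E) := by
      have h1 : V / 2 + V / 2 ≤ volume (Metric.ball x R \ E) + V / 2 := by
        rw [ENNReal.add_halves, ← hVball x]
        refine (measure_mono (fun y hy => ?_ : Metric.ball x R ⊆ (Metric.ball x R \ E) ∪ E)).trans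
          ((measure_union_le _ _).trans (add_le_add le_rfl (by rw [hVball x]; exact hν)))
        by_cases hyE : y ∈ E
        · exact Or.inr hyE
        · exact Or.inl ⟨hy, hyE⟩
      exact (ENNReal.add_le_add_iff_right (ENNReal.div_ne_top hVt (by simp))).1 h1
    calc V / 2 * ENNReal.ofReal |e x|
        ≤ ∫⁻ _ in Metric.ball x R \ E, ENNReal.ofReal |e x| := by
          rw [setLIntegral_const, mul_comm]
          gcongr
      _ ≤ ∫⁻ y in Metric.ball x R \ E, (ENNReal.ofReal (R ^ ((d : ℝ) + σ)) * gint σ e (x, y) +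
            ENNReal.ofReal η) := by
          refine setLIntegral_mono' (measurableSet_ball.diff hEm) fun y hy => ?_
          have hy2 : |e y| ≤ η := not_lt.1 hy.2
          have h1 : ENNReal.ofReal |e x| ≤ ENNReal.ofReal |e x - e y| + ENNReal.ofReal η := by
            rw [← ENNReal.ofReal_add (abs_nonneg _) hη.le]
            refine ENNReal.ofReal_le_ofReal ?_
            have := abs_sub_abs_le_abs_sub (e x) (e y)
            linarith
          refine h1.trans (add_le_add ?_ le_rfl)
          rw [gint]
          by_cases hxy : x = y
          · simp [hxy]
          · have hker := ker_anti (α := (d : ℝ) + σ) (by positivity) (sub_ne_zero.2 hxy)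
              (R := R) (by rw [norm_sub_rev]; exact (mem_ball_iff_norm.1 hy.1).le)
            calc ENNReal.ofReal |e x - e y|
                = ENNReal.ofReal (R ^ ((d : ℝ) + σ)) * (ENNReal.ofReal |e x - e y| *
                    ENNReal.ofReal (R ^ (-((d : ℝ) + σ)))) := by
                  rw [mul_left_comm, ← ENNReal.ofReal_mul (by positivity), ← Real.rpow_add hR,
                    add_neg_cancel, Real.rpow_zero, ENNReal.ofReal_one, mul_one]
              _ ≤ _ := by gcongr
      _ ≤ ∫⁻ y in Metric.ball x R, (ENNReal.ofReal (R ^ ((d : ℝ) + σ)) * gint σ e (x, y) +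
            ENNReal.ofReal η) := lintegral_mono_set sdiff_subset
      _ = ENNReal.ofReal (R ^ ((d : ℝ) + σ)) * (∫⁻ y in Metric.ball x R, gint σ e (x, y)) +
            ENNReal.ofReal η * V := by
          rw [lintegral_add_right _ measurable_const, lintegral_const_mul' _ _ (by simp),
            setLIntegral_const, hVball x]
      _ ≤ _ := by
          gcongr
          exact (Metric.ball_subset_ball hR1).trans (hΩB x hx)
  have hV2 : V / 2 ≠ 0 := (ENNReal.half_pos hV0).ne'
  have hV2t : V / 2 ≠ ∞ := ENNReal.div_ne_top hVt (by simp)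
  rw [← ENNReal.mul_le_mul_iff_right hV2 hV2t, ← lintegral_const_mul' _ _ hV2t]
  calc ∫⁻ x in Ω, V / 2 * ENNReal.ofReal |e x|
      ≤ ∫⁻ x in Ω, (ENNReal.ofReal (R ^ ((d : ℝ) + σ)) * (∫⁻ y in B, gint σ e (x, y)) +
        ENNReal.ofReal η * V) := setLIntegral_mono' hΩ hpt
    _ = ENNReal.ofReal (R ^ ((d : ℝ) + σ)) * gagliardo σ (Ω ×ˢ B) e +
        V * (volume Ω * ENNReal.ofReal η) := by
        rw [lintegral_add_right _ measurable_const, lintegral_const_mul' _ _ (by simp),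
          setLIntegral_const, gagliardo_eq, lintegral_prod_restrict hgm]
        ring
    _ ≤ V * (τ / 2 / 2) + V * (τ / 2 / 2) := by
        refine add_le_add ?_ (mul_le_mul_right hηΩ _)
        calc ENNReal.ofReal (R ^ ((d : ℝ) + σ)) * gagliardo σ (Ω ×ˢ B) e
            ≤ ENNReal.ofReal (R ^ ((d : ℝ) + σ)) * M := by gcongr
          _ = ENNReal.ofReal (R ^ d) * (M * ENNReal.ofReal (R ^ σ)) := by
              rw [Real.rpow_add hR, Real.rpow_natCast, ENNReal.ofReal_mul (by positivity)]
              ring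
          _ ≤ ENNReal.ofReal (R ^ d) * (V₁ * (τ / 2 / 2)) := by gcongr
          _ = _ := by rw [hV, mul_assoc]
    _ = V / 2 * τ := by
        rw [← mul_add, ENNReal.add_halves, ENNReal.div_eq_inv_mul, ENNReal.div_eq_inv_mul]
        ring

/-- Pairs closer than `δ` gain `δ^(σ-τ)` from the stronger kernel; for the others the kernel is
bounded and the `L¹` norm suffices. -/
theorem gagliardo_interpolation {τ σ δ : ℝ} (hτ : 0 < τ) (hτσ : τ ≤ σ)
    (hδ : 0 < δ) {f : Eucl d → ℝ} (hf : Measurable f) :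
    gagliardo τ (Ω ×ˢ Ω) f ≤ ENNReal.ofReal (δ ^ (σ - τ)) * gagliardo σ (Ω ×ˢ Ω) f +
      ENNReal.ofReal (δ ^ (-((d : ℝ) + τ))) *
        (2 * (volume Ω * ∫⁻ x in Ω, ENNReal.ofReal |f x|)) := by
  have hgm := measurable_gint σ hf
  have hpt : ∀ z : Eucl d × Eucl d, gint τ f z ≤ ENNReal.ofReal (δ ^ (σ - τ)) * gint σ f z +
      ENNReal.ofReal (δ ^ (-((d : ℝ) + τ))) *
        (ENNReal.ofReal |f z.1| + ENNReal.ofReal |f z.2|) := by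
    intro z
    by_cases hz : z.1 - z.2 = 0
    · rw [sub_eq_zero] at hz
      simp [gint, hz]
    have hp : 0 < ‖z.1 - z.2‖ := norm_pos_iff.2 hz
    rcases le_total ‖z.1 - z.2‖ δ with h | h
    · refine le_trans ?_ le_self_add
      rw [gint, gint, mul_left_comm]
      gcongr
      rw [ker, ker, ← ENNReal.ofReal_mul (by positivity)]
      refine ENNReal.ofReal_le_ofReal ?_
      rw [show -((d : ℝ) + τ) = (σ - τ) + -(d + σ) by ring, Real.rpow_add hp]
      gcongr
    · refine le_trans ?_ le_add_self
      rw [gint, mul_comm]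
      gcongr
      · rw [ker]
        refine ENNReal.ofReal_le_ofReal (Real.rpow_le_rpow_of_nonpos hδ h ?_)
        have : (0 : ℝ) ≤ d := d.cast_nonneg
        linarith
      · rw [← ENNReal.ofReal_add (abs_nonneg _) (abs_nonneg _)]
        exact ENNReal.ofReal_le_ofReal (abs_sub _ _)
  rw [gagliardo_eq, gagliardo_eq]
  refine (lintegral_mono hpt).trans (le_of_eq ?_)
  rw [lintegral_add_left (by fun_prop), lintegral_const_mul' _ _ (by simp),
    lintegral_const_mul' _ _ (by simp), lintegral_add_left (by fun_prop),
    lintegral_prod_restrict (f := fun z => ENNReal.ofReal |f z.1|) (by fun_prop),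
    lintegral_prod_restrict (f := fun z => ENNReal.ofReal |f z.2|) (by fun_prop)]
  simp only [setLIntegral_const]
  rw [lintegral_mul_const _ (by fun_prop)]
  ring

end

/-! ### Convergence of discrete minimizers -/

section

variable {d : ℕ} {s : ℝ} {Ω Λ : Set (Eucl d)}

theorem lintegral_abs_sub_le {A : Set (Eucl d)} {f g : Eucl d → ℝ} (hf : Measurable f) :
    ∫⁻ x in A, ENNReal.ofReal |f x - g x| ≤
      (∫⁻ x in A, ENNReal.ofReal |f x|) + ∫⁻ x in A, ENNReal.ofReal |g x| := by
  rw [← lintegral_add_left (by fun_prop : Measurable fun x => ENNReal.ofReal |f x|)]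
  refine lintegral_mono fun x => ?_
  rw [← ENNReal.ofReal_add (abs_nonneg _) (abs_nonneg _)]
  exact ENNReal.ofReal_le_ofReal (abs_sub _ _)

/-- Discrete minimizers are bounded in the fractional Sobolev space and converge in `L¹`. -/
theorem exists_lintegral_sub_le (hd : 1 ≤ d) (hs0 : 0 < s) (hs1 : s < 1 / 2)
    (hΩ : IsBoundedLipschitzDomain Ω) (hΛ : closure Ω ⊆ interior Λ) (hΛm : MeasurableSet Λ)
    (hΛb : Bornology.IsBounded Λ) {g : Eucl d → ℝ} {G : ℝ} (hg : BddMeas g G)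
    (hgΛ : ∀ x ∉ Λ, g x = 0) {u : Eucl d → ℝ} (hu : Measurable u) (hug : ∀ x ∉ Ω, u x = g x)
    (hu1 : ∫⁻ x in Ω, ENNReal.ofReal |u x| ≠ ∞) (hfin : gagliardo (2 * s) (Q Ω) u ≠ ∞)
    (hmin : ∀ v, Measurable v → (∀ x ∉ Ω, v x = u x) →
      gagliardo (2 * s) (Q Ω) (fun x => v x - u x) ≠ ∞ → energy s Ω u ≤ energy s Ω v) (ρ : ℝ) :
    ∃ M : ℝ≥0∞, M ≠ ∞ ∧ ∀ τ > 0, ∃ δ > 0, ∀ K : Cplx d, IsMesh Λ Ω K → IsRegular ρ K →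
      meshSize K < δ → ∀ uh ∈ feSpaceBC Λ Ω K g,
        (∀ w ∈ feSpaceBC Λ Ω K g, energy s Ω uh ≤ energy s Ω w) →
          gagliardo (2 * s) (Ω ×ˢ Ω) (fun x => u x - uh x) ≤ M ∧
            ∫⁻ x in Ω, ENNReal.ofReal |u x - uh x| ≤ τ := by
  have hσ0 : 0 < 2 * s := by linarith
  have hσ1 : 2 * s < 1 := by linarith
  have hΩm := hΩ.measurableSet
  have hΩΛ : Ω ⊆ Λ := subset_closure.trans (hΛ.trans interior_subset)
  have hu0 : ∀ x ∉ Λ, u x = 0 := fun x hx => by rw [hug x fun h => hx (hΩΛ h), hgΛ x hx]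
  have hΩΩQ : Ω ×ˢ Ω ⊆ Q Ω := prod_subset_Q Ω Ω
  -- The seminorm over `Ω × Ωᶜ` compares `u` with the bounded datum, whose weighted integral is at
  -- most `G` times the fractional perimeter.
  have hW : ∫⁻ x in Ω, ENNReal.ofReal |u x| * wt (2 * s) Ωᶜ x ≠ ∞ := by
    refine ne_top_of_le_ne_top ?_ (lintegral_mul_wt_le (2 * s) Ω Ωᶜ hu)
    refine ENNReal.add_ne_top.2
      ⟨ne_top_of_le_ne_top hfin (gagliardo_mono (prod_subset_Q Ω _) u), ?_⟩
    have : ∫⁻ y in Ωᶜ, ENNReal.ofReal |u y| * wt (2 * s) Ω y ≤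
        ∫⁻ y in Ωᶜ, ENNReal.ofReal G * wt (2 * s) Ω y :=
      setLIntegral_mono' hΩm.compl fun y hy => by
        gcongr
        rw [hug y hy]
        exact hg.2 y
    refine ne_top_of_le_ne_top ?_ this
    rw [lintegral_const_mul' _ _ ENNReal.ofReal_ne_top, ← lintegral_wt_comm]
    exact ENNReal.mul_ne_top ENNReal.ofReal_ne_top (lintegral_wt_compl_ne_top hd hΩ hσ0 hσ1)
  have hEfin : energy s Ω u ≠ ∞ := ne_top_of_le_ne_top (ENNReal.mul_ne_top (by simp) hfin)
    (energy_le_gagliardo hd hs0 u)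
  obtain ⟨R, hR, hΩR⟩ := hΩ.isBounded.subset_closedBall_lt 0 0
  set B : Set (Eucl d) := Metric.ball 0 (R + 1) with hB
  have hnorm : ∀ x ∈ Ω, ‖x‖ ≤ R := fun x hx => mem_closedBall_zero_iff.1 (hΩR hx)
  have hΩB : Ω ⊆ B := fun x hx => mem_ball_zero_iff.2 (by linarith [hnorm x hx])
  have hΩB1 : ∀ x ∈ Ω, Metric.ball x 1 ⊆ B := fun x hx =>
    Metric.ball_subset_ball' (by rw [dist_zero_right]; linarith [hnorm x hx])
  have hker := lintegral_ker_prod_ne_top hd hs0 hs1 hΩm hΩ.volume_ne_top (B := B)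
    measurableSet_ball (R := 2 * R + 1) (by linarith) (fun x hx y hy => by
      have := mem_ball_zero_iff.1 hy
      exact (norm_sub_le _ _).trans (by linarith [hnorm x hx]))
  set c : ℝ≥0∞ := ENNReal.ofReal (F d s 1) with hc
  have hc0 : c ≠ 0 := by
    rw [hc, Ne, ENNReal.ofReal_eq_zero, not_le]
    exact F_pos one_ne_zero
  have hct : c ≠ ∞ := ENNReal.ofReal_ne_top
  -- Coercivity bound for `u + e`, plus the seminorm of `u`. The 4 is the energy excess `2 (2 ε)`
  -- for `ε ≤ 1`, so `M` is fixed before `τ`.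
  set M : ℝ≥0∞ := c⁻¹ * (energy s Ω u + 4 +
    c * ∫⁻ z in Ω ×ˢ B, ker (d + 2 * s - 1) (z.1 - z.2)) + gagliardo (2 * s) (Q Ω) u with hM
  have hMt : M ≠ ∞ := by
    refine ENNReal.add_ne_top.2 ⟨ENNReal.mul_ne_top (ENNReal.inv_ne_top.2 hc0) ?_, hfin⟩
    exact ENNReal.add_ne_top.2 ⟨ENNReal.add_ne_top.2 ⟨hEfin, by simp⟩,
      ENNReal.mul_ne_top hct hker⟩
  refine ⟨1 + M, ENNReal.add_ne_top.2 ⟨ENNReal.one_ne_top, hMt⟩, fun τ hτ => ?_⟩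
  have hτ2 : 0 < τ / 2 := ENNReal.half_pos hτ.ne'
  obtain ⟨η, ν, hη, hν, H₁⟩ := exists_lintegral_le_of_measure_le hd hΩm hΩ.volume_ne_top hΩB1 hσ0
    hMt hτ2
  obtain ⟨ε₁, hε₁, H₂⟩ := exists_measure_le_of_energyGap_le hd hs0 hΛb hΩΛ hΩm hu hu0 hu1 hη hν
  obtain ⟨C, hC, H₃⟩ := exists_lintegral_le_gagliardo hd hΛb hΩΛ hΩm hσ0
  obtain ⟨ε₂, hε₂, hCε₂⟩ := exists_pos_mul_le hC hτ2
  set ε : ℝ≥0∞ := min 1 (min (ε₁ / 2) ε₂) with hε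
  have hε0 : 0 < ε := lt_min one_pos (lt_min (ENNReal.half_pos hε₁.ne') hε₂)
  have hε1 : ε ≤ 1 := min_le_left _ _
  obtain ⟨δ, hδ, H₄⟩ := exists_consistent hd hΩ hΛ hΛm hΛb hσ0 hσ1 hg hgΛ hu hug
    (ne_top_of_le_ne_top hfin (gagliardo_mono hΩΩQ u)) hW ρ hε0
  refine ⟨δ, hδ, fun K hK hr hh uh huh huhmin => ?_⟩
  obtain ⟨w, hw, hwu⟩ := H₄ K hK hr hh
  have hwm := hK.measurable_of_mem hw.1
  have huhm := hK.measurable_of_mem huh.1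
  have hwfin := gagliardo_feSpace_ne_top hd hK hr hσ0 hσ1 hw.1
  have huhfin := gagliardo_feSpace_ne_top hd hK hr hσ0 hσ1 huh.1
  -- Subtracting `w` rather than `u` makes `e` vanish off `Ω`: the exterior data of `u` and `uh`
  -- differ, but `u + e` and `u + e / 2` are admissible competitors for `u`.
  let e : Eucl d → ℝ := fun x => uh x - w x
  have hem : Measurable e := huhm.sub hwm
  have he0 : ∀ x ∉ Ω, e x = 0 := fun x hx => by
    by_cases hxΛ : x ∈ Λ
    · simp only [e, huh.2 ⟨hxΛ, hx⟩, hw.2 ⟨hxΛ, hx⟩, sub_self]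
    · simp only [e, huh.1.2.2 x hxΛ, hw.1.2.2 x hxΛ, sub_self]
  have hefin : gagliardo (2 * s) (Q Ω) e ≠ ∞ := by
    refine ne_top_of_le_ne_top ?_ ((gagliardo_mono (subset_univ _) _).trans
      (gagliardo_sub_le (2 * s) univ huhm))
    exact ENNReal.add_ne_top.2 ⟨huhfin, hwfin⟩
  have huw : gagliardo (2 * s) (Q Ω) (fun x => u x - w x) ≤ ε := by
    rwa [gagliardo_sub_comm]
  have h1 : energy s Ω u ≤ energy s Ω fun x => u x + e x / 2 := by
    refine hmin _ (by fun_prop) (fun x hx => by rw [he0 x hx]; simp) ?_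
    simp only [add_sub_cancel_left]
    exact ne_top_of_le_ne_top hefin (gagliardo_half _ _ _)
  -- Since `u + e - uh = u - w`, the closeness of `w` to `u` is used twice, with discrete minimality
  -- of `uh` against `w` in between.
  have h2 : energy s Ω (fun x => u x + e x) ≤ energy s Ω u + 2 * (2 * ε) := by
    calc energy s Ω (fun x => u x + e x)
        ≤ energy s Ω uh + 2 * gagliardo (2 * s) (Q Ω) (fun x => u x + e x - uh x) :=
          energy_le_add hd hs0 huhm
      _ ≤ energy s Ω w + 2 * ε := by
          refine add_le_add (huhmin w hw) (mul_le_mul_right (le_trans (le_of_eq ?_) huw) _)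
          congr 1
          funext x
          simp only [e]
          ring
      _ ≤ energy s Ω u + 2 * ε + 2 * ε := by
          refine add_le_add_left ?_ _
          exact (energy_le_add hd hs0 hu).trans (by gcongr)
      _ = _ := by ring
  have hgap : energyGap s Ω u e ≤ ε₁ := by
    refine (energyGap_le hu hem hEfin h1 h2).trans ?_
    calc 2 * ε ≤ 2 * (ε₁ / 2) := by
          gcongr
          exact (min_le_right _ _).trans (min_le_left _ _)
      _ ≤ ε₁ := ENNReal.mul_div_le
  have hgagB : gagliardo (2 * s) (Ω ×ˢ B) e ≤ M := by
    have e1 : e = fun x => (u x + e x) - u x := by funext x; ring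
    rw [e1]
    refine (gagliardo_sub_le (2 * s) _ (hu.add hem)).trans
      (add_le_add ?_ (gagliardo_mono (prod_subset_Q Ω B) u))
    rw [← ENNReal.mul_le_mul_iff_right hc0 hct, ← mul_assoc, ENNReal.mul_inv_cancel hc0 hct,
      one_mul]
    refine (gagliardo_prod_le_energy hd hs0 (hu.add hem)).trans (add_le_add_left ?_ _)
    refine h2.trans (add_le_add_right ?_ _)
    calc 2 * (2 * ε) ≤ 2 * (2 * 1) := by gcongr
      _ = 4 := by norm_num
  have hsplit : (fun x => u x - uh x) = fun x => (u x - w x) - e x := by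
    funext x
    simp only [e]
    ring
  constructor
  · rw [hsplit]
    refine (gagliardo_sub_le (2 * s) _ (hu.sub hwm)).trans (add_le_add
      ((gagliardo_mono hΩΩQ _).trans (huw.trans hε1)) ?_)
    exact (gagliardo_mono (prod_mono_right hΩB) _).trans hgagB
  · calc ∫⁻ x in Ω, ENNReal.ofReal |u x - uh x|
        = ∫⁻ x in Ω, ENNReal.ofReal |(u x - w x) - e x| :=
          lintegral_congr fun x => by rw [congrFun hsplit x]
      _ ≤ τ / 2 + τ / 2 := by
          refine (lintegral_abs_sub_le (hu.sub hwm)).trans (add_le_add ?_ ?_)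
          · refine (H₃ _ (hu.sub hwm) (fun x hx => ?_)).trans (le_trans ?_ hCε₂)
            · simp [hu0 x hx, hw.1.2.2 x hx]
            · gcongr
              exact huw.trans ((min_le_right _ _).trans (min_le_right _ _))
          · exact H₁ e hem hgagB (H₂ e hem he0 hgap)
      _ = τ := ENNReal.add_halves τ

theorem eLpNorm_one_eq (v : Eucl d → ℝ) (A : Set (Eucl d)) :
    eLpNorm v 1 (volume.restrict A) = ∫⁻ x in A, ENNReal.ofReal |v x| := by
  rw [eLpNorm_one_eq_lintegral_enorm]
  simp only [Real.enorm_eq_ofReal_abs]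

theorem exists_sobolevNorm_sub_le (hd : 1 ≤ d) (hs0 : 0 < s) (hs1 : s < 1 / 2)
    (hΩ : IsBoundedLipschitzDomain Ω) (hΛ : closure Ω ⊆ interior Λ) (hΛm : MeasurableSet Λ)
    (hΛb : Bornology.IsBounded Λ) {g : Eucl d → ℝ} {G : ℝ} (hg : BddMeas g G)
    (hgΛ : ∀ x ∉ Λ, g x = 0) {u : Eucl d → ℝ} (hu : Measurable u) (hug : ∀ x ∉ Ω, u x = g x)
    (hu1 : ∫⁻ x in Ω, ENNReal.ofReal |u x| ≠ ∞) (hfin : gagliardo (2 * s) (Q Ω) u ≠ ∞)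
    (hmin : ∀ v, Measurable v → (∀ x ∉ Ω, v x = u x) →
      gagliardo (2 * s) (Q Ω) (fun x => v x - u x) ≠ ∞ → energy s Ω u ≤ energy s Ω v) (ρ : ℝ)
    {r : ℝ} (hr0 : 0 ≤ r) (hrs : r < s) {ε : ℝ≥0∞} (hε : 0 < ε) :
    ∃ δ > 0, ∀ K : Cplx d, IsMesh Λ Ω K → IsRegular ρ K → meshSize K < δ →
      ∀ uh ∈ feSpaceBC Λ Ω K g, (∀ w ∈ feSpaceBC Λ Ω K g, energy s Ω uh ≤ energy s Ω w) →
        sobolevNorm (2 * r) Ω (fun x => u x - uh x) ≤ ε := by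
  obtain ⟨M, hM, H⟩ := exists_lintegral_sub_le hd hs0 hs1 hΩ hΛ hΛm hΛb hg hgΛ hu hug hu1 hfin
    hmin ρ
  have hε2 : 0 < ε / 2 := ENNReal.half_pos hε.ne'
  have hε4 : 0 < ε / 2 / 2 := ENNReal.half_pos hε2.ne'
  -- The splitting distance depends only on `M` and `ε`; the required `L¹` accuracy `τ` is chosen
  -- after it.
  obtain ⟨t, ht, htM⟩ : ∃ t : ℝ, 0 < t ∧ M * ENNReal.ofReal (t ^ (2 * s - 2 * r)) ≤ ε / 2 / 2 := by
    have hlim : Tendsto (fun t : ℝ => M * ENNReal.ofReal (t ^ (2 * s - 2 * r))) (𝓝[>] 0)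
        (𝓝 0) := by
      have hc : Continuous fun t : ℝ => ENNReal.ofReal (t ^ (2 * s - 2 * r)) :=
        ENNReal.continuous_ofReal.comp (Real.continuous_rpow_const (by linarith))
      have := (hc.tendsto 0).mono_left (nhdsWithin_le_nhds (s := Ioi 0))
      rw [Real.zero_rpow (by linarith), ENNReal.ofReal_zero] at this
      simpa using ENNReal.Tendsto.const_mul this (Or.inr hM)
    obtain ⟨t, h1, h2⟩ := ((hlim.eventually (ge_mem_nhds hε4)).and self_mem_nhdsWithin).exists
    exact ⟨t, h2, h1⟩
  obtain ⟨τ, hτ, hτε⟩ := exists_pos_mul_le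
    (C := ENNReal.ofReal (t ^ (-((d : ℝ) + 2 * r))) * (2 * volume Ω))
    (ENNReal.mul_ne_top ENNReal.ofReal_ne_top (ENNReal.mul_ne_top (by simp) hΩ.volume_ne_top)) hε4
  obtain ⟨δ, hδ, Hδ⟩ := H (min τ (ε / 2)) (lt_min hτ hε2)
  refine ⟨δ, hδ, fun K hK hr hh uh huh hmin' => ?_⟩
  obtain ⟨h1, h2⟩ := Hδ K hK hr hh uh huh hmin'
  have huhm := hK.measurable_of_mem huh.1
  rw [sobolevNorm, eLpNorm_one_eq, ← ENNReal.add_halves ε]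
  refine add_le_add (h2.trans (min_le_right _ _)) ?_
  split_ifs with h0
  · exact zero_le
  have hrpos : 0 < 2 * r := lt_of_le_of_ne (by linarith) (Ne.symm h0)
  refine (gagliardo_interpolation hrpos (by linarith : 2 * r ≤ 2 * s) ht (hu.sub huhm)).trans ?_
  rw [← ENNReal.add_halves (ε / 2)]
  refine add_le_add ?_ ?_
  · rw [mul_comm]
    refine le_trans ?_ htM
    gcongr
    exact h1
  · refine le_trans ?_ hτε
    rw [mul_assoc, mul_assoc]
    gcongr
    exact h2.trans (min_le_left _ _)

end

section

/-! ### Measurable representatives -/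

variable {d : ℕ} {s : ℝ} {Ω Λ : Set (Eucl d)} {K : Cplx d}

/-- Almost everywhere equal data have the same projection predicate, hence the same chosen
projection. -/
theorem exteriorClement_congr {g g' : Eucl d → ℝ} (h : ∀ᵐ x, g x = g' x) :
    exteriorClement K Ω g = exteriorClement K Ω g' := by
  have h1 : ∀ A : Set (Eucl d), l2Proj A g = l2Proj A g' := fun A => by
    have : IsL2Proj A g = IsL2Proj A g' := by
      funext q
      refine forall_congr fun p => ?_
      rw [integral_congr_ae]
      filter_upwards [ae_restrict_of_ae h] with x hx
      rw [hx]
    rw [l2Proj, this, l2Proj]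
  funext x
  simp only [exteriorClement, h1]

theorem feSpaceBC_congr {g g' : Eucl d → ℝ} (h : ∀ᵐ x, g x = g' x) :
    feSpaceBC Λ Ω K g = feSpaceBC Λ Ω K g' := by
  rw [feSpaceBC, exteriorClement_congr h, feSpaceBC]

theorem sub_mem_feSpace {v w : Eucl d → ℝ} (hv : v ∈ feSpace Λ K) (hw : w ∈ feSpace Λ K) :
    (fun x => v x - w x) ∈ feSpace Λ K := by
  refine ⟨hv.1.sub hw.1, fun t ht => ?_, fun x hx => by simp [hv.2.2 x hx, hw.2.2 x hx]⟩
  obtain ⟨q, hq⟩ := hv.2.1 t ht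
  obtain ⟨q', hq'⟩ := hw.2.1 t ht
  exact ⟨q - q', fun x hx => by simp [hq hx, hq' hx]⟩

theorem sub_mem_feSpaceBC (hK : IsMesh Λ Ω K) (hΩ : IsBoundedLipschitzDomain Ω)
    (hΛ : closure Ω ⊆ interior Λ) {g v w : Eucl d → ℝ} (hv : v ∈ feSpaceBC Λ Ω K g)
    (hw : w ∈ feSpaceBC Λ Ω K g) : (fun x => v x - w x) ∈ feSpaceBC Λ Ω K 0 := by
  refine ⟨sub_mem_feSpace hv.1 hw.1, fun x hx => ?_⟩
  have h0 : BddMeas (0 : Eucl d → ℝ) 0 := ⟨measurable_const, fun x => by simp⟩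
  -- The a priori bound with `M = 0` shows that the Clément interpolant of zero vanishes off `Ω`.
  have h := hK.abs_interp_le_of_notMem hΩ hΛ h0 0 hx.2
  rw [mul_zero, (interp_mem hK hΩ hΛ 0 0).2 hx] at h
  rw [abs_eq_zero.1 (le_antisymm h (abs_nonneg _))]
  simp only [hv.2 hx, hw.2 hx, sub_self]

theorem energy_le_of_mem_feSpaceBC (hd : 1 ≤ d) (hs0 : 0 < s) (hs1 : s < 1 / 2)
    (hK : IsMesh Λ Ω K) (hΩ : IsBoundedLipschitzDomain Ω) (hΛ : closure Ω ⊆ interior Λ) {ρ : ℝ}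
    (hr : IsRegular ρ K) {g uh : Eucl d → ℝ}
    (h : IsWeakSolutionOver s Ω (feSpaceBC Λ Ω K g) (feSpaceBC Λ Ω K 0) uh ∨
      IsMinimizerOver s Ω (feSpaceBC Λ Ω K g) uh) :
    uh ∈ feSpaceBC Λ Ω K g ∧ ∀ w ∈ feSpaceBC Λ Ω K g, energy s Ω uh ≤ energy s Ω w := by
  rcases h with h | h
  · refine ⟨h.1, fun w hw => ?_⟩
    have hsub := sub_mem_feSpaceBC hK hΩ hΛ hw h.1
    refine energy_le_of_form_eq_zero hd hs0 (hK.measurable_of_mem h.1.1)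
      (hK.measurable_of_mem hw.1) ?_ (h.2 _ hsub)
    exact ne_top_of_le_ne_top (gagliardo_feSpace_ne_top hd hK hr (by linarith) (by linarith) hsub.1)
      (gagliardo_mono (subset_univ _) _)
  · exact h

theorem mem_energySpace {g v : Eucl d → ℝ} (hv : Measurable v)
    (h1 : ∫⁻ x in Ω, ENNReal.ofReal |v x| ≠ ∞) (hg : ∀ᵐ x, x ∉ Ω → v x = g x)
    (h2 : gagliardo (2 * s) (Q Ω) v ≠ ∞) : v ∈ energySpace s Ω g := by
  refine ⟨⟨hv.aestronglyMeasurable, ?_⟩, hg, h2.lt_top⟩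
  rw [sobolevNorm, eLpNorm_one_eq]
  refine ENNReal.add_lt_top.2 ⟨h1.lt_top, ?_⟩
  split_ifs
  · exact ENNReal.zero_lt_top
  · exact (gagliardo_mono (prod_subset_Q Ω Ω) v).trans_lt h2.lt_top

theorem exists_bounded_representative (hΛm : MeasurableSet Λ) {g : Eucl d → ℝ}
    (hg : MemLp g ∞ volume) (hgΛ : ∀ᵐ x, x ∉ Λ → g x = 0) :
    ∃ (g' : Eucl d → ℝ) (G : ℝ), BddMeas g' G ∧ (∀ x ∉ Λ, g' x = 0) ∧ ∀ᵐ x, g x = g' x := by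
  classical
  set G : ℝ := (eLpNorm g ∞ volume).toReal with hG
  have hG0 : 0 ≤ G := ENNReal.toReal_nonneg
  have hbd : ∀ᵐ x, |g x| ≤ G := by
    have h := ae_le_eLpNormEssSup (f := g) (μ := volume)
    filter_upwards [h] with x hx
    rw [← eLpNorm_exponent_top, Real.enorm_eq_ofReal_abs] at hx
    exact (ENNReal.ofReal_le_iff_le_toReal hg.2.ne).1 hx
  have hm : Measurable fun x => clamp G (hg.1.mk g x) :=
    (continuous_clamp G).measurable.comp hg.1.stronglyMeasurable_mk.measurable
  refine ⟨Λ.indicator fun x => clamp G (hg.1.mk g x), G, ⟨hm.indicator hΛm, fun x => ?_⟩,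
    fun x hx => indicator_of_notMem hx _, ?_⟩
  · by_cases hx : x ∈ Λ
    · rw [indicator_of_mem hx]; exact abs_clamp_le hG0 _
    · rw [indicator_of_notMem hx, abs_zero]; exact hG0
  · filter_upwards [hbd, hgΛ, hg.1.ae_eq_mk] with x h1 h2 h3
    by_cases hx : x ∈ Λ
    · rw [indicator_of_mem hx, ← h3, clamp_of_le h1]
    · rw [indicator_of_notMem hx, h2 hx]

theorem exists_measurable_representative (hΩm : MeasurableSet Ω) {g g' u : Eucl d → ℝ}
    (hg' : Measurable g') (hgg' : ∀ᵐ x, g x = g' x) (hu : u ∈ energySpace s Ω g) :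
    ∃ u' : Eucl d → ℝ, Measurable u' ∧ (∀ x ∉ Ω, u' x = g' x) ∧ ∀ᵐ x, u x = u' x := by
  classical
  refine ⟨Ω.piecewise (hu.1.1.mk u) g', hu.1.1.stronglyMeasurable_mk.measurable.piecewise hΩm hg',
    fun x hx => piecewise_eq_of_notMem _ _ _ hx, ?_⟩
  filter_upwards [hu.2.1, hgg', (ae_restrict_iff' hΩm).1 hu.1.1.ae_eq_mk] with x h1 h2 h3
  by_cases hx : x ∈ Ω
  · rw [piecewise_eq_of_mem _ _ _ hx, h3 hx]
  · rw [piecewise_eq_of_notMem _ _ _ hx, h1 hx, h2]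

theorem sobolevNorm_congr (σ : ℝ) (Ω : Set (Eucl d)) {v w : Eucl d → ℝ} (h : ∀ᵐ x, v x = w x) :
    sobolevNorm σ Ω v = sobolevNorm σ Ω w := by
  rw [sobolevNorm, sobolevNorm, gagliardo_congr _ _ h, eLpNorm_congr_ae (ae_restrict_of_ae h)]

/-- For a weak solution, the difference `v - u'` is a test function by the Poincaré inequality and
convexity applies; for a minimizer, `v` itself belongs to the trial class. -/
theorem energy_le_of_mem_energySpace (hd : 1 ≤ d) (hs0 : 0 < s)
    (hΩ : IsBoundedLipschitzDomain Ω) {g u u' : Eucl d → ℝ}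
    (hu : IsWeakSolutionOver s Ω (energySpace s Ω g) (energySpace s Ω 0) u ∨
      IsMinimizerOver s Ω (energySpace s Ω g) u)
    (hu' : Measurable u') (huu' : ∀ᵐ x, u x = u' x) {v : Eucl d → ℝ} (hv : Measurable v)
    (hvu : ∀ x ∉ Ω, v x = u' x) (hfin : gagliardo (2 * s) (Q Ω) (fun x => v x - u' x) ≠ ∞) :
    energy s Ω u' ≤ energy s Ω v := by
  have hmem : u ∈ energySpace s Ω g := hu.elim (·.1) (·.1)
  obtain ⟨C, hC, H⟩ := exists_lintegral_le_gagliardo hd hΩ.isBounded le_rfl hΩ.measurableSet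
    (σ := 2 * s) (by linarith)
  have hsub1 : ∫⁻ x in Ω, ENNReal.ofReal |v x - u' x| ≠ ∞ :=
    ne_top_of_le_ne_top (ENNReal.mul_ne_top hC hfin)
      (H _ (hv.sub hu') fun x hx => by simp [hvu x hx])
  rcases hu with h | h
  · refine energy_le_of_form_eq_zero hd hs0 hu' hv hfin ?_
    rw [← h.2 (fun x => v x - u' x) (mem_energySpace (hv.sub hu') hsub1
      (ae_of_all _ fun x hx => by simp [hvu x hx]) hfin)]
    exact (form_congr s Ω huu' (ae_of_all _ fun _ => rfl)).symm
  · rw [← energy_congr s Ω huu']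
    have e : v = fun x => (v x - u' x) + u' x := by funext x; ring
    refine h.2 v (mem_energySpace hv ?_ ?_ ?_)
    · have h1 : ∫⁻ x in Ω, ENNReal.ofReal |u' x| ≠ ∞ := by
        rw [← eLpNorm_one_eq, ← eLpNorm_congr_ae (ae_restrict_of_ae huu')]
        exact (le_self_add.trans_lt hmem.1.2).ne
      have h2 := lintegral_abs_sub_le (A := Ω) (f := fun x => v x - u' x) (g := fun x => -u' x)
        (hv.sub hu')
      simp only [abs_neg, sub_neg_eq_add, sub_add_cancel] at h2
      exact ne_top_of_le_ne_top (ENNReal.add_ne_top.2 ⟨hsub1, h1⟩) h2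
    · filter_upwards [hmem.2.1, huu'] with x h1 h2 hx
      rw [hvu x hx, ← h2, h1 hx]
    · rw [e]
      refine ne_top_of_le_ne_top ?_ (gagliardo_add_le (2 * s) _ (hv.sub hu'))
      refine ENNReal.add_ne_top.2 ⟨hfin, ?_⟩
      rw [← gagliardo_congr _ _ huu']
      exact hmem.2.2.ne

end

end NonlocalGraph

end

theorem mainTheorem1 {d : ℕ} (hd : 1 ≤ d) {s : ℝ} (hs0 : 0 < s) (hs1 : s < 1 / 2)
    {Ω Λ : Set (NonlocalGraph.Eucl d)} (hΩ : NonlocalGraph.IsBoundedLipschitzDomain Ω)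
    (hΛ : closure Ω ⊆ interior Λ)
    {g : NonlocalGraph.Eucl d → ℝ} (hg : MemLp g ∞ volume) (hgΛ : ∀ᵐ x, x ∉ Λ → g x = 0)
    {u : NonlocalGraph.Eucl d → ℝ}
    (hu : NonlocalGraph.IsWeakSolutionOver s Ω (NonlocalGraph.energySpace s Ω g)
        (NonlocalGraph.energySpace s Ω 0) u ∨
      NonlocalGraph.IsMinimizerOver s Ω (NonlocalGraph.energySpace s Ω g) u)
    {ι : Type*} {l : Filter ι} {T : ι → NonlocalGraph.Cplx d}
    (hT : ∀ i, NonlocalGraph.IsMesh Λ Ω (T i))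
    (hreg : ∃ σ : ℝ, ∀ i, ∀ t ∈ NonlocalGraph.cells (T i),
      Metric.diam (NonlocalGraph.elt t) ≤ σ * NonlocalGraph.inDiam (NonlocalGraph.elt t))
    (hh : Tendsto (fun i => NonlocalGraph.meshSize (T i)) l (𝓝 0))
    {uh : ι → NonlocalGraph.Eucl d → ℝ}
    (huh : ∀ i, NonlocalGraph.IsWeakSolutionOver s Ω (NonlocalGraph.feSpaceBC Λ Ω (T i) g)
        (NonlocalGraph.feSpaceBC Λ Ω (T i) 0) (uh i) ∨
      NonlocalGraph.IsMinimizerOver s Ω (NonlocalGraph.feSpaceBC Λ Ω (T i) g) (uh i))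
    {r : ℝ} (hr0 : 0 ≤ r) (hrs : r < s) :
    Tendsto (fun i => NonlocalGraph.sobolevNorm (2 * r) Ω (fun x => u x - uh i x)) l (𝓝 0) := by
  open NonlocalGraph in
  obtain ⟨ρ, hρ⟩ := hreg
  -- Measurability and boundedness of `Λ` are read off one mesh; without any index the filter is
  -- trivial.
  rcases isEmpty_or_nonempty ι with hι | ⟨⟨i₀⟩⟩
  · rw [filter_eq_bot_of_isEmpty l]
    exact tendsto_bot
  have hΛm := (hT i₀).measurableSet
  have hΛb := (hT i₀).isBounded
  obtain ⟨g', G, hg', hg'Λ, hgg'⟩ := exists_bounded_representative hΛm hg hgΛ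
  have hmem : u ∈ energySpace s Ω g := hu.elim (·.1) (·.1)
  obtain ⟨u', hu', hu'g, huu'⟩ := exists_measurable_representative hΩ.measurableSet hg'.1 hgg' hmem
  refine ENNReal.tendsto_nhds_zero.2 fun ε hε => ?_
  have hu1 : ∫⁻ x in Ω, ENNReal.ofReal |u' x| ≠ ∞ := by
    rw [← eLpNorm_one_eq, ← eLpNorm_congr_ae (ae_restrict_of_ae huu')]
    exact (le_self_add.trans_lt hmem.1.2).ne
  have hfin : gagliardo (2 * s) (Q Ω) u' ≠ ∞ := by
    rw [← gagliardo_congr _ _ huu']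
    exact hmem.2.2.ne
  obtain ⟨δ, hδ, H⟩ := exists_sobolevNorm_sub_le hd hs0 hs1 hΩ hΛ hΛm hΛb hg' hg'Λ hu' hu'g hu1
    hfin (fun v hv hvu hvfin => energy_le_of_mem_energySpace hd hs0 hΩ hu hu' huu' hv hvu hvfin)
    ρ hr0 hrs hε
  filter_upwards [hh.eventually (gt_mem_nhds hδ)] with i hi
  have hmin := energy_le_of_mem_feSpaceBC hd hs0 hs1 (hT i) hΩ hΛ (hρ i) (huh i)
  rw [feSpaceBC_congr hgg'] at hmin
  rw [sobolevNorm_congr (w := fun x => u' x - uh i x)]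
  · exact H (T i) (hT i) (hρ i) hi (uh i) hmin.1 hmin.2
  · filter_upwards [huu'] with x hx
    rw [hx]
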